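/- Let $G=(\mathcal R\cup\mathcal H,E)$ be a finite bipartite graph with strict preference lists on both sides, in which every hospital $h$ has an upper quota $q^+(h)$ and a lower quota $q^-(h)$. A matching is a set $M\subseteq E$ with $|M(r)|\le 1$ for $r\in\mathcal R$ and $|M(h)|\le q^+(h)$ for $h\in\mathcal H$; it is feasible if also $|M(h)|\ge q^-(h)$ for all $h$. Assume that $G$ admits a feasible matching. **Reduction.** Put $n=|\mathcal R|$ and $\ell=n+\sum_h q^-(h)$. The Hospital Residents instance $G''$ has copies $h^0,\dots,h^{\ell-1}$ of each hospital $h$, where $h^s$ has capacity $q^+(h)$ for $s<n$ and $q^-(h)$ for $s\ge n$. Its residents are $\mathcal R$ together with dummies $d^s_{h,1},d^s_{h,2},\dots$ for $0\le s\le \ell-2$, as many as the capacity of $h^s$; let $D^s_h$ be the list of these in increasing order of index. A resident $r\in\mathcal R$ has the list $\mathrm{list}_r^{\ell-1}\circ\dots\circ \mathrm{list}_r^{0}$, where $\mathrm{list}_r^{s}$ is its list in $G$ with every $h$ replaced by $h^s$. The dummy $d^s_{h,i}$ has the list $\langle h^s,h^{s+1}\rangle$, except that it is $\langle h^s\rangle$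 if $s=n-1$ and $i\le q^+(h)-q^-(h)$. The copy $h^s$ has the list $\widehat D^{s-1}_h\circ \mathrm{list}_h\circ D^s_h$, where $\widehat D^{s-1}_h$ is $D^{s-1}_h$ without the dummies that do not list $h^s$, and where $\widehat D^{-1}_h$ and $D^{\ell-1}_h$ are empty. For a stable matching $M''$ of $G''$, the set $\mathrm{map}(M'')$ consists of the edges $(r,h)$ such that $M''$ matches $r\in\mathcal R$ to some copy of $h$. **Votes.** $\mathrm{vote}_u(x,y)$ is $1$, $-1$ or $0$ according to whether $u$ prefers $x$ to $y$, prefers $y$ to $x$, or $x=y$; every neighbour is preferred to $\bot$. For matchings $M_1,M_2$, $\mathrm{vote}_r(M_1,M_2)=\mathrm{vote}_r(M_1(r),M_2(r))$ for a resident $r$, where $M_i(r)=\bot$ if $r$ is unmatched. Each hospital $h$ chooses an arbitrary bijective correspondence $\mathbf{corr}_h$ between $M_1(h)\setminus M_2(h)$ and $M_2(h)\setminus M_1(h)$, the smaller of the two being padded with copies of $\bot$, and the same correspondence is used when $M_1$ and $M_2$ are exchanged; $\mathrm{vote}_h(M_1,M_2)$ is the sum of $\mathrm{vote}_h$ over the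 corresponding pairs. Let $\Delta(M_1,M_2)=\sum_{v\in\mathcal R\cup\mathcal H}\mathrm{vote}_v(M_1,M_2)$; $M_1$ is more popular than $M_2$ if $\Delta(M_1,M_2)>\Delta(M_2,M_1)$. **Decomposition.** For a feasible matching $N$, the edges of $M\oplus N$ are decomposed into (possibly non-simple) maximal alternating paths and cycles, by making consecutive the two edges at a resident, and, at a hospital, an edge of $M\setminus N$ and an edge of $N\setminus M$ whose residents correspond to each other under a correspondence between $M(h)\setminus N(h)$ and $N(h)\setminus M(h)$ as above. An end-point of a path counts as matched in $M$ if the terminal edge of the path there is in $M$. **Theorem.** Let $M''$ be any stable matching of $G''$ and $M=\mathrm{map}(M'')$. 1. Let $N$ be a feasible matching, and let $\rho$ be an alternating cycle, or an alternating path with exactly one end-point matched in $M$, in the decomposition of $M\oplus N$. Then $M\oplus\rho$ is a feasible matching and $\Delta(M\oplus\rho,M)\le\Delta(M,M\oplus\rho)$. This holds for every choice of the correspondences, and the ones used for decomposing may differ from the ones used for voting. 2. For every choice of the correspondences, $M$ is popular among the maximum-cardinality feasible matchings: $M$ is feasible, no feasible matching has more edges, and no maximum-cardinality feasible matching is more popular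 than $M$. 3. Such an $M$ is computable in polynomial time: there are a program of a random access machine (unit-cost addition and truncated subtraction of natural numbers, indirect load and store, branches and loops) and a polynomial $p$ such that, for every instance $G$ that admits a feasible matching, given as a sequence of $L$ numbers (the numbers of residents and hospitals, the quotas, and the preference lists preceded by their lengths), the program halts after at most $p(L)$ steps with output $\mathrm{map}(M'')$ for some stable matching $M''$ of $G''$. -/

import Mathlib

open scoped symmDiff

universe u v

/-- A Hospital Residents instance: strict preference lists of residents and hospitals (which
determine the edges of the bipartite graph) and capacities of the hospitals. -/
structure HR (R : Type u) (H : Type v) where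
  resList : R → List H
  hospList : H → List R
  upper : H → ℕ
  resList_nodup : ∀ r, (resList r).Nodup
  hospList_nodup : ∀ h, (hospList h).Nodup
  mem_iff : ∀ r h, h ∈ resList r ↔ r ∈ hospList h

/-- A Hospital Residents instance with lower quotas; `upper` and `lower` are `q⁺` and `q⁻`. -/
structure HRLQ (R : Type u) (H : Type v) extends HR R H where
  lower : H → ℕ

/-- On a preference list, `x` is strictly preferred to `y`. -/
def Prefers {α : Type*} [DecidableEq α] (l : List α) (x y : α) : Prop :=
  x ∈ l ∧ y ∈ l ∧ l.idxOf x < l.idxOf y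

instance {α : Type*} [DecidableEq α] (l : List α) (x y : α) : Decidable (Prefers l x y) := by
  unfold Prefers; infer_instance

/-- `vote_u(x, y)` for a vertex `u` with preference list `l`; `none` is `⊥`. -/
def vote {α : Type*} [DecidableEq α] (l : List α) : Option α → Option α → ℤ
  | some x, some y => if Prefers l x y then 1 else if Prefers l y x then -1 else 0
  | some _, none => 1
  | none, some _ => -1
  | none, none => 0

section Sets

variable {R : Type u} {H : Type v} [DecidableEq R] [DecidableEq H]

/-- `M(h)`: the residents assigned to `h`. -/
def residentsOf (M : Finset (R × H)) (h : H) : Finset R :=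
  (M.filter (fun e => e.2 = h)).image Prod.fst

open Classical in
/-- `M(r)`: the hospital of `r`, or `none` (`⊥`) if `r` is unmatched. -/
noncomputable def partner (M : Finset (R × H)) (r : R) : Option H :=
  if hx : ∃ h, (r, h) ∈ M then some hx.choose else none

/-- A matching of an HR instance: a set of edges respecting the capacities. -/
def HR.IsMatching (G : HR R H) (M : Finset (R × H)) : Prop :=
  (∀ e ∈ M, e.2 ∈ G.resList e.1) ∧
  (∀ r h h', (r, h) ∈ M → (r, h') ∈ M → h = h') ∧
  (∀ h, (residentsOf M h).card ≤ G.upper h)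

/-- The edge `(r, h)` blocks `M`. -/
def HR.Blocks (G : HR R H) (M : Finset (R × H)) (r : R) (h : H) : Prop :=
  h ∈ G.resList r ∧
  ((∀ h', (r, h') ∉ M) ∨ ∃ h', (r, h') ∈ M ∧ Prefers (G.resList r) h h') ∧
  ((residentsOf M h).card < G.upper h ∨ ∃ r' ∈ residentsOf M h, Prefers (G.hospList h) r r')

def HR.IsStable (G : HR R H) (M : Finset (R × H)) : Prop :=
  G.IsMatching M ∧ ∀ r h, ¬ G.Blocks M r h

def HRLQ.IsFeasible (G : HRLQ R H) (M : Finset (R × H)) : Prop :=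
  G.toHR.IsMatching M ∧ ∀ h, G.lower h ≤ (residentsOf M h).card

def HRLQ.IsMaxFeasible (G : HRLQ R H) (M : Finset (R × H)) : Prop :=
  G.IsFeasible M ∧ ∀ N, G.IsFeasible N → N.card ≤ M.card

/-- The correspondences `corr_h(·, M₁, M₂)` chosen by the hospitals: for every hospital `h` and
all `M₁, M₂` an arbitrary pairing of `M₁(h) \ M₂(h)` with `M₂(h) \ M₁(h)`. The smaller of the
two sets is padded with `⊥` (`none`), so only the larger one has elements paired with `⊥`. -/
structure Correspondence (R : Type u) (H : Type v) [DecidableEq R] [DecidableEq H] where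
  corr : H → Finset (R × H) → Finset (R × H) → R → Option R
  pairing : ∀ h M₁ M₂ r r', r ∈ residentsOf M₁ h \ residentsOf M₂ h →
    corr h M₁ M₂ r = some r' →
    r' ∈ residentsOf M₂ h \ residentsOf M₁ h ∧ corr h M₂ M₁ r' = some r
  one_sided : ∀ h M₁ M₂ r r', r ∈ residentsOf M₁ h \ residentsOf M₂ h →
    r' ∈ residentsOf M₂ h \ residentsOf M₁ h →
    ¬ (corr h M₁ M₂ r = none ∧ corr h M₂ M₁ r' = none)

/-- `vote_h(M₁, M₂)`: the residents of `M₁(h) \ M₂(h)` are compared with their correspondents,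
and the empty positions of `M₁` with the residents of `M₂(h) \ M₁(h)` paired with `⊥`. -/
def HR.hospVote (G : HR R H) (τ : Correspondence R H) (M₁ M₂ : Finset (R × H)) (h : H) : ℤ :=
  ∑ r ∈ residentsOf M₁ h \ residentsOf M₂ h,
      vote (G.hospList h) (some r) (τ.corr h M₁ M₂ r) +
    ∑ r ∈ (residentsOf M₂ h \ residentsOf M₁ h).filter (fun r => τ.corr h M₂ M₁ r = none),
      vote (G.hospList h) none (some r)

/-- `Δ(M₁, M₂)`: the sum of the votes of all vertices for `M₁` against `M₂`. -/
noncomputable def HR.votes [Fintype R] [Fintype H] (G : HR R H) (τ : Correspondence R H)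
    (M₁ M₂ : Finset (R × H)) : ℤ :=
  ∑ r, vote (G.resList r) (partner M₁ r) (partner M₂ r) + ∑ h, G.hospVote τ M₁ M₂ h

def HR.MorePopular [Fintype R] [Fintype H] (G : HR R H) (τ : Correspondence R H)
    (M₁ M₂ : Finset (R × H)) : Prop :=
  G.votes τ M₁ M₂ > G.votes τ M₂ M₁

/-- `M` is a maximum-cardinality feasible matching, and no maximum-cardinality feasible matching
is more popular. -/
def HRLQ.IsPopularAmongMaxFeasible [Fintype R] [Fintype H] (G : HRLQ R H)
    (τ : Correspondence R H) (M : Finset (R × H)) : Prop :=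
  G.IsMaxFeasible M ∧ ∀ N, G.IsMaxFeasible N → ¬ G.toHR.MorePopular τ N M

/-- Two edges of `M ⊕ N` are consecutive in the decomposition of `M ⊕ N`: they are the two edges
at a resident, or an edge of `M` and an edge of `N` at a hospital whose residents correspond to
each other. -/
def Linked (σ : Correspondence R H) (M N : Finset (R × H)) (e f : R × H) : Prop :=
  e ∈ M ∆ N ∧ f ∈ M ∆ N ∧ e ≠ f ∧
  (e.1 = f.1 ∨ e.2 = f.2 ∧
    ((e ∈ M ∧ f ∈ N ∧ σ.corr e.2 M N e.1 = some f.1) ∨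
     (e ∈ N ∧ f ∈ M ∧ σ.corr e.2 M N f.1 = some e.1)))

/-- The list of edges `ρ` closes up (at least three edges are required, as the two edges of a
path of length two are linked to each other). -/
def ClosesUp (σ : Correspondence R H) (M N : Finset (R × H)) (ρ : List (R × H)) : Prop :=
  2 < ρ.length ∧ ∀ e ∈ ρ.getLast?, ∀ f ∈ ρ.head?, Linked σ M N e f

/-- `ρ` lists the edges of an alternating cycle of the decomposition of `M ⊕ N`. -/
def IsAltCycle (σ : Correspondence R H) (M N : Finset (R × H)) (ρ : List (R × H)) : Prop :=
  ρ.Nodup ∧ ρ.IsChain (Linked σ M N) ∧ ClosesUp σ M N ρ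

/-- `ρ` lists the edges of a (maximal) alternating path of the decomposition of `M ⊕ N`. -/
def IsAltPath (σ : Correspondence R H) (M N : Finset (R × H)) (ρ : List (R × H)) : Prop :=
  ρ ≠ [] ∧ ρ.Nodup ∧ (∀ e ∈ ρ, e ∈ M ∆ N) ∧ ρ.IsChain (Linked σ M N) ∧ ¬ ClosesUp σ M N ρ ∧
  ∀ e ∈ ρ, ∀ f, Linked σ M N e f → f ∈ ρ

/-- Exactly one end-point of the path `ρ` is matched in `M`. The position of an end-point on the
path is matched in `M` if and only if the terminal edge of `ρ` there belongs to `M`: at a terminal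
edge of `N` the end-point is an unmatched resident, or a hospital with an empty position in `M`. -/
def OneEndMatched (M : Finset (R × H)) (ρ : List (R × H)) : Prop :=
  ∃ e ∈ ρ.head?, ∃ f ∈ ρ.getLast?, Xor (e ∈ M) (f ∈ M)

end Sets

section Reduction

variable {R : Type u} {H : Type v} [Fintype R] [Fintype H]

/-- The number `ℓ` of copies of each hospital. -/
def HRLQ.numLevels (G : HRLQ R H) : ℕ := Fintype.card R + ∑ h, G.lower h

/-- The capacity of the level-`s` copy of `h`, also the number of its level-`s` dummies. -/
def HRLQ.levelCap (G : HRLQ R H) (h : H) (s : ℕ) : ℕ :=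
  if s < Fintype.card R then G.upper h else G.lower h

/-- The dummy residents `d^s_{h,i}` with `0 ≤ s ≤ ℓ - 2` and (counting from zero)
`0 ≤ i < levelCap h s`. -/
abbrev HRLQ.Dummy (G : HRLQ R H) : Type v :=
  Σ h : H, Σ s : Fin (G.numLevels - 1), Fin (G.levelCap h s)

/-- The residents of the reduced instance. -/
abbrev HRLQ.Res (G : HRLQ R H) : Type (max u v) := R ⊕ G.Dummy

/-- The hospitals of the reduced instance; `(h, s)` is the level-`s` copy of `h`. -/
abbrev HRLQ.Copy (G : HRLQ R H) : Type v := H × Fin G.numLevels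

/-- The list of the level-`s` dummies of `h` with index at least `k`, in increasing order. -/
def HRLQ.dummies (G : HRLQ R H) (h : H) (s : Fin (G.numLevels - 1)) (k : ℕ) : List G.Res :=
  ((List.finRange (G.levelCap h s)).filter (fun i => k ≤ i.val)).map (fun i => Sum.inr ⟨h, s, i⟩)

/-- The number of first level-`s` dummies of `h` that list only the level-`s` copy: it is
`q⁺(h) - q⁻(h)` at the last level of capacity `q⁺(h)`, and zero at the other levels. -/
def HRLQ.numShort (G : HRLQ R H) (h : H) (s : ℕ) : ℕ :=
  if s + 1 = Fintype.card R then G.upper h - G.lower h else 0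

/-- Preference lists of the residents: `list_r^{ℓ-1} ∘ ⋯ ∘ list_r^0` for a resident `r`,
`⟨h^s⟩` or `⟨h^s, h^{s+1}⟩` for a dummy. -/
def HRLQ.redResList (G : HRLQ R H) : G.Res → List G.Copy
  | Sum.inl r => (List.finRange G.numLevels).reverse.flatMap
      (fun s => (G.resList r).map (fun h => (h, s)))
  | Sum.inr ⟨h, s, i⟩ =>
      if i.val < G.numShort h s then [(h, ⟨s.val, by omega⟩)]
      else [(h, ⟨s.val, by omega⟩), (h, ⟨s.val + 1, by omega⟩)]

/-- Preference list of `h^s`: the level-`(s-1)` dummies that list it, then `list_h`, then the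
level-`s` dummies. -/
def HRLQ.redHospList (G : HRLQ R H) (c : G.Copy) : List G.Res :=
  (if hs : 0 < c.2.val then
      G.dummies c.1 ⟨c.2.val - 1, by omega⟩ (G.numShort c.1 (c.2.val - 1)) else []) ++
  ((G.hospList c.1).map Sum.inl ++
  (if hs : c.2.val + 1 < G.numLevels then G.dummies c.1 ⟨c.2.val, by omega⟩ 0 else []))

theorem HRLQ.mem_dummies (G : HRLQ R H) (x : G.Res) (h : H) (s : Fin (G.numLevels - 1)) (k : ℕ) :
    x ∈ G.dummies h s k ↔ ∃ i, k ≤ i.val ∧ x = Sum.inr ⟨h, s, i⟩ := by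
  simp [HRLQ.dummies, eq_comm]

theorem HRLQ.dummies_nodup (G : HRLQ R H) (h : H) (s : Fin (G.numLevels - 1)) (k : ℕ) :
    (G.dummies h s k).Nodup := by
  refine List.Nodup.map ?_ ((List.nodup_finRange _).filter _)
  intro i j hij
  simpa using hij

theorem HRLQ.redResList_nodup (G : HRLQ R H) (x : G.Res) : (G.redResList x).Nodup := by
  rcases x with r | ⟨h, s, i⟩
  · simp only [HRLQ.redResList]
    rw [List.nodup_flatMap]
    refine ⟨fun s _ => (G.resList_nodup r).map (fun a b hab => by simpa using hab), ?_⟩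
    have hn : (List.finRange G.numLevels).reverse.Nodup :=
      List.nodup_reverse.2 (List.nodup_finRange _)
    refine hn.imp ?_
    intro a b hab
    simp only [Function.onFun]
    intro c hc hc'
    simp only [List.mem_map] at hc hc'
    obtain ⟨_, _, rfl⟩ := hc
    obtain ⟨_, _, h2⟩ := hc'
    exact hab (Prod.ext_iff.1 h2).2.symm
  · simp only [HRLQ.redResList]
    split_ifs <;> simp

theorem HRLQ.redHospList_nodup (G : HRLQ R H) (c : G.Copy) : (G.redHospList c).Nodup := by
  obtain ⟨h, s⟩ := c
  simp only [HRLQ.redHospList]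
  have hm : ((G.hospList h).map (Sum.inl : R → G.Res)).Nodup :=
    (G.hospList_nodup h).map Sum.inl_injective
  rw [List.nodup_append', List.nodup_append']
  refine ⟨?_, ⟨hm, ?_, ?_⟩, ?_⟩
  · split_ifs
    · exact G.dummies_nodup _ _ _
    · simp
  · split_ifs
    · exact G.dummies_nodup _ _ _
    · simp
  · intro x hx hx'
    split_ifs at hx'
    · simp only [List.mem_map] at hx
      obtain ⟨r, _, rfl⟩ := hx
      simp [HRLQ.mem_dummies] at hx'
    · simp at hx'
  · intro x hx hx'
    split_ifs at hx with h1
    · rw [HRLQ.mem_dummies] at hx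
      obtain ⟨i, _, rfl⟩ := hx
      rw [List.mem_append] at hx'
      rcases hx' with hx' | hx'
      · simp at hx'
      · split_ifs at hx'
        · rw [HRLQ.mem_dummies] at hx'
          obtain ⟨j, _, hj⟩ := hx'
          simp only [Sum.inr.injEq, Sigma.mk.injEq, heq_eq_eq, true_and] at hj
          have := congrArg Fin.val hj.1
          simp at this
          omega
        · simp at hx'
    · simp at hx

theorem HRLQ.red_mem_iff (G : HRLQ R H) (x : G.Res) (c : G.Copy) :
    c ∈ G.redResList x ↔ x ∈ G.redHospList c := by
  obtain ⟨h, s⟩ := c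
  have key : ∀ (x : G.Res), x ∈ G.redHospList (h, s) ↔
      ((∃ hs : 0 < s.val, ∃ i : Fin (G.levelCap h (s.val - 1)), G.numShort h (s.val - 1) ≤ i.val ∧
        x = Sum.inr ⟨h, ⟨s.val - 1, by omega⟩, i⟩) ∨ (∃ r ∈ G.hospList h, Sum.inl r = x) ∨
      (∃ hs : s.val + 1 < G.numLevels, ∃ i : Fin (G.levelCap h s.val), x = Sum.inr ⟨h, ⟨s.val, by omega⟩, i⟩)) := by
    intro x
    simp only [HRLQ.redHospList, List.mem_append, List.mem_map]
    refine or_congr ?_ (or_congr Iff.rfl ?_)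
    · split_ifs with h1 <;> simp [HRLQ.mem_dummies, h1]
    · split_ifs with h1 <;> simp [HRLQ.mem_dummies, h1]
  rw [key]
  rcases x with r | ⟨h', s', i⟩
  · simp [HRLQ.redResList, G.mem_iff]
  · constructor
    · intro hc
      simp only [HRLQ.redResList] at hc
      split_ifs at hc with h1
      · simp only [List.mem_singleton, Prod.mk.injEq] at hc
        obtain ⟨rfl, rfl⟩ := hc
        exact Or.inr (Or.inr ⟨by simp only; omega, i, rfl⟩)
      · simp only [List.mem_cons, Prod.mk.injEq, List.not_mem_nil, or_false] at hc
        rcases hc with ⟨rfl, rfl⟩ | ⟨rfl, rfl⟩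
        · exact Or.inr (Or.inr ⟨by simp only; omega, i, rfl⟩)
        · exact Or.inl ⟨by simp, i, by simpa using h1, rfl⟩
    · rintro (⟨hs, j, hj, hx⟩ | ⟨r, _, hr⟩ | ⟨hs, j, hx⟩)
      · simp only [Sum.inr.injEq] at hx
        cases hx
        simp only [HRLQ.redResList]
        rw [if_neg (by omega)]
        simp only [List.mem_cons, Prod.mk.injEq, Fin.ext_iff, true_and]
        right; left; omega
      · cases hr
      · simp only [Sum.inr.injEq] at hx
        cases hx
        simp only [HRLQ.redResList]
        split_ifs <;> simp

/-- The reduced Hospital Residents instance `G''`. -/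
def HRLQ.reduction (G : HRLQ R H) : HR G.Res G.Copy where
  resList := G.redResList
  hospList := G.redHospList
  upper := fun c => G.levelCap c.1 c.2
  resList_nodup := G.redResList_nodup
  hospList_nodup := G.redHospList_nodup
  mem_iff := G.red_mem_iff

open Classical in
/-- `map(M'')`: a resident is matched to `h` if it is matched to some copy of `h`. -/
noncomputable def HRLQ.mapBack (G : HRLQ R H)
    (M : Finset (G.Res × G.Copy)) : Finset (R × H) :=
  Finset.univ.filter (fun e => ∃ s : Fin G.numLevels, ((Sum.inl e.1 : G.Res), ((e.2, s) : G.Copy)) ∈ M)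

end Reduction

section Machine

/-- Programs of a random access machine with registers and a memory, both holding natural
numbers and indexed by natural numbers. There is no multiplication, so that a number of steps
bounds the growth of the stored numbers (at most one more bit in each step). -/
inductive RamProgram : Type
  /-- `reg x := c` -/
  | const (x c : ℕ)
  /-- `reg x := reg y + reg z` -/
  | plus (x y z : ℕ)
  /-- `reg x := reg y - reg z` (truncated) -/
  | minus (x y z : ℕ)
  /-- `reg x := mem (reg y)` -/
  | load (x y : ℕ)
  /-- `mem (reg x) := reg y` -/
  | store (x y : ℕ)
  /-- run `p`, then `q` -/
  | seq (p q : RamProgram)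
  /-- run `p` if `reg x ≠ 0`, otherwise `q` -/
  | branch (x : ℕ) (p q : RamProgram)
  /-- as long as `reg x ≠ 0`, run `p` -/
  | loop (x : ℕ) (p : RamProgram)

structure RamState where
  reg : ℕ → ℕ
  mem : ℕ → ℕ

def RamState.setReg (s : RamState) (x v : ℕ) : RamState :=
  { s with reg := Function.update s.reg x v }

def RamState.setMem (s : RamState) (a v : ℕ) : RamState :=
  { s with mem := Function.update s.mem a v }

/-- `p.Runs s t s'`: started in state `s`, the program `p` halts in state `s'` after exactly `t`
steps. Every elementary instruction and every test is one step. -/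
inductive RamProgram.Runs : RamProgram → RamState → ℕ → RamState → Prop
  | const (x c : ℕ) (s : RamState) : Runs (.const x c) s 1 (s.setReg x c)
  | plus (x y z : ℕ) (s : RamState) : Runs (.plus x y z) s 1 (s.setReg x (s.reg y + s.reg z))
  | minus (x y z : ℕ) (s : RamState) : Runs (.minus x y z) s 1 (s.setReg x (s.reg y - s.reg z))
  | load (x y : ℕ) (s : RamState) : Runs (.load x y) s 1 (s.setReg x (s.mem (s.reg y)))
  | store (x y : ℕ) (s : RamState) : Runs (.store x y) s 1 (s.setMem (s.reg x) (s.reg y))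
  | seq (p q : RamProgram) (s s' s'' : RamState) (t t' : ℕ) :
      Runs p s t s' → Runs q s' t' s'' → Runs (.seq p q) s (t + t') s''
  | branch_pos (x : ℕ) (p q : RamProgram) (s s' : RamState) (t : ℕ) :
      s.reg x ≠ 0 → Runs p s t s' → Runs (.branch x p q) s (t + 1) s'
  | branch_zero (x : ℕ) (p q : RamProgram) (s s' : RamState) (t : ℕ) :
      s.reg x = 0 → Runs q s t s' → Runs (.branch x p q) s (t + 1) s'
  | loop_zero (x : ℕ) (p : RamProgram) (s : RamState) :
      s.reg x = 0 → Runs (.loop x p) s 1 s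
  | loop_pos (x : ℕ) (p : RamProgram) (s s' s'' : RamState) (t t' : ℕ) :
      s.reg x ≠ 0 → Runs p s t s' → Runs (.loop x p) s' t' s'' →
      Runs (.loop x p) s (t + t' + 1) s''

/-- The input encoding of an instance with `n` residents and `m` hospitals: `n`, `m`, the upper
quotas, the lower quotas, then the preference lists of the residents and of the hospitals, each
preceded by its length. -/
def HRLQ.encode {n m : ℕ} (G : HRLQ (Fin n) (Fin m)) : List ℕ :=
  [n, m] ++ List.ofFn G.upper ++ List.ofFn G.lower ++
  (List.finRange n).flatMap (fun r => (G.resList r).length :: (G.resList r).map Fin.val) ++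
  (List.finRange m).flatMap (fun h => (G.hospList h).length :: (G.hospList h).map Fin.val)

/-- The initial state: the input stands at the beginning of the memory, all else is zero. -/
def RamState.init (input : List ℕ) : RamState where
  reg := fun _ => 0
  mem := fun a => input.getD a 0

/-- The output encoding of a matching: cell `r` holds `0` if the resident `r` is unmatched, and
`h + 1` if `r` is matched to the hospital `h`. -/
def RamState.Outputs {n m : ℕ} (s : RamState) (M : Finset (Fin n × Fin m)) : Prop :=
  ∀ r : Fin n, s.mem r.val = (partner M r).elim 0 (fun h => h.val + 1)

end Machine

/-!
A stable matching of the reduced instance places every resident at a copy `h^s`, that is, at a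
hospital and a level `s`. The dummies at the copies of `h` are pushed up by the residents below
them, so stability says that the residents at `h` of level at most `s` share the capacity of
`h^s`, and that each copy that a resident prefers to its place is filled with residents ranked
above it.

Levels are a dual certificate for popularity. For an edge `(r, h)` of `N` outside `M`, the vote of
`r` for `N` plus the vote of `h` for `r` against the resident `r'` of `M` it corresponds to is at
most twice the level of `r` minus the level of `r'`, or minus `n - 1` for the empty position. Since
a level `≥ n` only occurs at a hospital with at most `q⁻(h)` residents, a resident of `M` that
corresponds to the empty position has level at most `n - 1`. Summed over all edges the levels
cancel, and the votes for `N` over `M` are at most `2 (n - 1) (|M| - |N|)`, hence not positive if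
`|N| ≥ |M|`. This applies to `M ⊕ ρ`, which is feasible and as large as `M`.

Feasibility and maximality come from one count. If a matching `N` puts more residents than `M` at
the hospitals whose level-`s` copies are not full, then strictly more residents move between `M`
and `N` at the levels from `s` on than at those from `s + 1` on. A deficient hospital in `M` makes
this happen for all the `∑ q⁻(h)` levels from `n` on, which hold fewer residents than that; a larger
`N` makes it happen for the `n` levels below, which leaves too few residents for `N`.

The algorithm is deferred acceptance run on the placements themselves: per resident it keeps the
number of levels used up, a position on the list and the current hospital, so that no copy and no
dummy is ever built.
-/

section Votes

variable {α : Type*} [DecidableEq α] {l : List α} {x y : α}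

theorem Prefers.asymm (hxy : Prefers l x y) : ¬ Prefers l y x :=
  fun hyx => hxy.2.2.asymm hyx.2.2

theorem Prefers.ne (hxy : Prefers l x y) : x ≠ y := by
  rintro rfl
  exact hxy.2.2.false

theorem Prefers.or_of_ne (hx : x ∈ l) (hy : y ∈ l) (hne : x ≠ y) :
    Prefers l x y ∨ Prefers l y x :=
  (Nat.lt_or_gt_of_ne fun h => hne ((List.idxOf_inj hx).1 h)).imp
    (fun h => ⟨hx, hy, h⟩) (fun h => ⟨hy, hx, h⟩)

theorem vote_le_one (l : List α) (x y : Option α) : vote l x y ≤ 1 := by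
  unfold vote
  split <;> (try split_ifs) <;> norm_num

theorem vote_eq_neg_one_of_prefers (hyx : Prefers l y x) : vote l (some x) (some y) = -1 := by
  simp only [vote, if_neg hyx.asymm, if_pos hyx]

theorem vote_swap (l : List α) (x y : Option α) : vote l x y = -vote l y x := by
  rcases x with _ | x <;> rcases y with _ | y <;> simp only [vote, neg_neg, neg_zero]
  by_cases hxy : Prefers l x y
  · simp only [if_pos hxy, if_neg hxy.asymm, neg_neg]
  · simp only [if_neg hxy]
    split_ifs <;> simp

theorem vote_self (l : List α) (x : Option α) : vote l x x = 0 :=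
  self_eq_neg.1 (vote_swap l x x)

theorem vote_none_le_zero (l : List α) (y : Option α) : vote l none y ≤ 0 := by
  cases y <;> simp [vote]

end Votes

section Partners

variable {R : Type u} {H : Type v} {M : Finset (R × H)} {r : R} {h : H}

/-- Every resident has at most one edge in `M`; this is one of the three conditions on a
matching. -/
def IsSingleValued (M : Finset (R × H)) : Prop :=
  ∀ r h h', (r, h) ∈ M → (r, h') ∈ M → h = h'

theorem IsSingleValued.injOn_fst (hM : IsSingleValued M) :
    Set.InjOn Prod.fst (M : Set (R × H)) := by
  rintro ⟨r, h⟩ hr ⟨_, h'⟩ hr' rfl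
  rw [hM r h h' hr hr']

theorem IsSingleValued.partner_eq_some (hM : IsSingleValued M) (hr : (r, h) ∈ M) :
    partner M r = some h := by
  have hex : ∃ h, (r, h) ∈ M := ⟨h, hr⟩
  rw [partner, dif_pos hex, hM r _ _ hex.choose_spec hr]

theorem partner_eq_none (hr : ∀ h, (r, h) ∉ M) : partner M r = none := by
  rw [partner, dif_neg (by simpa using hr)]

theorem mem_of_partner_eq_some (hr : partner M r = some h) : (r, h) ∈ M := by
  rw [partner] at hr
  split_ifs at hr with hex
  exact Option.some.inj hr ▸ hex.choose_spec

end Partners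

section ResidentsOf

variable {R : Type u} {H : Type v} [DecidableEq R] [DecidableEq H] {M N : Finset (R × H)}

@[simp]
theorem mem_residentsOf {r : R} {h : H} : r ∈ residentsOf M h ↔ (r, h) ∈ M := by
  simp [residentsOf]

theorem residentsOf_sdiff (M N : Finset (R × H)) (h : H) :
    residentsOf (M \ N) h = residentsOf M h \ residentsOf N h := by
  ext r
  simp

theorem sum_mem_residentsOf {A : Type*} [AddCommMonoid A] (M : Finset (R × H)) (O : Finset H)
    (f : R → H → A) :
    ∑ h ∈ O, ∑ r ∈ residentsOf M h, f r h = ∑ e ∈ M with e.2 ∈ O, f e.1 e.2 := by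
  rw [← Finset.sum_fiberwise_eq_sum_filter M O Prod.snd]
  refine Finset.sum_congr rfl fun h _ => ?_
  have hinj : Set.InjOn Prod.fst ((M.filter (·.2 = h) : Finset (R × H)) : Set (R × H)) := by
    rintro ⟨r, h₁⟩ h₁mem ⟨r', h₂⟩ h₂mem heq
    obtain rfl : h₁ = h := (Finset.mem_filter.1 h₁mem).2
    obtain rfl : h₂ = h₁ := (Finset.mem_filter.1 h₂mem).2
    exact Prod.ext heq rfl
  rw [residentsOf, Finset.sum_image hinj]
  exact Finset.sum_congr rfl fun e he => by rw [(Finset.mem_filter.1 he).2]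

theorem sum_residentsOf [Fintype H] {A : Type*} [AddCommMonoid A] (M : Finset (R × H))
    (f : R → H → A) : ∑ h, ∑ r ∈ residentsOf M h, f r h = ∑ e ∈ M, f e.1 e.2 := by
  simpa using sum_mem_residentsOf M Finset.univ f

theorem sum_card_mem_residentsOf (M : Finset (R × H)) (O : Finset H) :
    ∑ h ∈ O, (residentsOf M h).card = (M.filter (·.2 ∈ O)).card := by
  simpa only [Finset.card_eq_sum_ones] using sum_mem_residentsOf M O fun _ _ => 1

theorem sum_card_residentsOf [Fintype H] (M : Finset (R × H)) :
    ∑ h, (residentsOf M h).card = M.card := by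
  simpa using sum_card_mem_residentsOf M Finset.univ

namespace HR.IsMatching

variable {G : HR R H}

theorem mem_resList (hM : G.IsMatching M) {r : R} {h : H} (hr : (r, h) ∈ M) : h ∈ G.resList r :=
  hM.1 (r, h) hr

theorem isSingleValued (hM : G.IsMatching M) : IsSingleValued M := hM.2.1

theorem card_residentsOf_le_upper (hM : G.IsMatching M) (h : H) :
    (residentsOf M h).card ≤ G.upper h := hM.2.2 h

theorem card_le [Fintype R] (hM : G.IsMatching M) : M.card ≤ Fintype.card R :=
  Finset.card_le_card_of_injOn (t := Finset.univ) Prod.fst (by simp [Set.MapsTo])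
    hM.isSingleValued.injOn_fst

end HR.IsMatching

namespace HRLQ.IsFeasible

variable {G : HRLQ R H}

theorem isMatching (hN : G.IsFeasible N) : G.toHR.IsMatching N := hN.1

theorem lower_le_card_residentsOf (hN : G.IsFeasible N) (h : H) :
    G.lower h ≤ (residentsOf N h).card := hN.2 h

theorem lower_le_upper (hN : G.IsFeasible N) (h : H) : G.lower h ≤ G.upper h :=
  (hN.lower_le_card_residentsOf h).trans (hN.isMatching.card_residentsOf_le_upper h)

theorem sum_lower_le [Fintype R] [Fintype H] (hN : G.IsFeasible N) :
    ∑ h, G.lower h ≤ Fintype.card R :=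
  calc ∑ h, G.lower h ≤ ∑ h, (residentsOf N h).card :=
        Finset.sum_le_sum fun h _ => hN.lower_le_card_residentsOf h
    _ = N.card := sum_card_residentsOf N
    _ ≤ Fintype.card R := hN.isMatching.card_le

end HRLQ.IsFeasible

end ResidentsOf

section Correspondences

variable {R : Type u} {H : Type v} [DecidableEq R] [DecidableEq H]

namespace Correspondence

variable (τ : Correspondence R H) (h : H) (M N : Finset (R × H))

/-- The residents of `M(h) \ N(h)` that correspond to residents of `N(h) \ M(h)`. -/
def paired : Finset R :=
  (residentsOf M h \ residentsOf N h).filter fun r => τ.corr h M N r ≠ none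

/-- The residents of `M(h) \ N(h)` that correspond to `⊥`. -/
def unpaired : Finset R :=
  (residentsOf M h \ residentsOf N h).filter fun r => τ.corr h M N r = none

variable {τ h M N} in
theorem exists_corr_of_mem_paired {r : R} (hr : r ∈ τ.paired h M N) :
    ∃ r' ∈ τ.paired h N M, τ.corr h M N r = some r' ∧ τ.corr h N M r' = some r := by
  obtain ⟨hr, hne⟩ := Finset.mem_filter.1 hr
  obtain ⟨r', hr'⟩ := Option.ne_none_iff_exists'.1 hne
  obtain ⟨hmem, hback⟩ := τ.pairing h M N r r' hr hr'
  exact ⟨r', Finset.mem_filter.2 ⟨hmem, by simp [hback]⟩, hr', hback⟩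

theorem sum_unpaired_add_sum_paired {A : Type*} [AddCommMonoid A] (g : R → A) :
    ∑ r ∈ τ.unpaired h M N, g r + ∑ r ∈ τ.paired h M N, g r =
      ∑ r ∈ residentsOf M h \ residentsOf N h, g r :=
  Finset.sum_filter_add_sum_filter_not _ _ _

theorem sum_paired_comm {A : Type*} [AddCommMonoid A] (g : Option R → Option R → A) :
    ∑ r ∈ τ.paired h M N, g (some r) (τ.corr h M N r) =
      ∑ r ∈ τ.paired h N M, g (τ.corr h N M r) (some r) := by
  refine Finset.sum_bij' (fun r _ => (τ.corr h M N r).getD r)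
    (fun r _ => (τ.corr h N M r).getD r) ?_ ?_ ?_ ?_ ?_ <;> intro r hr <;>
    obtain ⟨r', hr', hto, hback⟩ := exists_corr_of_mem_paired hr
  · simpa only [hto, Option.getD_some] using hr'
  · simpa only [hto, Option.getD_some] using hr'
  all_goals simp only [hto, hback, Option.getD_some]

theorem card_unpaired_sub_card_unpaired :
    ((τ.unpaired h M N).card : ℤ) - (τ.unpaired h N M).card =
      (residentsOf M h).card - (residentsOf N h).card := by
  have hpaired : ((τ.paired h M N).card : ℤ) = (τ.paired h N M).card := by
    simpa using τ.sum_paired_comm h M N fun _ _ => (1 : ℤ)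
  have hM : ((τ.unpaired h M N).card : ℤ) + (τ.paired h M N).card =
      (residentsOf M h \ residentsOf N h).card := by
    simpa using τ.sum_unpaired_add_sum_paired h M N fun _ => (1 : ℤ)
  have hN : ((τ.unpaired h N M).card : ℤ) + (τ.paired h N M).card =
      (residentsOf N h \ residentsOf M h).card := by
    simpa using τ.sum_unpaired_add_sum_paired h N M fun _ => (1 : ℤ)
  have hsdiff := Finset.card_sdiff_add_card (residentsOf M h) (residentsOf N h)
  have hsdiff' := Finset.card_sdiff_add_card (residentsOf N h) (residentsOf M h)
  rw [Finset.union_comm] at hsdiff'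
  lia

variable {τ h M N} in
theorem card_lt_of_mem_unpaired {r : R} (hr : r ∈ τ.unpaired h M N) :
    (residentsOf N h).card < (residentsOf M h).card := by
  have hempty : τ.unpaired h N M = ∅ := Finset.eq_empty_of_forall_notMem fun r' hr' =>
    τ.one_sided h M N r r' (Finset.mem_filter.1 hr).1 (Finset.mem_filter.1 hr').1
      ⟨(Finset.mem_filter.1 hr).2, (Finset.mem_filter.1 hr').2⟩
  have hcard := τ.card_unpaired_sub_card_unpaired h M N
  have hpos := Finset.card_pos.2 ⟨r, hr⟩
  rw [hempty] at hcard
  simp only [Finset.card_empty, Nat.cast_zero] at hcard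
  lia

theorem sum_comp_corr {A : Type*} [AddCommMonoid A] (f : Option R → A) :
    ∑ r ∈ residentsOf M h \ residentsOf N h, f (τ.corr h M N r) =
      (τ.unpaired h M N).card • f none + ∑ r ∈ τ.paired h N M, f (some r) := by
  rw [← τ.sum_unpaired_add_sum_paired, τ.sum_paired_comm h M N fun _ => f,
    Finset.sum_congr rfl fun r hr => by rw [(Finset.mem_filter.1 hr).2], Finset.sum_const]

end Correspondence

namespace HR

variable (G : HR R H) (τ : Correspondence R H) (M N : Finset (R × H))

theorem hospVote_eq_sum_sub_card (h : H) : G.hospVote τ M N h =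
    ∑ r ∈ residentsOf M h \ residentsOf N h, vote (G.hospList h) (some r) (τ.corr h M N r) -
      (τ.unpaired h N M).card := by
  simp [hospVote, vote, Correspondence.unpaired, sub_eq_add_neg]

theorem hospVote_swap (h : H) : G.hospVote τ M N h = -G.hospVote τ N M h := by
  have hsplit : ∀ A B : Finset (R × H), G.hospVote τ A B h = (τ.unpaired h A B).card +
      ∑ r ∈ τ.paired h A B, vote (G.hospList h) (some r) (τ.corr h A B r) -
        (τ.unpaired h B A).card := by
    intro A B
    rw [hospVote_eq_sum_sub_card, ← τ.sum_unpaired_add_sum_paired]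
    rw [Finset.sum_congr (s₁ := τ.unpaired h A B) rfl fun r hr => by
      rw [(Finset.mem_filter.1 hr).2, vote]]
    simp
  have hpaired : ∑ r ∈ τ.paired h M N, vote (G.hospList h) (some r) (τ.corr h M N r) =
      -∑ r ∈ τ.paired h N M, vote (G.hospList h) (some r) (τ.corr h N M r) := by
    rw [τ.sum_paired_comm h M N (vote (G.hospList h)), ← Finset.sum_neg_distrib]
    exact Finset.sum_congr rfl fun r _ => vote_swap _ _ _
  rw [hsplit, hsplit, hpaired]
  ring

theorem votes_swap [Fintype R] [Fintype H] : G.votes τ M N = -G.votes τ N M := by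
  simp_rw [votes, vote_swap _ (partner M _), hospVote_swap G τ M N, Finset.sum_neg_distrib, neg_add]

end HR

end Correspondences

section Placements

variable {R : Type u} {H : Type v}

/-- A placement of the residents at levelled copies `(h, s)` of the hospitals, `none` standing for
an unmatched resident. It records where a matching of the reduced instance puts the residents of
`G`, and forgets the dummies. -/
abbrev Placement (R : Type u) (H : Type v) : Type (max u v) := R → Option (H × ℕ)

namespace Placement

variable (pl : Placement R H) {r : R} {h : H} {s t : ℕ}

/-- The level of the copy at which `r` is placed. The value `0` for an unplaced resident is the
one that the votes of the residents require. -/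
def level (r : R) : ℕ := (pl r).elim 0 Prod.snd

variable {pl} in
theorem level_of_eq_some (hr : pl r = some (h, s)) : pl.level r = s := by simp [level, hr]

variable [Fintype R]

/-- The value of a position, with `none` for an empty position, in the dual certificate for the
popularity of a placement. -/
def price : Option R → ℤ := fun x => x.elim (Fintype.card R - 1) fun r => pl.level r

open Classical in
/-- The residents placed at `h` at a level at most `s`. -/
noncomputable def upTo (h : H) (s : ℕ) : Finset R :=
  Finset.univ.filter fun r => ∃ t, pl r = some (h, t) ∧ t ≤ s

@[simp]
theorem mem_upTo : r ∈ pl.upTo h s ↔ ∃ t, pl r = some (h, t) ∧ t ≤ s := by simp [upTo]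

open Classical in
/-- The residents who are placed at level `s` or above, at a hospital that is not theirs in `N`. -/
noncomputable def movers (N : Finset (R × H)) (s : ℕ) : Finset R :=
  Finset.univ.filter fun r => ∃ h t, pl r = some (h, t) ∧ s ≤ t ∧ (r, h) ∉ N

@[simp]
theorem mem_movers {N : Finset (R × H)} :
    r ∈ pl.movers N s ↔ ∃ h t, pl r = some (h, t) ∧ s ≤ t ∧ (r, h) ∉ N := by
  simp [movers]

variable [Fintype H]

open Classical in
/-- The matching of residents to hospitals that forgets the levels of a placement. -/
noncomputable def edges : Finset (R × H) :=
  Finset.univ.filter fun e => ∃ s, pl e.1 = some (e.2, s)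

@[simp]
theorem mem_edges : (r, h) ∈ pl.edges ↔ ∃ s, pl r = some (h, s) := by simp [edges]

variable {pl} in
theorem mem_edges_of_eq_some (hr : pl r = some (h, s)) : (r, h) ∈ pl.edges := pl.mem_edges.2 ⟨s, hr⟩

theorem isSingleValued_edges : IsSingleValued pl.edges := by
  intro r h h' hr hr'
  obtain ⟨s, hs⟩ := pl.mem_edges.1 hr
  obtain ⟨s', hs'⟩ := pl.mem_edges.1 hr'
  exact congrArg Prod.fst (Option.some.inj (hs.symm.trans hs'))

theorem partner_edges (r : R) : partner pl.edges r = (pl r).map Prod.fst := by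
  rcases hp : pl r with _ | ⟨h, s⟩
  · exact partner_eq_none fun h => by simp [hp]
  · exact pl.isSingleValued_edges.partner_eq_some (mem_edges_of_eq_some hp)

theorem sum_level_edges : ∑ e ∈ pl.edges, pl.level e.1 = ∑ r, pl.level r := by
  classical
  rw [← Finset.sum_image (f := pl.level) pl.isSingleValued_edges.injOn_fst]
  refine Finset.sum_subset (Finset.subset_univ _) fun r _ hr => ?_
  rcases hp : pl r with _ | ⟨h, s⟩
  · simp [level, hp]
  · exact absurd (Finset.mem_image_of_mem _ (mem_edges_of_eq_some hp)) hr

theorem sum_level_le_sum_level_edges {N : Finset (R × H)} (hN : IsSingleValued N) :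
    ∑ e ∈ N, pl.level e.1 ≤ ∑ e ∈ pl.edges, pl.level e.1 := by
  classical
  rw [sum_level_edges, ← Finset.sum_image (f := pl.level) hN.injOn_fst]
  exact Finset.sum_le_univ_sum_of_nonneg fun _ => Nat.zero_le _

variable [DecidableEq R] [DecidableEq H]

theorem upTo_subset_residentsOf (h : H) (s : ℕ) : pl.upTo h s ⊆ residentsOf pl.edges h := by
  intro r hr
  obtain ⟨t, ht, -⟩ := pl.mem_upTo.1 hr
  exact mem_residentsOf.2 (mem_edges_of_eq_some ht)

theorem upTo_eq_residentsOf (hs : ∀ r t, pl r = some (h, t) → t ≤ s) :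
    pl.upTo h s = residentsOf pl.edges h := by
  ext r
  simp only [mem_upTo, mem_residentsOf, mem_edges]
  exact exists_congr fun t => and_iff_left_of_imp (hs r t)

theorem residentsOf_edges_eq_empty_or (h : H) : residentsOf pl.edges h = ∅ ∨
    ∃ r s, pl r = some (h, s) ∧ pl.upTo h s = residentsOf pl.edges h := by
  refine (residentsOf pl.edges h).eq_empty_or_nonempty.imp_right fun hne => ?_
  obtain ⟨r, hr, hmax⟩ := Finset.exists_max_image _ pl.level hne
  obtain ⟨s, hs⟩ := pl.mem_edges.1 (mem_residentsOf.1 hr)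
  refine ⟨r, s, hs, pl.upTo_eq_residentsOf fun r' t ht => ?_⟩
  have hle := hmax r' (mem_residentsOf.2 (mem_edges_of_eq_some ht))
  rwa [level_of_eq_some hs, level_of_eq_some ht] at hle

end Placement

theorem HR.sum_vote_partner_le [Fintype R] [DecidableEq R] [DecidableEq H] (G : HR R H)
    {M N : Finset (R × H)} (hM : IsSingleValued M)
    (hN : IsSingleValued N) :
    ∑ r, vote (G.resList r) (partner N r) (partner M r) ≤
      ∑ e ∈ N \ M, vote (G.resList e.1) (some e.2) (partner M e.1) := by
  have hinj : Set.InjOn Prod.fst ((N \ M : Finset (R × H)) : Set (R × H)) :=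
    hN.injOn_fst.mono (by simp)
  calc ∑ r, vote (G.resList r) (partner N r) (partner M r)
      ≤ ∑ r ∈ (N \ M).image Prod.fst, vote (G.resList r) (partner N r) (partner M r) := by
        rw [← Finset.sum_sdiff (Finset.subset_univ ((N \ M).image Prod.fst))]
        refine add_le_of_nonpos_left (Finset.sum_nonpos fun r hr => ?_)
        rcases hpr : partner N r with _ | h
        · exact vote_none_le_zero _ _
        have hrN := mem_of_partner_eq_some hpr
        have hrM : (r, h) ∈ M := by
          by_contra hrM
          exact (Finset.mem_sdiff.1 hr).2
            (Finset.mem_image_of_mem Prod.fst (Finset.mem_sdiff.2 ⟨hrN, hrM⟩))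
        rw [hM.partner_eq_some hrM, vote_self]
    _ = ∑ e ∈ N \ M, vote (G.resList e.1) (some e.2) (partner M e.1) := by
        rw [Finset.sum_image hinj]
        exact Finset.sum_congr rfl fun e he => by
          rw [hN.partner_eq_some (Finset.mem_sdiff.1 he).1]

namespace HRLQ

variable (G : HRLQ R H)

section Desires

variable [DecidableEq H]

/-- `r` prefers the level-`s` copy of `h` to its place. -/
def Desires (pl : Placement R H) (r : R) (h : H) (s : ℕ) : Prop :=
  h ∈ G.resList r ∧ ∀ h' t, pl r = some (h', t) → t < s ∨ t = s ∧ Prefers (G.resList r) h h'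

variable {G} {pl : Placement R H} {r : R} {h h' : H} {s t : ℕ}

theorem desires_of_eq_none (hr : h ∈ G.resList r) (hpr : pl r = none) : G.Desires pl r h s :=
  ⟨hr, by simp [hpr]⟩

theorem desires_iff_of_eq_some (hr : h ∈ G.resList r) (hpr : pl r = some (h', t)) :
    G.Desires pl r h s ↔ t < s ∨ t = s ∧ Prefers (G.resList r) h h' := by
  simp [Desires, hr, hpr]

theorem exists_le_of_not_desires (hr : h ∈ G.resList r) (hd : ¬ G.Desires pl r h s) :
    ∃ h' t, pl r = some (h', t) ∧ s ≤ t := by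
  by_contra! hlt
  exact hd ⟨hr, fun h' t hpr => Or.inl (hlt h' t hpr)⟩

theorem exists_desires_vote_le [Fintype R] [Fintype H] (hr : h ∈ G.resList r)
    (hvalid : ∀ h' t, pl r = some (h', t) → h' ∈ G.resList r) (hm : (r, h) ∉ pl.edges) :
    ∃ s, G.Desires pl r h s ∧
      vote (G.resList r) (some h) (partner pl.edges r) ≤ 2 * ((pl.level r : ℤ) - s) + 1 := by
  rw [pl.partner_edges]
  rcases hpr : pl r with _ | ⟨h', t⟩
  · exact ⟨0, desires_of_eq_none hr hpr, by simp [vote, Placement.level, hpr]⟩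
  have hne : h ≠ h' := by
    rintro rfl
    exact hm (Placement.mem_edges_of_eq_some hpr)
  rw [Placement.level_of_eq_some hpr, Option.map_some]
  rcases Prefers.or_of_ne hr (hvalid h' t hpr) hne with hpref | hpref
  · exact ⟨t, (desires_iff_of_eq_some hr hpr).2 (Or.inr ⟨rfl, hpref⟩), by
      simpa using vote_le_one _ _ _⟩
  · refine ⟨t + 1, (desires_iff_of_eq_some hr hpr).2 (Or.inl t.lt_succ_self), ?_⟩
    rw [vote_eq_neg_one_of_prefers hpref]
    push_cast
    omega

end Desires

section Levels

variable {G} [Fintype R]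

theorem levelCap_of_lt {s : ℕ} (hs : s < Fintype.card R) (h : H) : G.levelCap h s = G.upper h :=
  if_pos hs

theorem levelCap_of_le {s : ℕ} (hs : Fintype.card R ≤ s) (h : H) : G.levelCap h s = G.lower h :=
  if_neg hs.not_gt

theorem levelCap_anti (hq : ∀ h, G.lower h ≤ G.upper h) (h : H) {s t : ℕ} (hst : s ≤ t) :
    G.levelCap h t ≤ G.levelCap h s := by
  rcases lt_or_ge t (Fintype.card R) with ht | ht
  · rw [levelCap_of_lt ht, levelCap_of_lt (hst.trans_lt ht)]
  · rw [levelCap_of_le ht, levelCap]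
    split_ifs
    exacts [hq h, le_rfl]

theorem levelCap_le_upper (hq : ∀ h, G.lower h ≤ G.upper h) (h : H) (s : ℕ) :
    G.levelCap h s ≤ G.upper h := by
  unfold levelCap
  split_ifs
  exacts [le_rfl, hq h]

variable (G) in
theorem card_le_numLevels [Fintype H] : Fintype.card R ≤ G.numLevels := Nat.le_add_right _ _

variable (G) in
/-- The hospitals whose level-`s` copy is not full. -/
noncomputable def openHospitals [Fintype H] (pl : Placement R H) (s : ℕ) : Finset H :=
  Finset.univ.filter fun h => (pl.upTo h s).card < G.levelCap h s

@[simp]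
theorem mem_openHospitals [Fintype H] {pl : Placement R H} {s : ℕ} {h : H} :
    h ∈ G.openHospitals pl s ↔ (pl.upTo h s).card < G.levelCap h s := by
  simp [openHospitals]

end Levels

section LevelStable

variable [DecidableEq R] [Fintype R]

open Classical in
/-- The residents placed at `h` that the levelled hospital ranks above `r` at level `s`: those at a
lower level, and those at level `s` that `h` prefers to `r`. -/
noncomputable def above (pl : Placement R H) (h : H) (s : ℕ) (r : R) : Finset R :=
  Finset.univ.filter fun r' => ∃ t, pl r' = some (h, t) ∧
    (t < s ∨ t = s ∧ Prefers (G.hospList h) r' r)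

variable {G} in
@[simp]
theorem mem_above {pl : Placement R H} {h : H} {s : ℕ} {r r' : R} :
    r' ∈ G.above pl h s r ↔
      ∃ t, pl r' = some (h, t) ∧ (t < s ∨ t = s ∧ Prefers (G.hospList h) r' r) := by
  simp [above]

theorem above_subset_upTo (pl : Placement R H) (h : H) (s : ℕ) (r : R) :
    G.above pl h s r ⊆ pl.upTo h s := by
  intro r' hr'
  obtain ⟨t, ht, hts⟩ := mem_above.1 hr'
  exact pl.mem_upTo.2 ⟨t, ht, hts.elim le_of_lt fun h => h.1.le⟩

variable {G} in
theorem notMem_above_self {pl : Placement R H} {h : H} {s : ℕ} {r : R}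
    (hr : pl r = some (h, s)) : r ∉ G.above pl h s r := by
  intro hmem
  obtain ⟨t, ht, hlt | ⟨-, hpref⟩⟩ := mem_above.1 hmem
  · cases ht.symm.trans hr
    exact lt_irrefl _ hlt
  · exact hpref.ne rfl

variable [Fintype H] [DecidableEq H]

/-- What a stable matching of the reduced instance says about the residents of `G`: the levelled
copy at which a resident is placed accepts it, and every copy that a resident prefers to its place
is filled with residents ranked above it. Residents below level `s` count towards the capacity of
the level-`s` copy because the level-`(s - 1)` dummies that they push up occupy it. -/
structure IsLevelStable (pl : Placement R H) : Prop where
  valid : ∀ r h s, pl r = some (h, s) → h ∈ G.resList r ∧ s < G.numLevels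
  keep : ∀ r h s, pl r = some (h, s) → (G.above pl h s r).card < G.levelCap h s
  full : ∀ r h s, s < G.numLevels → G.Desires pl r h s →
    G.levelCap h s ≤ (G.above pl h s r).card

namespace IsLevelStable

variable {G} {pl : Placement R H} {r r' : R} {h : H} {s t : ℕ} {N : Finset (R × H)}

theorem mem_resList (hp : G.IsLevelStable pl) (hr : pl r = some (h, s)) : h ∈ G.resList r :=
  (hp.valid r h s hr).1

theorem lt_numLevels (hp : G.IsLevelStable pl) (hr : pl r = some (h, s)) : s < G.numLevels :=
  (hp.valid r h s hr).2

theorem mem_hospList (hp : G.IsLevelStable pl) (hr : pl r = some (h, s)) : r ∈ G.hospList h :=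
  (G.mem_iff r h).1 (hp.mem_resList hr)

theorem card_upTo_le (hp : G.IsLevelStable pl) (hr : pl r = some (h, s)) :
    (pl.upTo h s).card ≤ G.levelCap h s := by
  classical
  obtain ⟨w, hw, hmax⟩ := Finset.exists_max_image (Finset.univ.filter fun r' => pl r' = some (h, s))
    (fun r' => (G.hospList h).idxOf r') ⟨r, by simp [hr]⟩
  simp only [Finset.mem_filter, Finset.mem_univ, true_and] at hw hmax
  have hsub : pl.upTo h s ⊆ insert w (G.above pl h s w) := by
    intro r' hr'
    obtain ⟨t, ht, hts⟩ := pl.mem_upTo.1 hr'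
    refine Finset.mem_insert.2 (or_iff_not_imp_left.2 fun hne => mem_above.2 ⟨t, ht, ?_⟩)
    refine hts.lt_or_eq.imp_right fun heq => ⟨heq, ?_⟩
    subst heq
    exact (Prefers.or_of_ne (hp.mem_hospList ht) (hp.mem_hospList hw) hne).resolve_right
      fun hpref => (hmax r' ht).not_gt hpref.2.2
  exact (Finset.card_le_card hsub).trans
    ((Finset.card_insert_le _ _).trans (hp.keep w h s hw))

theorem card_upTo_lt (hp : G.IsLevelStable pl) (hr : pl r = some (h, t)) (hst : s < t) :
    (pl.upTo h s).card < G.levelCap h t := by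
  refine (Finset.card_le_card fun r' hr' => ?_).trans_lt (hp.keep r h t hr)
  obtain ⟨t', ht', hle⟩ := pl.mem_upTo.1 hr'
  exact mem_above.2 ⟨t', ht', Or.inl (hle.trans_lt hst)⟩

theorem not_desires_of_card_upTo_lt (hp : G.IsLevelStable pl) (hs : s < G.numLevels)
    (hlt : (pl.upTo h s).card < G.levelCap h s) : ¬ G.Desires pl r h s := fun hd =>
  hlt.not_ge ((hp.full r h s hs hd).trans (Finset.card_le_card (G.above_subset_upTo pl h s r)))

theorem not_desires_of_lt (hp : G.IsLevelStable pl) (hq : ∀ h, G.lower h ≤ G.upper h)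
    (hr' : pl r' = some (h, t)) (hst : s < t) : ¬ G.Desires pl r h s :=
  hp.not_desires_of_card_upTo_lt (hst.trans (hp.lt_numLevels hr'))
    ((hp.card_upTo_lt hr' hst).trans_le (levelCap_anti hq h hst.le))

theorem prefers_of_desires (hp : G.IsLevelStable pl) (hd : G.Desires pl r h s)
    (hr' : pl r' = some (h, s)) : Prefers (G.hospList h) r' r := by
  have heq : G.above pl h s r = pl.upTo h s :=
    Finset.eq_of_subset_of_card_le (G.above_subset_upTo pl h s r)
      ((hp.card_upTo_le hr').trans (hp.full r h s (hp.lt_numLevels hr') hd))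
  obtain ⟨t, ht, habove⟩ := mem_above.1 (heq ▸ pl.mem_upTo.2 ⟨s, hr', le_rfl⟩)
  cases ht.symm.trans hr'
  exact (habove.resolve_left (lt_irrefl _)).2

theorem card_residentsOf_le_upper (hp : G.IsLevelStable pl) (hq : ∀ h, G.lower h ≤ G.upper h)
    (h : H) : (residentsOf pl.edges h).card ≤ G.upper h := by
  rcases pl.residentsOf_edges_eq_empty_or h with hempty | ⟨r, s, hr, heq⟩
  · simp [hempty]
  · rw [← heq]
    exact (hp.card_upTo_le hr).trans (levelCap_le_upper hq h s)

theorem card_residentsOf_le_lower (hp : G.IsLevelStable pl) (hr : pl r = some (h, s))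
    (hs : Fintype.card R ≤ s) : (residentsOf pl.edges h).card ≤ G.lower h := by
  rcases pl.residentsOf_edges_eq_empty_or h with hempty | ⟨r', s', hr', heq⟩
  · simp [hempty]
  · obtain ⟨t, ht, hts⟩ := pl.mem_upTo.1
      (heq ▸ mem_residentsOf.2 (Placement.mem_edges_of_eq_some hr))
    cases ht.symm.trans hr
    rw [← heq, ← levelCap_of_le (hs.trans hts)]
    exact hp.card_upTo_le hr'

theorem isMatching (hp : G.IsLevelStable pl) (hq : ∀ h, G.lower h ≤ G.upper h) :
    G.toHR.IsMatching pl.edges := by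
  refine ⟨?_, pl.isSingleValued_edges, hp.card_residentsOf_le_upper hq⟩
  rintro ⟨r, h⟩ hr
  obtain ⟨s, hs⟩ := pl.mem_edges.1 hr
  exact hp.mem_resList hs

theorem vote_le_of_desires (hp : G.IsLevelStable pl) (hq : ∀ h, G.lower h ≤ G.upper h)
    (hd : G.Desires pl r h s) (hr' : pl r' = some (h, t)) :
    vote (G.hospList h) (some r) (some r') ≤ 2 * ((s : ℤ) - t) - 1 := by
  have hts : t ≤ s := not_lt.1 fun hlt => hp.not_desires_of_lt hq hr' hlt hd
  rcases hts.lt_or_eq with hlt | rfl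
  · have := vote_le_one (G.hospList h) (some r) (some r')
    omega
  · simp [vote_eq_neg_one_of_prefers (hp.prefers_of_desires hd hr')]

theorem vote_add_vote_le (hp : G.IsLevelStable pl) (hq : ∀ h, G.lower h ≤ G.upper h)
    (hr : h ∈ G.resList r) (hm : (r, h) ∉ pl.edges) (hr' : pl r' = some (h, t)) :
    vote (G.resList r) (some h) (partner pl.edges r) +
      vote (G.hospList h) (some r) (some r') ≤ 2 * ((pl.level r : ℤ) - t) := by
  obtain ⟨s, hd, hvote⟩ := exists_desires_vote_le hr (fun _ _ => hp.mem_resList) hm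
  linarith [hp.vote_le_of_desires hq hd hr']

theorem vote_add_one_le (hp : G.IsLevelStable pl) (hr : h ∈ G.resList r)
    (hm : (r, h) ∉ pl.edges) (hc : (residentsOf pl.edges h).card < G.upper h) :
    vote (G.resList r) (some h) (partner pl.edges r) + 1 ≤
      2 * ((pl.level r : ℤ) - (Fintype.card R - 1)) := by
  obtain ⟨s, hd, hvote⟩ := exists_desires_vote_le hr (fun _ _ => hp.mem_resList) hm
  have hs : Fintype.card R ≤ s := by
    by_contra! hlt
    refine hp.not_desires_of_card_upTo_lt (hlt.trans_le G.card_le_numLevels) ?_ hd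
    rw [levelCap_of_lt hlt]
    exact (Finset.card_le_card (pl.upTo_subset_residentsOf h s)).trans_lt hc
  omega

theorem level_lt_card (hp : G.IsLevelStable pl) (hN : G.IsFeasible N)
    (hr : r ∈ residentsOf pl.edges h)
    (hc : (residentsOf N h).card < (residentsOf pl.edges h).card) :
    pl.level r < Fintype.card R := by
  obtain ⟨s, hs⟩ := pl.mem_edges.1 (mem_residentsOf.1 hr)
  rw [Placement.level_of_eq_some hs]
  by_contra! hle
  exact (hN.lower_le_card_residentsOf h).not_gt
    (hc.trans_le (hp.card_residentsOf_le_lower hs hle))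

theorem vote_corr_add_vote_le (hp : G.IsLevelStable pl) (hN : G.IsFeasible N)
    (τ : Correspondence R H) (hr : r ∈ residentsOf N h \ residentsOf pl.edges h) :
    vote (G.hospList h) (some r) (τ.corr h N pl.edges r) +
        vote (G.resList r) (some h) (partner pl.edges r) ≤
      2 * (pl.level r - pl.price (τ.corr h N pl.edges r)) := by
  have hmem := Finset.mem_sdiff.1 hr
  rw [mem_residentsOf, mem_residentsOf] at hmem
  have hrh := hN.isMatching.mem_resList hmem.1
  rw [add_comm]
  rcases hc : τ.corr h N pl.edges r with _ | r'
  · have hlt := τ.card_lt_of_mem_unpaired (Finset.mem_filter.2 ⟨hr, hc⟩)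
    exact hp.vote_add_one_le hrh hmem.2
      (hlt.trans_le (hN.isMatching.card_residentsOf_le_upper h))
  · have hr' := (Finset.mem_sdiff.1 (τ.pairing h N pl.edges r r' hr hc).1).1
    obtain ⟨t, ht⟩ := pl.mem_edges.1 (mem_residentsOf.1 hr')
    simpa only [Placement.price, Option.elim_some, Placement.level_of_eq_some ht] using
      hp.vote_add_vote_le hN.lower_le_upper hrh hmem.2 ht

theorem sum_level_unpaired_le (hp : G.IsLevelStable pl) (hN : G.IsFeasible N)
    (τ : Correspondence R H) (h : H) : ∑ r ∈ τ.unpaired h pl.edges N, (pl.level r : ℤ) ≤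
      (τ.unpaired h pl.edges N).card * (Fintype.card R - 1) := by
  rw [← nsmul_eq_mul]
  refine Finset.sum_le_card_nsmul _ _ _ fun r hr => ?_
  have hlt := hp.level_lt_card hN (Finset.mem_sdiff.1 (Finset.mem_filter.1 hr).1).1
    (τ.card_lt_of_mem_unpaired hr)
  omega

theorem hospVote_add_sum_vote_le (hp : G.IsLevelStable pl) (hN : G.IsFeasible N)
    (τ : Correspondence R H) (h : H) :
    G.toHR.hospVote τ N pl.edges h + ∑ r ∈ residentsOf N h \ residentsOf pl.edges h,
        vote (G.resList r) (some h) (partner pl.edges r) ≤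
      2 * (∑ r ∈ residentsOf N h \ residentsOf pl.edges h, (pl.level r : ℤ) -
          ∑ r ∈ residentsOf pl.edges h \ residentsOf N h, (pl.level r : ℤ)) +
        2 * ((Fintype.card R : ℤ) - 1) *
          ((residentsOf pl.edges h).card - (residentsOf N h).card) := by
  have hvotes := Finset.sum_le_sum fun r hr => hp.vote_corr_add_vote_le hN (h := h) (r := r) τ hr
  rw [Finset.sum_add_distrib, ← Finset.mul_sum, Finset.sum_sub_distrib,
    τ.sum_comp_corr h N pl.edges, nsmul_eq_mul] at hvotes
  rw [HR.hospVote_eq_sum_sub_card, ← τ.card_unpaired_sub_card_unpaired h pl.edges N,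
    ← τ.sum_unpaired_add_sum_paired h pl.edges N]
  have hunpaired := hp.sum_level_unpaired_le hN τ h
  simp only [Placement.price, Option.elim_none, Option.elim_some] at hvotes
  linarith

end IsLevelStable

theorem IsLevelStable.votes_nonpos {G : HRLQ R H} {pl : Placement R H} (hp : G.IsLevelStable pl)
    {N : Finset (R × H)} (hN : G.IsFeasible N) (hcard : pl.edges.card ≤ N.card)
    (τ : Correspondence R H) : G.toHR.votes τ N pl.edges ≤ 0 := by
  have hsum := Finset.sum_le_sum fun h (_ : h ∈ Finset.univ) => hp.hospVote_add_sum_vote_le hN τ h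
  simp_rw [← residentsOf_sdiff, Finset.sum_add_distrib, ← Finset.mul_sum, Finset.sum_sub_distrib,
    sum_residentsOf _ fun r _ => (pl.level r : ℤ), ← Nat.cast_sum, sum_card_residentsOf,
    sum_residentsOf _ fun r h => vote (G.resList r) (some h) (partner pl.edges r)] at hsum
  have hres := G.toHR.sum_vote_partner_le pl.isSingleValued_edges hN.isMatching.isSingleValued
  have hlevel : ∑ e ∈ N, (pl.level e.1 : ℤ) ≤ ∑ e ∈ pl.edges, (pl.level e.1 : ℤ) :=
    mod_cast pl.sum_level_le_sum_level_edges hN.isMatching.isSingleValued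
  have hprod : ((Fintype.card R : ℤ) - 1) * (pl.edges.card - N.card) ≤ 0 := by
    have hN_le := hN.isMatching.card_le
    rcases Nat.eq_zero_or_pos (Fintype.card R) with hzero | hpos
    · simp [show N.card = 0 by omega, show pl.edges.card = 0 by omega]
    · exact mul_nonpos_of_nonneg_of_nonpos (by omega) (by omega)
  push_cast at hsum
  rw [Finset.sum_sdiff_sub_sum_sdiff] at hsum
  rw [HR.votes]
  linarith

namespace IsLevelStable

variable {G} {pl : Placement R H} {h : H} {s : ℕ} {N : Finset (R × H)}

theorem card_movers_succ_lt (hp : G.IsLevelStable pl) (hq : ∀ h, G.lower h ≤ G.upper h)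
    (hN : G.toHR.IsMatching N) (hs : s < G.numLevels)
    (hlt : ∑ h ∈ G.openHospitals pl s, (residentsOf pl.edges h).card <
      ∑ h ∈ G.openHospitals pl s, (residentsOf N h).card) :
    (pl.movers N (s + 1)).card < (pl.movers N s).card := by
  rw [sum_card_mem_residentsOf, sum_card_mem_residentsOf,
    ← Finset.card_sdiff_lt_card_sdiff_iff] at hlt
  refine lt_of_le_of_lt ?_ (hlt.trans_le ?_)
  · refine (Finset.card_le_card fun r hr => ?_).trans (Finset.card_image_le (f := Prod.fst))
    obtain ⟨h, t, hpr, hst, hrN⟩ := pl.mem_movers.1 hr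
    have hopen : h ∈ G.openHospitals pl s := mem_openHospitals.2
      ((hp.card_upTo_lt hpr hst).trans_le (levelCap_anti hq h (Nat.le_of_succ_le hst)))
    exact Finset.mem_image.2 ⟨(r, h), by simp [-mem_openHospitals, hopen, hrN, hpr], rfl⟩
  · refine Finset.card_le_card_of_injOn Prod.fst ?_
      (hN.isSingleValued.injOn_fst.mono fun e he => ?_)
    · rintro ⟨r, h⟩ he
      simp only [Finset.mem_coe, Finset.mem_sdiff, Finset.mem_filter, mem_openHospitals] at he
      obtain ⟨⟨hrN, hopen⟩, hrM⟩ := he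
      obtain ⟨h', t, hpr, hst⟩ := exists_le_of_not_desires (hN.mem_resList hrN)
        (hp.not_desires_of_card_upTo_lt hs hopen)
      refine pl.mem_movers.2 ⟨h', t, hpr, hst, fun hrN' => hrM ⟨?_, hopen⟩⟩
      rw [hN.isSingleValued r h h' hrN hrN']
      exact Placement.mem_edges_of_eq_some hpr
    · exact (Finset.mem_filter.1 (Finset.mem_sdiff.1 he).1).1

theorem card_movers_add_le (hp : G.IsLevelStable pl) (hq : ∀ h, G.lower h ≤ G.upper h)
    (hN : G.toHR.IsMatching N) {a b : ℕ} (hab : a ≤ b) (hb : b ≤ G.numLevels)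
    (hlt : ∀ s, a ≤ s → s < b → ∑ h ∈ G.openHospitals pl s, (residentsOf pl.edges h).card <
      ∑ h ∈ G.openHospitals pl s, (residentsOf N h).card) :
    (pl.movers N b).card + (b - a) ≤ (pl.movers N a).card := by
  induction b, hab using Nat.le_induction with
  | base => simp
  | succ b hab ih =>
    have hrest := ih (Nat.le_of_succ_le hb) fun s has hsb => hlt s has (hsb.trans b.lt_succ_self)
    have hstep := hp.card_movers_succ_lt hq hN hb (hlt b hab b.lt_succ_self)
    omega

theorem card_filter_level_le_lower (hp : G.IsLevelStable pl) (h : H) :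
    ((residentsOf pl.edges h).filter fun r => Fintype.card R ≤ pl.level r).card ≤ G.lower h := by
  rcases Finset.eq_empty_or_nonempty ((residentsOf pl.edges h).filter
    fun r => Fintype.card R ≤ pl.level r) with hempty | ⟨r, hr⟩
  · simp [hempty]
  · obtain ⟨hr, hlevel⟩ := Finset.mem_filter.1 hr
    obtain ⟨s, hs⟩ := pl.mem_edges.1 (mem_residentsOf.1 hr)
    rw [Placement.level_of_eq_some hs] at hlevel
    exact (Finset.card_filter_le _ _).trans (hp.card_residentsOf_le_lower hs hlevel)

theorem card_movers_lt_sum_lower (hp : G.IsLevelStable pl)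
    (hh : (residentsOf pl.edges h).card < G.lower h) (N : Finset (R × H)) :
    (pl.movers N (Fintype.card R)).card < ∑ h, G.lower h := by
  refine lt_of_le_of_lt ?_ (Finset.sum_lt_sum (fun h _ => hp.card_filter_level_le_lower h)
    ⟨h, Finset.mem_univ h, (Finset.card_filter_le _ _).trans_lt hh⟩)
  refine (Finset.card_le_card fun r hr => ?_).trans Finset.card_biUnion_le
  obtain ⟨h, t, hpr, hle, -⟩ := pl.mem_movers.1 hr
  refine Finset.mem_biUnion.2 ⟨h, Finset.mem_univ h, Finset.mem_filter.2 ⟨?_, ?_⟩⟩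
  · exact mem_residentsOf.2 (Placement.mem_edges_of_eq_some hpr)
  · rwa [Placement.level_of_eq_some hpr]

theorem card_residentsOf_le_lower_of_mem_openHospitals (hp : G.IsLevelStable pl)
    (hs : Fintype.card R ≤ s) (hh : h ∈ G.openHospitals pl s) :
    (residentsOf pl.edges h).card ≤ G.lower h := by
  by_cases hhigh : ∃ r t, pl r = some (h, t) ∧ Fintype.card R ≤ t
  · obtain ⟨r, t, hr, ht⟩ := hhigh
    exact hp.card_residentsOf_le_lower hr ht
  · push Not at hhigh
    rw [← pl.upTo_eq_residentsOf fun r t hr => (hhigh r t hr).le.trans hs, ← levelCap_of_le hs]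
    exact (mem_openHospitals.1 hh).le

theorem isFeasible (hp : G.IsLevelStable pl) (hN : G.IsFeasible N) : G.IsFeasible pl.edges := by
  have hq := hN.lower_le_upper
  refine ⟨hp.isMatching hq, fun h₀ => ?_⟩
  by_contra! hdeficient
  have hmovers := hp.card_movers_add_le hq hN.isMatching G.card_le_numLevels le_rfl
    fun s hs _ => Finset.sum_lt_sum
      (fun h hh => (hp.card_residentsOf_le_lower_of_mem_openHospitals hs hh).trans
        (hN.lower_le_card_residentsOf h))
      ⟨h₀, mem_openHospitals.2 (by
        rw [levelCap_of_le hs]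
        exact (Finset.card_le_card (pl.upTo_subset_residentsOf h₀ s)).trans_lt hdeficient),
      hdeficient.trans_le (hN.lower_le_card_residentsOf h₀)⟩
  have hfew := hp.card_movers_lt_sum_lower hdeficient N
  rw [numLevels] at hmovers
  omega

theorem sum_card_openHospitals_lt (hN : G.toHR.IsMatching N) (hs : s < Fintype.card R)
    (hcard : pl.edges.card < N.card) :
    ∑ h ∈ G.openHospitals pl s, (residentsOf pl.edges h).card <
      ∑ h ∈ G.openHospitals pl s, (residentsOf N h).card := by
  have hfull : ∑ h ∈ (G.openHospitals pl s)ᶜ, (residentsOf N h).card ≤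
      ∑ h ∈ (G.openHospitals pl s)ᶜ, (residentsOf pl.edges h).card := by
    refine Finset.sum_le_sum fun h hh => (hN.card_residentsOf_le_upper h).trans ?_
    rw [Finset.mem_compl, mem_openHospitals, not_lt, levelCap_of_lt hs] at hh
    exact hh.trans (Finset.card_le_card (pl.upTo_subset_residentsOf h s))
  rw [← sum_card_residentsOf, ← sum_card_residentsOf N,
    ← Finset.sum_add_sum_compl (G.openHospitals pl s),
    ← Finset.sum_add_sum_compl (G.openHospitals pl s)] at hcard
  omega

theorem isMaxFeasible (hp : G.IsLevelStable pl) (hN : G.IsFeasible N) :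
    G.IsMaxFeasible pl.edges := by
  refine ⟨hp.isFeasible hN, fun N hN => ?_⟩
  by_contra! hcard
  have hmovers := hp.card_movers_add_le hN.lower_le_upper hN.isMatching (Nat.zero_le _)
    G.card_le_numLevels fun s _ hs => sum_card_openHospitals_lt hN.isMatching hs hcard
  have hplaced : (pl.movers N 0).card ≤ pl.edges.card := by
    refine (Finset.card_le_card fun r hr => ?_).trans (Finset.card_image_le (f := Prod.fst))
    obtain ⟨h, t, hpr, -⟩ := pl.mem_movers.1 hr
    exact Finset.mem_image.2 ⟨(r, h), Placement.mem_edges_of_eq_some hpr, rfl⟩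
  have hN_le := hN.isMatching.card_le
  omega

end IsLevelStable

end LevelStable

end HRLQ

end Placements

section Exchanges

variable {R : Type u} {H : Type v} [DecidableEq R] [DecidableEq H] {σ : Correspondence R H}
  {M N S : Finset (R × H)} {ρ : List (R × H)}

namespace Linked

variable {e f g k : R × H}

theorem symm (hl : Linked σ M N e f) : Linked σ M N f e := by
  obtain ⟨he, hf, hne, hfst | ⟨hsnd, hcorr⟩⟩ := hl
  · exact ⟨hf, he, hne.symm, Or.inl hfst.symm⟩
  · rw [hsnd] at hcorr
    exact ⟨hf, he, hne.symm, Or.inr ⟨hsnd.symm, hcorr.elim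
      (fun ⟨heM, hfN, hto⟩ => Or.inr ⟨hfN, heM, hto⟩)
      (fun ⟨heN, hfM, hto⟩ => Or.inl ⟨hfM, heN, hto⟩)⟩⟩

theorem mem_iff (hM : IsSingleValued M) (hN : IsSingleValued N) (hl : Linked σ M N e f) :
    e ∈ M ↔ f ∉ M := by
  obtain ⟨he, hf, hne, hfst | ⟨-, hcorr⟩⟩ := hl
  · rw [Finset.mem_symmDiff] at he hf
    have hnotM : ¬ (e ∈ M ∧ f ∈ M) := fun h => hne (hM.injOn_fst h.1 h.2 hfst)
    have hnotN : ¬ (e ∈ N ∧ f ∈ N) := fun h => hne (hN.injOn_fst h.1 h.2 hfst)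
    tauto
  · rw [Finset.mem_symmDiff] at he hf
    tauto

theorem eq_of_fst_eq (hM : IsSingleValued M) (hN : IsSingleValued N) (hf : Linked σ M N e f)
    (hg : Linked σ M N e g) (hef : e.1 = f.1) (heg : e.1 = g.1) : f = g := by
  have hfst : f.1 = g.1 := hef.symm.trans heg
  have hfM := hf.mem_iff hM hN
  have hgM := hg.mem_iff hM hN
  have hfMN := Finset.mem_symmDiff.1 hf.2.1
  have hgMN := Finset.mem_symmDiff.1 hg.2.1
  by_cases he : e ∈ M
  · exact hN.injOn_fst (show f ∈ N by tauto) (show g ∈ N by tauto) hfst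
  · exact hM.injOn_fst (show f ∈ M by tauto) (show g ∈ M by tauto) hfst

theorem corr_of_mem_left (hl : Linked σ M N e f) (hne : e.1 ≠ f.1) (he : e ∈ M) :
    σ.corr e.2 M N e.1 = some f.1 := by
  have heMN := Finset.mem_symmDiff.1 hl.1
  rcases hl.2.2.2.resolve_left hne with ⟨-, ⟨-, -, hto⟩ | ⟨heN, -⟩⟩
  · exact hto
  · tauto

theorem corr_of_mem_right (hl : Linked σ M N e f) (hne : e.1 ≠ f.1) (he : e ∈ N) :
    σ.corr e.2 N M e.1 = some f.1 := by
  have heMN := Finset.mem_symmDiff.1 hl.1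
  have hfMN := Finset.mem_symmDiff.1 hl.2.1
  obtain ⟨hsnd, ⟨heM, -⟩ | ⟨-, hfM, hto⟩⟩ := hl.2.2.2.resolve_left hne
  · tauto
  · refine (σ.pairing e.2 M N f.1 e.1 ?_ hto).2
    rw [hsnd, Finset.mem_sdiff, mem_residentsOf, mem_residentsOf]
    tauto

theorem eq_of_fst_ne (hf : Linked σ M N e f) (hg : Linked σ M N e g) (hef : e.1 ≠ f.1)
    (heg : e.1 ≠ g.1) : f = g := by
  refine Prod.ext (Option.some.inj ?_)
    ((hf.2.2.2.resolve_left hef).1.symm.trans (hg.2.2.2.resolve_left heg).1)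
  rcases Finset.mem_symmDiff.1 hf.1 with ⟨he, -⟩ | ⟨he, -⟩
  · rw [← hf.corr_of_mem_left hef he, hg.corr_of_mem_left heg he]
  · rw [← hf.corr_of_mem_right hef he, hg.corr_of_mem_right heg he]

theorem eq_or_eq (hM : IsSingleValued M) (hN : IsSingleValued N) (hf : Linked σ M N e f)
    (hg : Linked σ M N e g) (hk : Linked σ M N e k) (hne : f ≠ g) : k = f ∨ k = g := by
  have huniq : ∀ {x y}, Linked σ M N e x → Linked σ M N e y → (e.1 = x.1 ↔ e.1 = y.1) → x = y := by
    intro x y hx hy hxy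
    by_cases hex : e.1 = x.1
    · exact hx.eq_of_fst_eq hM hN hy hex (hxy.1 hex)
    · exact hx.eq_of_fst_ne hy hex (hxy.not.1 hex)
  have hfg := mt (huniq hf hg) hne
  by_cases hkf : e.1 = k.1 ↔ e.1 = f.1
  · exact Or.inl (huniq hk hf hkf)
  · exact Or.inr (huniq hk hg (by tauto))

end Linked

/-- `S` is a union of components of the decomposition of `M ⊕ N`: a set of edges closed under
passing to a consecutive edge. -/
def IsComponentUnion (σ : Correspondence R H) (M N S : Finset (R × H)) : Prop :=
  S ⊆ M ∆ N ∧ ∀ e ∈ S, ∀ f, Linked σ M N e f → f ∈ S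

namespace IsComponentUnion

variable {r r' : R} {h h' : H}

theorem mem_right_of_notMem_left (hS : IsComponentUnion σ M N S) {e : R × H} (he : e ∈ S)
    (heM : e ∉ M) : e ∈ N := by
  have := Finset.mem_symmDiff.1 (hS.1 he)
  tauto

theorem mem_iff_of_corr (hS : IsComponentUnion σ M N S)
    (hr : r ∈ residentsOf M h \ residentsOf N h) (hr' : r' ∈ residentsOf N h \ residentsOf M h)
    (hto : σ.corr h M N r = some r') : (r, h) ∈ S ↔ (r', h) ∈ S := by
  simp only [Finset.mem_sdiff, mem_residentsOf] at hr hr'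
  have hl : Linked σ M N (r, h) (r', h) :=
    ⟨Finset.mem_symmDiff.2 (Or.inl hr), Finset.mem_symmDiff.2 (Or.inr hr'),
      fun heq => hr'.2 (heq ▸ hr.1), Or.inr ⟨rfl, Or.inl ⟨hr.1, hr'.1, hto⟩⟩⟩
  exact ⟨fun hmem => hS.2 _ hmem _ hl, fun hmem => hS.2 _ hmem _ hl.symm⟩

theorem card_filter_paired (hS : IsComponentUnion σ M N S) :
    ((σ.paired h M N).filter fun r => (r, h) ∈ S).card =
      ((σ.paired h N M).filter fun r => (r, h) ∈ S).card := by
  have hcomm := σ.sum_paired_comm h M N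
    fun x _ => x.elim 0 fun r => if (r, h) ∈ S then 1 else 0
  have hcongr : ∀ r ∈ σ.paired h N M,
      (σ.corr h N M r).elim 0 (fun r' => if (r', h) ∈ S then 1 else 0) =
        if (r, h) ∈ S then 1 else 0 := by
    intro r hr
    obtain ⟨r', hr', hto, hback⟩ := Correspondence.exists_corr_of_mem_paired hr
    rw [hto]
    exact if_congr (hS.mem_iff_of_corr (Finset.mem_filter.1 hr').1 (Finset.mem_filter.1 hr).1 hback)
      rfl rfl
  rw [Finset.sum_congr rfl hcongr] at hcomm
  simpa using hcomm

theorem card_residentsOf_symmDiff (hS : IsComponentUnion σ M N S) (h : H) :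
    (residentsOf (M ∆ S) h).card + ((σ.unpaired h M N).filter fun r => (r, h) ∈ S).card =
      (residentsOf M h).card + ((σ.unpaired h N M).filter fun r => (r, h) ∈ S).card := by
  set lost := (residentsOf M h \ residentsOf N h).filter fun r => (r, h) ∈ S with hlost
  set gained := (residentsOf N h \ residentsOf M h).filter fun r => (r, h) ∈ S with hgained
  have hexchange : residentsOf (M ∆ S) h = (residentsOf M h \ lost) ∪ gained := by
    ext r
    have hr : (r, h) ∈ S → _ := fun hr => Finset.mem_symmDiff.1 (hS.1 hr)
    simp only [hlost, hgained, mem_residentsOf, Finset.mem_union, Finset.mem_sdiff,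
      Finset.mem_filter, Finset.mem_symmDiff]
    tauto
  have hdisj : Disjoint (residentsOf M h \ lost) gained :=
    Finset.disjoint_of_subset_left Finset.sdiff_subset
      (Finset.disjoint_of_subset_right (Finset.filter_subset _ _) Finset.disjoint_sdiff)
  have hsub : lost ⊆ residentsOf M h := (Finset.filter_subset _ _).trans Finset.sdiff_subset
  have hsplit : ∀ A B : Finset (R × H), ((σ.unpaired h A B).filter fun r => (r, h) ∈ S).card +
      ((σ.paired h A B).filter fun r => (r, h) ∈ S).card =
        ((residentsOf A h \ residentsOf B h).filter fun r => (r, h) ∈ S).card := by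
    simpa only [Finset.card_filter] using fun A B => σ.sum_unpaired_add_sum_paired h A B _
  have hM : _ = lost.card := hsplit M N
  have hN : _ = gained.card := hsplit N M
  have hpaired := hS.card_filter_paired (h := h)
  have hcard := Finset.card_sdiff_add_card_eq_card hsub
  rw [hexchange, Finset.card_union_of_disjoint hdisj]
  omega

theorem card_residentsOf_symmDiff_mem_uIcc (hS : IsComponentUnion σ M N S) (h : H) :
    (residentsOf (M ∆ S) h).card ∈
      Set.uIcc (residentsOf M h).card (residentsOf N h).card := by
  have hcard := hS.card_residentsOf_symmDiff h
  have hunpaired := σ.card_unpaired_sub_card_unpaired h M N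
  have hle : ∀ A B : Finset (R × H), ((σ.unpaired h A B).filter fun r => (r, h) ∈ S).card ≤
      (σ.unpaired h A B).card := fun A B => Finset.card_filter_le _ _
  have hM := hle M N
  have hN := hle N M
  have hempty : (σ.unpaired h M N).card = 0 ∨ (σ.unpaired h N M).card = 0 := by
    by_contra! hpos
    obtain ⟨r, hr⟩ := Finset.card_pos.1 (Nat.pos_of_ne_zero hpos.1)
    obtain ⟨r', hr'⟩ := Finset.card_pos.1 (Nat.pos_of_ne_zero hpos.2)
    exact (Correspondence.card_lt_of_mem_unpaired hr).asymm
      (Correspondence.card_lt_of_mem_unpaired hr')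
  rw [Set.mem_uIcc]
  omega

theorem isSingleValued_symmDiff (hS : IsComponentUnion σ M N S) (hM : IsSingleValued M)
    (hN : IsSingleValued N) : IsSingleValued (M ∆ S) := by
  have hmixed : ∀ {r h h'}, (r, h) ∈ M ∧ (r, h) ∉ S → (r, h') ∈ S ∧ (r, h') ∉ M → h = h' := by
    rintro r h h' ⟨hrM, hrS⟩ ⟨hrS', hrM'⟩
    by_contra hne
    have hrN' := hS.mem_right_of_notMem_left hrS' hrM'
    have hrN : (r, h) ∉ N := fun hrN => hne (hN r h h' hrN hrN')
    exact hrS (hS.2 _ hrS' _ ⟨hS.1 hrS', Finset.mem_symmDiff.2 (Or.inl ⟨hrM, hrN⟩),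
      by simp [Ne.symm hne], Or.inl rfl⟩)
  intro r h h' hr hr'
  rcases Finset.mem_symmDiff.1 hr with hr | hr <;> rcases Finset.mem_symmDiff.1 hr' with hr' | hr'
  · exact hM r h h' hr.1 hr'.1
  · exact hmixed hr hr'
  · exact (hmixed hr' hr).symm
  · exact hN r h h' (hS.mem_right_of_notMem_left hr.1 hr.2)
      (hS.mem_right_of_notMem_left hr'.1 hr'.2)

theorem isFeasible_symmDiff {G : HRLQ R H} (hS : IsComponentUnion σ M N S)
    (hM : G.IsFeasible M) (hN : G.IsFeasible N) : G.IsFeasible (M ∆ S) := by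
  have hcard := fun h => Set.mem_uIcc.1 (hS.card_residentsOf_symmDiff_mem_uIcc h)
  refine ⟨⟨fun e he => ?_, hS.isSingleValued_symmDiff hM.isMatching.isSingleValued
    hN.isMatching.isSingleValued, fun h => ?_⟩, fun h => ?_⟩
  · rcases Finset.mem_symmDiff.1 he with ⟨heM, -⟩ | ⟨heS, heM⟩
    · exact hM.isMatching.mem_resList heM
    · exact hN.isMatching.mem_resList (hS.mem_right_of_notMem_left heS heM)
  · have := hM.isMatching.card_residentsOf_le_upper h
    have := hN.isMatching.card_residentsOf_le_upper h
    have := hcard h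
    omega
  · have := hM.lower_le_card_residentsOf h
    have := hN.lower_le_card_residentsOf h
    have := hcard h
    omega

end IsComponentUnion

theorem countP_add_one_of_isChain_alternating {α : Type*} {p : α → Bool} {l : List α}
    (hl : l.IsChain fun a b => p a = !p b) : ∀ e ∈ l.head?, ∀ f ∈ l.getLast?,
      l.countP p + 1 = l.countP (fun a => !p a) + (p e).toNat + (p f).toNat := by
  induction l with
  | nil => simp
  | cons a l ih =>
    rcases l with _ | ⟨b, l⟩
    · cases h : p a <;> simp [h]
    · rw [List.isChain_cons_cons] at hl
      intro e he f hf
      obtain rfl : a = e := by simpa using he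
      have htail := ih hl.2 b (by simp) f (by simpa [List.getLast?_cons_cons] using hf)
      rw [List.countP_cons, List.countP_cons (l := b :: l) (a := a)]
      have hab := hl.1
      cases ha : p a <;> cases hb : p b <;> simp [ha, hb] at hab htail ⊢ <;> omega

theorem card_symmDiff_of_oneEndMatched (hM : IsSingleValued M) (hN : IsSingleValued N)
    (hnodup : ρ.Nodup) (hchain : ρ.IsChain (Linked σ M N)) (hends : OneEndMatched M ρ) :
    (M ∆ ρ.toFinset).card = M.card := by
  obtain ⟨e, he, f, hf, hxor⟩ := hends
  have halt : ρ.IsChain fun a b => decide (a ∈ M) = !decide (b ∈ M) :=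
    hchain.imp fun a b hab => by simp [hab.mem_iff hM hN]
  have hcount := countP_add_one_of_isChain_alternating halt e he f hf
  have hone : (decide (e ∈ M)).toNat + (decide (f ∈ M)).toNat = 1 := by
    rcases hxor with ⟨he, hf⟩ | ⟨he, hf⟩ <;> simp [he, hf]
  have hcard : ∀ p : R × H → Prop, [DecidablePred p] →
      ρ.countP (fun a => decide (p a)) = (ρ.toFinset.filter p).card := by
    intro p _
    rw [List.countP_eq_length_filter, ← List.toFinset_card_of_nodup (hnodup.filter _),
      List.toFinset_filter]
    simp
  simp only [← decide_not, hcard, Finset.filter_mem_eq_inter, Finset.filter_notMem_eq_sdiff]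
    at hcount
  have hinter := Finset.card_sdiff_add_card_inter M ρ.toFinset
  rw [Finset.inter_comm] at hinter
  rw [symmDiff_def, Finset.sup_eq_union, Finset.card_union_of_disjoint disjoint_sdiff_sdiff]
  omega

namespace IsAltCycle

theorem exists_two_linked (hρ : IsAltCycle σ M N ρ) {e : R × H} (he : e ∈ ρ) :
    ∃ f ∈ ρ, ∃ g ∈ ρ, f ≠ g ∧ Linked σ M N e f ∧ Linked σ M N e g := by
  obtain ⟨hnodup, hchain, hlen, hclose⟩ := hρ
  have hlast : ∀ i (hi : i < ρ.length), i + 1 = ρ.length → Linked σ M N ρ[i] ρ[0] :=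
    fun i hi heq => hclose _ (by simp [List.getLast?_eq_getElem?, ← heq]) _
      (by simp [List.head?_eq_getElem?])
  have hsucc : ∀ i (hi : i + 1 < ρ.length), Linked σ M N ρ[i] ρ[i + 1] :=
    List.isChain_iff_getElem.1 hchain
  have hne : ∀ {i j} (hi : i < ρ.length) (hj : j < ρ.length), i ≠ j → ρ[i] ≠ ρ[j] :=
    fun hi hj hij heq => hij (hnodup.getElem_inj_iff.1 heq)
  obtain ⟨i, hi, rfl⟩ := List.getElem_of_mem he
  obtain rfl | ⟨j, rfl⟩ : i = 0 ∨ ∃ j, i = j + 1 := by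
    cases i <;> simp
  · exact ⟨_, List.getElem_mem _, _, List.getElem_mem _, hne _ _ (by omega), hsucc 0 (by omega),
      (hlast (ρ.length - 1) (by omega) (by omega)).symm⟩
  by_cases hj : j + 1 + 1 < ρ.length
  · exact ⟨_, List.getElem_mem _, _, List.getElem_mem _, hne _ _ (by omega), hsucc (j + 1) hj,
      (hsucc j hi).symm⟩
  · exact ⟨_, List.getElem_mem _, _, List.getElem_mem _, hne _ _ (by omega),
      hlast (j + 1) hi (by omega), (hsucc j hi).symm⟩

theorem isComponentUnion (hρ : IsAltCycle σ M N ρ) (hM : IsSingleValued M)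
    (hN : IsSingleValued N) : IsComponentUnion σ M N ρ.toFinset := by
  refine ⟨fun e he => ?_, fun e he k hk => ?_⟩ <;>
    obtain ⟨f, hf, g, hg, hne, hef, heg⟩ := hρ.exists_two_linked (List.mem_toFinset.1 he)
  · exact hef.1
  · rw [List.mem_toFinset]
    obtain rfl | rfl := hef.eq_or_eq hM hN heg hk hne
    · exact hf
    · exact hg

theorem oneEndMatched (hρ : IsAltCycle σ M N ρ) (hM : IsSingleValued M)
    (hN : IsSingleValued N) : OneEndMatched M ρ := by
  obtain ⟨-, -, hlen, hclose⟩ := hρ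
  have hne : ρ ≠ [] := List.ne_nil_of_length_pos (by omega)
  refine ⟨_, List.head_mem_head? hne, _, List.getLast_mem_getLast? hne, ?_⟩
  have hends := (hclose _ (List.getLast_mem_getLast? hne) _ (List.head_mem_head? hne)).mem_iff hM hN
  unfold Xor
  tauto

end IsAltCycle

theorem IsAltPath.isComponentUnion (hρ : IsAltPath σ M N ρ) :
    IsComponentUnion σ M N ρ.toFinset :=
  ⟨fun e he => hρ.2.2.1 e (List.mem_toFinset.1 he), fun e he f hef =>
    List.mem_toFinset.2 (hρ.2.2.2.2.2 e (List.mem_toFinset.1 he) f hef)⟩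

namespace HRLQ.IsLevelStable

variable [Fintype R] [Fintype H] {G : HRLQ R H} {pl : Placement R H}

theorem votes_le_votes_swap (hp : G.IsLevelStable pl) (hN : G.IsFeasible N)
    (hcard : pl.edges.card ≤ N.card) (τ : Correspondence R H) :
    G.toHR.votes τ N pl.edges ≤ G.toHR.votes τ pl.edges N := by
  have hnonpos := hp.votes_nonpos hN hcard τ
  have hswap := G.toHR.votes_swap τ N pl.edges
  omega

theorem exchange (hp : G.IsLevelStable pl) (σ τ : Correspondence R H) (hN : G.IsFeasible N)
    (hρ : IsAltCycle σ pl.edges N ρ ∨ (IsAltPath σ pl.edges N ρ ∧ OneEndMatched pl.edges ρ)) :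
    G.IsFeasible (pl.edges ∆ ρ.toFinset) ∧
      G.toHR.votes τ (pl.edges ∆ ρ.toFinset) pl.edges ≤
        G.toHR.votes τ pl.edges (pl.edges ∆ ρ.toFinset) := by
  have hM := hp.isFeasible hN
  have hsM := hM.isMatching.isSingleValued
  have hsN := hN.isMatching.isSingleValued
  obtain ⟨hnodup, hchain, hunion, hends⟩ : ρ.Nodup ∧ ρ.IsChain (Linked σ pl.edges N) ∧
      IsComponentUnion σ pl.edges N ρ.toFinset ∧ OneEndMatched pl.edges ρ := by
    rcases hρ with hρ | ⟨hρ, hends⟩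
    · exact ⟨hρ.1, hρ.2.1, hρ.isComponentUnion hsM hsN, hρ.oneEndMatched hsM hsN⟩
    · exact ⟨hρ.2.1, hρ.2.2.2.1, hρ.isComponentUnion, hends⟩
  have hfeasible := hunion.isFeasible_symmDiff hM hN
  exact ⟨hfeasible, hp.votes_le_votes_swap hfeasible
    (card_symmDiff_of_oneEndMatched hsM hsN hnodup hchain hends).ge τ⟩

theorem isPopularAmongMaxFeasible (hp : G.IsLevelStable pl) (τ : Correspondence R H)
    (hN : G.IsFeasible N) : G.IsPopularAmongMaxFeasible τ pl.edges := by
  have hmax := hp.isMaxFeasible hN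
  refine ⟨hmax, fun N' hN' hpop => hpop.not_ge ?_⟩
  exact hp.votes_le_votes_swap hN'.1 (hN'.2 _ hmax.1) τ

end HRLQ.IsLevelStable

end Exchanges

section RankedLists

theorem prefers_iff_of_pairwise {α β : Type*} [DecidableEq α] [Preorder β] {l : List α}
    {key : α → β} (hl : l.Pairwise fun x y => key x < key y) {x y : α} :
    Prefers l x y ↔ x ∈ l ∧ y ∈ l ∧ key x < key y := by
  have hlt : ∀ {x y}, Prefers l x y → key x < key y := fun {x y} h => by
    simpa using List.pairwise_iff_getElem.1 hl _ _ (List.idxOf_lt_length_iff.2 h.1)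
      (List.idxOf_lt_length_iff.2 h.2.1) h.2.2
  refine ⟨fun h => ⟨h.1, h.2.1, hlt h⟩, fun ⟨hx, hy, hkey⟩ => ?_⟩
  have hne : x ≠ y := fun h => (h ▸ hkey).ne rfl
  exact (Prefers.or_of_ne hx hy hne).resolve_right fun h => lt_asymm hkey (hlt h)

theorem pairwise_idxOf_lt_of_nodup {α : Type*} [DecidableEq α] {l : List α} (hl : l.Nodup) :
    l.Pairwise fun x y => l.idxOf x < l.idxOf y := by
  rw [List.pairwise_iff_getElem]
  intro i j hi hj hij
  rwa [hl.idxOf_getElem, hl.idxOf_getElem]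

end RankedLists

theorem card_fin_filter_le_val (n k : ℕ) :
    (Finset.univ.filter fun i : Fin n => k ≤ i.val).card = n - k := by
  have hcompl := Finset.card_filter_add_card_filter_not (s := Finset.univ)
    (fun i : Fin n => i.val < k)
  simp only [not_lt, Finset.card_univ, Fintype.card_fin, Fin.card_filter_val_lt] at hcompl
  omega

theorem HR.isStable_iff {R : Type u} {H : Type v} [DecidableEq R] [DecidableEq H] (G : HR R H)
    {M : Finset (R × H)} :
    G.IsStable M ↔ G.IsMatching M ∧ ∀ r, ∀ h ∈ G.resList r,
      (∀ h', (r, h') ∈ M → Prefers (G.resList r) h h') →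
        G.upper h ≤ (residentsOf M h).card ∧
          ∀ r' ∈ residentsOf M h, Prefers (G.hospList h) r' r := by
  refine and_congr_right fun hM => forall_congr' fun r => forall_congr' fun h => ?_
  constructor
  · refine fun hblocks hh hwants => ?_
    have hfree : (∀ h', (r, h') ∉ M) ∨ ∃ h', (r, h') ∈ M ∧ Prefers (G.resList r) h h' :=
      or_iff_not_imp_left.2 fun hmatched => by
        push Not at hmatched
        exact hmatched.imp fun h' hr => ⟨hr, hwants h' hr⟩
    obtain ⟨hcap, hbetter⟩ := not_or.1 fun hopen => hblocks ⟨hh, hfree, hopen⟩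
    refine ⟨not_lt.1 hcap, fun r' hr' => ?_⟩
    have hne : r' ≠ r := fun he => (hwants h (he ▸ mem_residentsOf.1 hr')).ne rfl
    have hr'h : r' ∈ G.hospList h := (G.mem_iff r' h).1 (hM.1 _ (mem_residentsOf.1 hr'))
    exact (Prefers.or_of_ne hr'h ((G.mem_iff r h).1 hh) hne).resolve_right
      fun hpref => hbetter ⟨r', hr', hpref⟩
  · rintro hfull ⟨hh, hfree, hopen⟩
    have hwants : ∀ h', (r, h') ∈ M → Prefers (G.resList r) h h' := fun h' hr => by
      obtain hfree | ⟨h'', hr', hpref⟩ := hfree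
      · exact absurd hr (hfree h')
      · rwa [hM.isSingleValued r h' h'' hr hr']
    obtain ⟨hcap, hbetter⟩ := hfull hh hwants
    obtain hlt | ⟨r', hr', hpref⟩ := hopen
    · exact hlt.not_ge hcap
    · exact hpref.asymm (hbetter r' hr')

section PlacementLevels

variable {R : Type u} {H : Type v} [Fintype R]

namespace Placement

variable (pl : Placement R H) {r : R} {h : H} {s : ℕ}

open Classical in
/-- The residents placed at the level-`s` copy of `h`. -/
noncomputable def residentsAt (h : H) (s : ℕ) : Finset R :=
  Finset.univ.filter fun r => pl r = some (h, s)

@[simp]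
theorem mem_residentsAt : r ∈ pl.residentsAt h s ↔ pl r = some (h, s) := by simp [residentsAt]

open Classical in
/-- The residents placed at `h` at a level smaller than `s`. -/
noncomputable def below (h : H) (s : ℕ) : Finset R :=
  Finset.univ.filter fun r => ∃ t, pl r = some (h, t) ∧ t < s

@[simp]
theorem mem_below : r ∈ pl.below h s ↔ ∃ t, pl r = some (h, t) ∧ t < s := by simp [below]

theorem below_zero (h : H) : pl.below h 0 = ∅ := by
  ext r
  simp

theorem below_succ (h : H) (s : ℕ) : pl.below h (s + 1) = pl.upTo h s := by
  ext r
  simp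

theorem card_upTo (h : H) (s : ℕ) :
    (pl.upTo h s).card = (pl.below h s).card + (pl.residentsAt h s).card := by
  classical
  rw [← Finset.card_union_of_disjoint]
  · congr 1
    ext r
    simp only [mem_upTo, Finset.mem_union, mem_below, mem_residentsAt, Nat.le_iff_lt_or_eq,
      and_or_left, exists_or, exists_eq_right]
  · refine Finset.disjoint_left.2 fun r hbelow hat => ?_
    obtain ⟨t, ht, hts⟩ := pl.mem_below.1 hbelow
    cases ht.symm.trans (pl.mem_residentsAt.1 hat)
    exact lt_irrefl _ hts

end Placement

end PlacementLevels

theorem HRLQ.levelCap_eq_numShort_add {R : Type u} {H : Type v} [Fintype R] {G : HRLQ R H}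
    (hq : ∀ h, G.lower h ≤ G.upper h) (h : H) (s : ℕ) :
    G.levelCap h s = G.numShort h s + G.levelCap h (s + 1) := by
  have := hq h
  unfold levelCap numShort
  split_ifs <;> omega

section Reduction

variable {R : Type u} {H : Type v} [Fintype R] [Fintype H]

namespace HRLQ

variable {G : HRLQ R H}

variable (G) in
/-- The dummy `d^s_{h,i}`, with its level given as a natural number. -/
def dummy (h : H) (s : ℕ) (hs : s + 1 < G.numLevels) (i : Fin (G.levelCap h s)) : G.Res :=
  Sum.inr ⟨h, ⟨s, by omega⟩, i⟩

theorem eq_inl_or_eq_dummy (x : G.Res) : (∃ r, x = Sum.inl r) ∨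
    ∃ (h : H) (s : ℕ) (hs : s + 1 < G.numLevels) (i : _), x = G.dummy h s hs i := by
  rcases x with r | ⟨h, s, i⟩
  · exact Or.inl ⟨r, rfl⟩
  · have := s.2
    exact Or.inr ⟨h, s.val, by omega, i, rfl⟩

theorem dummy_inj {h h' : H} {s t : ℕ} {hs : s + 1 < G.numLevels} {ht : t + 1 < G.numLevels}
    {i : Fin (G.levelCap h s)} {j : Fin (G.levelCap h' t)}
    (he : G.dummy h s hs i = G.dummy h' t ht j) : h = h' ∧ s = t ∧ i.val = j.val := by
  obtain ⟨rfl, he⟩ := Sigma.mk.inj (Sum.inr.inj he)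
  obtain ⟨hst, he⟩ := Sigma.mk.inj (eq_of_heq he)
  obtain rfl := Fin.mk.inj hst
  exact ⟨rfl, rfl, congrArg Fin.val (eq_of_heq he)⟩

theorem dummy_injective (h : H) (s : ℕ) (hs : s + 1 < G.numLevels) :
    Function.Injective (G.dummy h s hs) := fun _ _ he => Fin.ext (dummy_inj he).2.2

theorem mem_redResList_inl {r : R} {c : G.Copy} :
    c ∈ G.redResList (Sum.inl r) ↔ c.1 ∈ G.resList r := by
  obtain ⟨h, s⟩ := c
  simp [redResList]

theorem redResList_dummy (h : H) (s : ℕ) (hs : s + 1 < G.numLevels) (i : Fin (G.levelCap h s)) :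
    G.redResList (G.dummy h s hs i) =
      if i.val < G.numShort h s then [(h, ⟨s, by omega⟩)]
      else [(h, ⟨s, by omega⟩), (h, ⟨s + 1, hs⟩)] :=
  rfl

theorem mem_redResList_dummy {h : H} {s : ℕ} {hs : s + 1 < G.numLevels}
    {i : Fin (G.levelCap h s)} {c : G.Copy} : c ∈ G.redResList (G.dummy h s hs i) ↔
      c = (h, ⟨s, by omega⟩) ∨ c = (h, ⟨s + 1, hs⟩) ∧ G.numShort h s ≤ i.val := by
  rw [redResList_dummy]
  split_ifs with hi
  · simp [hi]
  · simp [not_lt.1 hi]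

theorem mem_redHospList {h : H} {s : ℕ} {hs : s < G.numLevels} {x : G.Res} :
    x ∈ G.redHospList (h, ⟨s, hs⟩) ↔ (∃ r ∈ G.hospList h, x = Sum.inl r) ∨
      (∃ (hs' : s + 1 < G.numLevels) (i : _), x = G.dummy h s hs' i) ∨
      ∃ (t : ℕ) (ht : t + 1 < G.numLevels) (i : _), t + 1 = s ∧ G.numShort h t ≤ i.val ∧
        x = G.dummy h t ht i := by
  rw [← G.red_mem_iff]
  rcases eq_inl_or_eq_dummy x with ⟨r, rfl⟩ | ⟨h', t, ht, i, rfl⟩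
  · simp [mem_redResList_inl, G.mem_iff, dummy]
  · rw [mem_redResList_dummy]
    constructor
    · simp only [Prod.mk.injEq, Fin.mk.injEq]
      rintro (⟨rfl, rfl⟩ | ⟨⟨rfl, rfl⟩, hi⟩)
      exacts [Or.inr (Or.inl ⟨ht, i, rfl⟩), Or.inr (Or.inr ⟨t, hs, i, rfl, hi, rfl⟩)]
    · rintro (⟨r, -, hx⟩ | ⟨hs', j, hx⟩ | ⟨t', ht', j, rfl, hj, hx⟩)
      · cases hx
      · obtain ⟨rfl, rfl, -⟩ := dummy_inj hx
        exact Or.inl rfl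
      · obtain ⟨rfl, rfl, hij⟩ := dummy_inj hx
        exact Or.inr ⟨rfl, hij ▸ hj⟩

variable (G) in
open Classical in
/-- The level-`s` dummies of `h`. -/
noncomputable def levelDummies (h : H) (s : ℕ) : Finset G.Res :=
  Finset.univ.filter fun x => ∃ (hs : s + 1 < G.numLevels) (i : _), x = G.dummy h s hs i

theorem mem_levelDummies {h : H} {s : ℕ} {x : G.Res} : x ∈ G.levelDummies h s ↔
    ∃ (hs : s + 1 < G.numLevels) (i : _), x = G.dummy h s hs i := by
  simp [levelDummies]

variable (G) in
open Classical in
/-- The dummies of the level below `s` that list the level-`s` copy of `h`. -/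
noncomputable def prevDummies (h : H) (s : ℕ) : Finset G.Res :=
  Finset.univ.filter fun x => ∃ (t : ℕ) (ht : t + 1 < G.numLevels) (i : _), t + 1 = s ∧
    G.numShort h t ≤ i.val ∧ x = G.dummy h t ht i

theorem mem_prevDummies_succ {h : H} {s : ℕ} {hs : s + 1 < G.numLevels} {x : G.Res} :
    x ∈ G.prevDummies h (s + 1) ↔ ∃ i, G.numShort h s ≤ i.val ∧ x = G.dummy h s hs i := by
  simp only [prevDummies, Finset.mem_filter, Finset.mem_univ, true_and]
  constructor
  · rintro ⟨t, ht, i, hts, hi, rfl⟩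
    obtain rfl : t = s := by omega
    exact ⟨i, hi, rfl⟩
  · rintro ⟨i, hi, rfl⟩
    exact ⟨s, hs, i, rfl, hi, rfl⟩

theorem prevDummies_zero (h : H) : G.prevDummies h 0 = ∅ := by simp [prevDummies]

theorem prevDummies_succ_subset (h : H) {s : ℕ} (hs : s + 1 < G.numLevels) :
    G.prevDummies h (s + 1) ⊆ G.levelDummies h s := by
  intro x hx
  obtain ⟨i, -, rfl⟩ := (mem_prevDummies_succ (hs := hs)).1 hx
  exact mem_levelDummies.2 ⟨hs, i, rfl⟩

theorem disjoint_levelDummies_prevDummies (h : H) (s : ℕ) :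
    Disjoint (G.levelDummies h s) (G.prevDummies h s) := by
  refine Finset.disjoint_left.2 fun x hx hx' => ?_
  obtain ⟨hs, i, rfl⟩ := mem_levelDummies.1 hx
  simp only [prevDummies, Finset.mem_filter, Finset.mem_univ, true_and] at hx'
  obtain ⟨t, ht, j, hts, -, he⟩ := hx'
  have := (dummy_inj he).2.1
  omega

theorem card_levelDummies (h : H) {s : ℕ} (hs : s + 1 < G.numLevels) :
    (G.levelDummies h s).card = G.levelCap h s := by
  classical
  have himage : G.levelDummies h s = Finset.univ.image (G.dummy h s hs) := by
    ext x
    simp [mem_levelDummies, hs, eq_comm]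
  rw [himage, Finset.card_image_of_injective _ (dummy_injective h s hs), Finset.card_univ,
    Fintype.card_fin]

theorem card_prevDummies_succ (hq : ∀ h, G.lower h ≤ G.upper h) (h : H) {s : ℕ}
    (hs : s + 1 < G.numLevels) : (G.prevDummies h (s + 1)).card = G.levelCap h (s + 1) := by
  classical
  have himage : G.prevDummies h (s + 1) = (Finset.univ.filter
      fun i : Fin (G.levelCap h s) => G.numShort h s ≤ i.val).image (G.dummy h s hs) := by
    ext x
    simp [mem_prevDummies_succ (hs := hs), eq_comm]
  rw [himage, Finset.card_image_of_injective _ (dummy_injective h s hs), card_fin_filter_le_val,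
    levelCap_eq_numShort_add hq h s, Nat.add_sub_cancel_left]

end HRLQ

end Reduction

section ReducedPreferences

variable {R : Type u} {H : Type v} [Fintype R] [Fintype H]

namespace HRLQ

variable {G : HRLQ R H}

variable (G) in
/-- The rank of a resident on the preference list of the level-`s` copy of `h`: the dummies of the
previous level have first component `0`, the residents of `G` have `1`, and the level-`s` dummies
have `2`. -/
def copyKey [DecidableEq R] (h : H) (s : ℕ) : G.Res → ℕ ×ₗ ℕ
  | Sum.inl r => toLex (1, (G.hospList h).idxOf r)
  | Sum.inr ⟨_, t, i⟩ => toLex (if t.val = s then 2 else 0, i.val)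

variable (G) in
/-- The rank of a copy on the preference list of the resident `r`. -/
def resKey [DecidableEq H] (r : R) (c : G.Copy) : ℕ ×ₗ ℕ :=
  toLex (G.numLevels - c.2.val, (G.resList r).idxOf c.1)

section HospitalKeys

variable [DecidableEq R]

theorem copyKey_inl (h : H) (s : ℕ) (r : R) :
    G.copyKey h s (Sum.inl r) = toLex (1, (G.hospList h).idxOf r) := rfl

theorem copyKey_dummy (h : H) (s t : ℕ) (ht : t + 1 < G.numLevels) (i : Fin (G.levelCap h t)) :
    G.copyKey h s (G.dummy h t ht i) = toLex (if t = s then 2 else 0, i.val) := rfl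

theorem pairwise_copyKey_dummies (h : H) (t : Fin (G.numLevels - 1)) (k s : ℕ) :
    (G.dummies h t k).Pairwise fun x y => G.copyKey h s x < G.copyKey h s y := by
  unfold dummies
  rw [List.pairwise_map]
  refine ((List.pairwise_lt_finRange _).filter _).imp fun {i j} hij => ?_
  exact Prod.Lex.toLex_lt_toLex.2 (Or.inr ⟨rfl, hij⟩)

theorem pairwise_copyKey_redHospList (h : H) (s : Fin G.numLevels) :
    (G.redHospList (h, s)).Pairwise fun x y => G.copyKey h s x < G.copyKey h s y := by
  have hfst : ∀ {x y : G.Res}, (ofLex (G.copyKey h s x)).1 < (ofLex (G.copyKey h s y)).1 →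
      G.copyKey h s x < G.copyKey h s y := fun hlt => Prod.Lex.lt_iff.2 (Or.inl hlt)
  have hprev : ∀ x ∈ (if hs : 0 < s.val then G.dummies h ⟨s.val - 1, by omega⟩
      (G.numShort h (s.val - 1)) else []), (ofLex (G.copyKey h s x)).1 = 0 := by
    intro x hx
    split_ifs at hx with hs
    · obtain ⟨i, -, rfl⟩ := (G.mem_dummies _ _ _ _).1 hx
      exact if_neg (by simp only; omega)
    · simp at hx
  have hreal : ∀ x ∈ (G.hospList h).map (Sum.inl : R → G.Res), (ofLex (G.copyKey h s x)).1 = 1 := by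
    intro x hx
    obtain ⟨r, -, rfl⟩ := List.mem_map.1 hx
    rfl
  have hlevel : ∀ x ∈ (if hs : s.val + 1 < G.numLevels then G.dummies h ⟨s.val, by omega⟩ 0
      else []), (ofLex (G.copyKey h s x)).1 = 2 := by
    intro x hx
    split_ifs at hx
    · obtain ⟨i, -, rfl⟩ := (G.mem_dummies _ _ _ _).1 hx
      exact if_pos rfl
    · simp at hx
  unfold redHospList
  rw [List.pairwise_append, List.pairwise_append]
  refine ⟨?_, ⟨?_, ?_, fun x hx y hy => hfst (by rw [hreal x hx, hlevel y hy]; norm_num)⟩,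
    fun x hx y hy => hfst ?_⟩
  · split_ifs
    exacts [pairwise_copyKey_dummies _ _ _ _, List.Pairwise.nil]
  · rw [List.pairwise_map]
    refine (pairwise_idxOf_lt_of_nodup (G.hospList_nodup h)).imp fun {a b} hlt => ?_
    exact Prod.Lex.toLex_lt_toLex.2 (Or.inr ⟨rfl, hlt⟩)
  · split_ifs
    exacts [pairwise_copyKey_dummies _ _ _ _, List.Pairwise.nil]
  · rw [hprev x hx]
    rcases List.mem_append.1 hy with hy | hy
    · rw [hreal y hy]
      norm_num
    · rw [hlevel y hy]
      norm_num

theorem prefers_redHospList [DecidableEq H] {h : H} {s : Fin G.numLevels} {x y : G.Res} :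
    Prefers (G.redHospList (h, s)) x y ↔ x ∈ G.redHospList (h, s) ∧ y ∈ G.redHospList (h, s) ∧
      G.copyKey h s x < G.copyKey h s y :=
  prefers_iff_of_pairwise (pairwise_copyKey_redHospList h s)

end HospitalKeys

section ResidentKeys

variable [DecidableEq H]

theorem pairwise_resKey_redResList (r : R) :
    (G.redResList (Sum.inl r)).Pairwise fun c d => G.resKey r c < G.resKey r d := by
  unfold redResList
  rw [List.pairwise_flatMap]
  constructor
  · intro s _
    rw [List.pairwise_map]
    refine (pairwise_idxOf_lt_of_nodup (G.resList_nodup r)).imp fun {a b} hlt => ?_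
    exact Prod.Lex.toLex_lt_toLex.2 (Or.inr ⟨rfl, hlt⟩)
  · rw [List.pairwise_reverse]
    refine (List.pairwise_lt_finRange _).imp fun {a b} hab x hx y hy => ?_
    obtain ⟨h, -, rfl⟩ := List.mem_map.1 hx
    obtain ⟨h', -, rfl⟩ := List.mem_map.1 hy
    exact Prod.Lex.toLex_lt_toLex.2 (Or.inl (Nat.sub_lt_sub_left a.2 hab))

theorem prefers_redResList_inl {r : R} {h h' : H} {s t : Fin G.numLevels} :
    Prefers (G.redResList (Sum.inl r)) (h, s) (h', t) ↔ h ∈ G.resList r ∧ h' ∈ G.resList r ∧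
      (t.val < s.val ∨ t.val = s.val ∧ Prefers (G.resList r) h h') := by
  rw [prefers_iff_of_pairwise (pairwise_resKey_redResList r), mem_redResList_inl,
    mem_redResList_inl, resKey, resKey, Prod.Lex.toLex_lt_toLex]
  refine and_congr_right fun hh => and_congr_right fun hh' => or_congr ?_ (and_congr ?_ ?_)
  · simp only
    omega
  · simp only
    omega
  · simp [Prefers, hh, hh']

theorem prefers_redResList_dummy {h : H} {s : ℕ} {hs : s + 1 < G.numLevels}
    {i : Fin (G.levelCap h s)} (hi : G.numShort h s ≤ i.val) :
    Prefers (G.redResList (G.dummy h s hs i)) (h, ⟨s, by omega⟩) (h, ⟨s + 1, hs⟩) := by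
  rw [redResList_dummy, if_neg hi.not_gt]
  simp [Prefers]

end ResidentKeys

end HRLQ

end ReducedPreferences

section AtLevel

variable {R : Type u} {H : Type v} [Fintype R] [Fintype H]

namespace HRLQ

variable {G : HRLQ R H} {M : Finset (G.Res × G.Copy)} {r : R} {h h' : H} {s t : ℕ} {x : G.Res}

variable (G) in
open Classical in
/-- The residents matched to the level-`s` copy of `h`, with the level given as a natural number. -/
noncomputable def atLevel (M : Finset (G.Res × G.Copy)) (h : H) (s : ℕ) : Finset G.Res :=
  Finset.univ.filter fun x => ∃ hs : s < G.numLevels, (x, ((h, ⟨s, hs⟩) : G.Copy)) ∈ M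

theorem mem_atLevel :
    x ∈ G.atLevel M h s ↔ ∃ hs : s < G.numLevels, (x, ((h, ⟨s, hs⟩) : G.Copy)) ∈ M := by
  simp [atLevel]

variable (G) in
/-- The placement of the residents of `G` in a matching of the reduced instance. -/
noncomputable def placementOf (M : Finset (G.Res × G.Copy)) : Placement R H := fun r =>
  (partner M (Sum.inl r)).map fun c => (c.1, c.2.val)

theorem placementOf_eq_some (hM : IsSingleValued M) :
    G.placementOf M r = some (h, s) ↔ Sum.inl r ∈ G.atLevel M h s := by
  rw [mem_atLevel, placementOf, Option.map_eq_some_iff]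
  constructor
  · rintro ⟨⟨h', t⟩, hpartner, he⟩
    cases he
    exact ⟨t.2, mem_of_partner_eq_some hpartner⟩
  · rintro ⟨hs, hr⟩
    exact ⟨_, hM.partner_eq_some hr, rfl⟩

theorem edges_placementOf (hM : IsSingleValued M) : (G.placementOf M).edges = G.mapBack M := by
  ext ⟨r, h⟩
  simp only [Placement.mem_edges, mapBack, Finset.mem_filter, placementOf_eq_some hM, mem_atLevel,
    Finset.mem_univ, true_and]
  exact ⟨fun ⟨s, hs, hr⟩ => ⟨⟨s, hs⟩, hr⟩, fun ⟨s, hr⟩ => ⟨s.val, s.2, hr⟩⟩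

theorem disjoint_atLevel (hM : IsSingleValued M) (hst : s ≠ t) :
    Disjoint (G.atLevel M h s) (G.atLevel M h t) := by
  refine Finset.disjoint_left.2 fun x hx hx' => hst ?_
  obtain ⟨_, hx⟩ := mem_atLevel.1 hx
  obtain ⟨_, hx'⟩ := mem_atLevel.1 hx'
  exact congrArg (fun c : G.Copy => c.2.val) (hM x _ _ hx hx')

theorem mem_redResList_of_mem_atLevel (hE : ∀ e ∈ M, e.2 ∈ G.redResList e.1)
    (hr : (Sum.inl r : G.Res) ∈ G.atLevel M h s) : h ∈ G.resList r := by
  obtain ⟨hs, hr⟩ := mem_atLevel.1 hr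
  exact mem_redResList_inl.1 (hE _ hr)

theorem cases_of_mem_atLevel (hE : ∀ e ∈ M, e.2 ∈ G.redResList e.1)
    (hx : x ∈ G.atLevel M h s) :
    (∃ r, x = Sum.inl r) ∨ x ∈ G.levelDummies h s ∨ x ∈ G.prevDummies h s := by
  obtain ⟨hs, hx⟩ := mem_atLevel.1 hx
  rcases mem_redHospList.1 ((G.red_mem_iff _ _).1 (hE _ hx)) with ⟨r, -, rfl⟩ | hlevel | hprev
  · exact Or.inl ⟨r, rfl⟩
  · exact Or.inr (Or.inl (mem_levelDummies.2 hlevel))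
  · exact Or.inr (Or.inr (by simpa [prevDummies] using hprev))

variable [DecidableEq R] [DecidableEq H]

theorem residentsOf_eq_atLevel (hs : s < G.numLevels) :
    residentsOf M ((h, ⟨s, hs⟩) : G.Copy) = G.atLevel M h s := by
  ext x
  rw [mem_residentsOf, mem_atLevel]
  exact ⟨fun hx => ⟨hs, hx⟩, fun ⟨_, hx⟩ => hx⟩

theorem card_atLevel (hE : ∀ e ∈ M, e.2 ∈ G.redResList e.1) (hM : IsSingleValued M) :
    (G.atLevel M h s).card = ((G.placementOf M).residentsAt h s).card +
      (G.levelDummies h s ∩ G.atLevel M h s).card +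
      (G.prevDummies h s ∩ G.atLevel M h s).card := by
  classical
  have hinl : ∀ r, Sum.inl r ∉ G.levelDummies h s ∪ G.prevDummies h s := by
    simp only [levelDummies, prevDummies, Finset.mem_union, Finset.mem_filter, Finset.mem_univ,
      true_and]
    simp [dummy]
  have hunion : G.atLevel M h s = ((G.placementOf M).residentsAt h s).image Sum.inl ∪
      (G.levelDummies h s ∩ G.atLevel M h s ∪ G.prevDummies h s ∩ G.atLevel M h s) := by
    ext x
    simp only [Finset.mem_union, Finset.mem_image, Placement.mem_residentsAt,
      placementOf_eq_some hM, Finset.mem_inter]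
    constructor
    · intro hx
      rcases cases_of_mem_atLevel hE hx with ⟨r, rfl⟩ | hlevel | hprev
      exacts [Or.inl ⟨r, hx, rfl⟩, Or.inr (Or.inl ⟨hlevel, hx⟩), Or.inr (Or.inr ⟨hprev, hx⟩)]
    · rintro (⟨r, hr, rfl⟩ | hx | hx)
      exacts [hr, hx.2, hx.2]
  rw [hunion, Finset.card_union_of_disjoint, Finset.card_union_of_disjoint, ← hunion,
    Finset.card_image_of_injective _ Sum.inl_injective, add_assoc]
  · exact (disjoint_levelDummies_prevDummies h s).mono Finset.inter_subset_left
      Finset.inter_subset_left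
  · refine Finset.disjoint_left.2 fun x hx hx' => ?_
    obtain ⟨r, -, rfl⟩ := Finset.mem_image.1 hx
    exact hinl r (Finset.union_subset_union Finset.inter_subset_left Finset.inter_subset_left hx')

theorem isStable_reduction_iff : G.reduction.IsStable M ↔ G.reduction.IsMatching M ∧
    ∀ (x : G.Res) (h : H) (s : ℕ) (hs : s < G.numLevels),
      ((h, ⟨s, hs⟩) : G.Copy) ∈ G.redResList x →
      (∀ c, (x, c) ∈ M → Prefers (G.redResList x) (h, ⟨s, hs⟩) c) →
        G.levelCap h s ≤ (G.atLevel M h s).card ∧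
          ∀ y ∈ G.atLevel M h s, G.copyKey h s y < G.copyKey h s x := by
  rw [HR.isStable_iff]
  refine and_congr_right fun hM => forall_congr' fun x => ?_
  have hpref : ∀ {h s} (hs : s < G.numLevels), ((h, ⟨s, hs⟩) : G.Copy) ∈ G.redResList x →
      ((∀ y ∈ G.atLevel M h s, Prefers (G.redHospList (h, ⟨s, hs⟩)) y x) ↔
        ∀ y ∈ G.atLevel M h s, G.copyKey h s y < G.copyKey h s x) := by
    refine fun hs hx => forall₂_congr fun y hy => ?_
    obtain ⟨_, hy⟩ := mem_atLevel.1 hy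
    rw [prefers_redHospList, ← G.red_mem_iff, ← G.red_mem_iff]
    exact ⟨fun hkey => hkey.2.2, fun hkey => ⟨hM.1 _ hy, hx, hkey⟩⟩
  constructor
  · intro hst h s hs hx hwants
    rw [← hpref hs hx, ← residentsOf_eq_atLevel hs]
    exact hst (h, ⟨s, hs⟩) hx hwants
  · rintro hst ⟨h, s, hs⟩ hx hwants
    rw [residentsOf_eq_atLevel]
    exact (hst h s hs hx hwants).imp_right (hpref hs hx).2

end HRLQ

end AtLevel

section StableToPlacement

variable {R : Type u} {H : Type v} [Fintype R] [Fintype H] [DecidableEq R] [DecidableEq H]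

namespace HRLQ

variable {G : HRLQ R H} {M : Finset (G.Res × G.Copy)} {r : R} {h : H} {s : ℕ} {x : G.Res}

theorem card_atLevel_le (hM : G.reduction.IsMatching M) (h : H) (hs : s < G.numLevels) :
    (G.atLevel M h s).card ≤ G.levelCap h s := by
  rw [← residentsOf_eq_atLevel hs]
  exact hM.card_residentsOf_le_upper _

theorem full_of_dummy_notMem_atLevel (hst : G.reduction.IsStable M) (hs : s + 1 < G.numLevels)
    {i : Fin (G.levelCap h s)} (hi : G.dummy h s hs i ∉ G.atLevel M h s) :
    G.levelCap h s ≤ (G.atLevel M h s).card ∧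
      ∀ y ∈ G.atLevel M h s, G.copyKey h s y < G.copyKey h s (G.dummy h s hs i) := by
  refine (isStable_reduction_iff.1 hst).2 (G.dummy h s hs i) h s (by omega)
    (mem_redResList_dummy.2 (Or.inl rfl)) fun c hc => ?_
  have hmem : c ∈ G.redResList (G.dummy h s hs i) := hst.1.1 _ hc
  rcases mem_redResList_dummy.1 hmem with rfl | ⟨rfl, hlong⟩
  · exact absurd (mem_atLevel.2 ⟨_, hc⟩) hi
  · exact prefers_redResList_dummy hlong

theorem card_atLevel_eq (hst : G.reduction.IsStable M) (h : H) (hs : s + 1 < G.numLevels) :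
    (G.atLevel M h s).card = G.levelCap h s := by
  refine (card_atLevel_le hst.1 h (by omega)).antisymm ?_
  by_cases hsub : G.levelDummies h s ⊆ G.atLevel M h s
  · rw [← card_levelDummies h hs]
    exact Finset.card_le_card hsub
  · obtain ⟨x, hx, hnot⟩ := Finset.not_subset.1 hsub
    obtain ⟨_, i, rfl⟩ := mem_levelDummies.1 hx
    exact (full_of_dummy_notMem_atLevel hst hs hnot).1

theorem mem_atLevel_or_of_mem_prevDummies (hst : G.reduction.IsStable M)
    (hq : ∀ h, G.lower h ≤ G.upper h) (hs : s + 1 < G.numLevels)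
    (hx : x ∈ G.prevDummies h (s + 1)) : x ∈ G.atLevel M h s ∨ x ∈ G.atLevel M h (s + 1) := by
  by_contra! hnot
  obtain ⟨i, hi, rfl⟩ := (mem_prevDummies_succ (hs := hs)).1 hx
  have hunmatched : ∀ c, (G.dummy h s hs i, c) ∉ M := fun c hc => by
    have hmem : c ∈ G.redResList (G.dummy h s hs i) := hst.1.1 _ hc
    rcases mem_redResList_dummy.1 hmem with rfl | ⟨rfl, -⟩
    exacts [hnot.1 (mem_atLevel.2 ⟨_, hc⟩), hnot.2 (mem_atLevel.2 ⟨_, hc⟩)]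
  obtain ⟨hfull, hbetter⟩ := (isStable_reduction_iff.1 hst).2 (G.dummy h s hs i) h (s + 1) hs
    (mem_redResList_dummy.2 (Or.inr ⟨rfl, hi⟩)) fun c hc => absurd hc (hunmatched c)
  have hprev : G.atLevel M h (s + 1) ⊆ G.prevDummies h (s + 1) := fun y hy => by
    have hkey := hbetter y hy
    rw [copyKey_dummy, if_neg (by omega)] at hkey
    rcases cases_of_mem_atLevel hst.1.1 hy with ⟨r, rfl⟩ | hlevel | hprev
    · simp only [copyKey_inl, Prod.Lex.toLex_lt_toLex] at hkey
      omega
    · obtain ⟨_, j, rfl⟩ := mem_levelDummies.1 hlevel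
      simp only [copyKey_dummy, Prod.Lex.toLex_lt_toLex, if_true] at hkey
      omega
    · exact hprev
  have hlt := Finset.card_lt_card (Finset.ssubset_iff_subset_ne.2
    ⟨hprev, fun he => hnot.2 (he ▸ hx)⟩)
  rw [card_prevDummies_succ hq h hs] at hlt
  omega

theorem card_prevDummies_le_card_below (hst : G.reduction.IsStable M) (h : H)
    (hs : s < G.numLevels) : (G.prevDummies h s ∩ G.atLevel M h s).card ≤
      ((G.placementOf M).below h s).card := by
  induction s with
  | zero => simp [prevDummies_zero]
  | succ s ih =>
    have hcard := card_atLevel hst.1.1 hst.1.isSingleValued (h := h) (s := s)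
    rw [card_atLevel_eq hst h hs] at hcard
    have hdummies : (G.prevDummies h (s + 1) ∩ G.atLevel M h (s + 1)).card +
        (G.levelDummies h s ∩ G.atLevel M h s).card ≤ G.levelCap h s := by
      rw [← card_levelDummies h hs, ← Finset.card_union_of_disjoint
        ((disjoint_atLevel hst.1.isSingleValued (Nat.succ_ne_self s)).mono
          Finset.inter_subset_right Finset.inter_subset_right)]
      exact Finset.card_le_card (Finset.union_subset
        (Finset.inter_subset_left.trans (prevDummies_succ_subset h hs)) Finset.inter_subset_left)
    have hbelow := ih (by omega)
    rw [Placement.below_succ, Placement.card_upTo]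
    omega

theorem levelDummies_subset_of_mem_prevDummies (hst : G.reduction.IsStable M)
    (hq : ∀ h, G.lower h ≤ G.upper h) (hs : s + 1 < G.numLevels)
    (hx : x ∈ G.prevDummies h (s + 1)) (hxs : x ∈ G.atLevel M h s) :
    G.levelDummies h s ⊆ (G.levelDummies h s ∩ G.atLevel M h s) ∪
      (G.prevDummies h (s + 1) ∩ G.atLevel M h (s + 1)) := by
  intro y hy
  rw [Finset.mem_union, Finset.mem_inter, Finset.mem_inter]
  obtain ⟨_, j, rfl⟩ := mem_levelDummies.1 hy
  by_cases hj : G.numShort h s ≤ j.val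
  · have hprev := (mem_prevDummies_succ (hs := hs)).2 ⟨j, hj, rfl⟩
    exact (mem_atLevel_or_of_mem_prevDummies hst hq hs hprev).imp (⟨hy, ·⟩) (⟨hprev, ·⟩)
  · refine Or.inl ⟨hy, ?_⟩
    by_contra hnot
    obtain ⟨i, hi, rfl⟩ := (mem_prevDummies_succ (hs := hs)).1 hx
    have hkey := (full_of_dummy_notMem_atLevel hst hs hnot).2 _ hxs
    simp only [copyKey_dummy, Prod.Lex.toLex_lt_toLex] at hkey
    omega

theorem min_le_card_prevDummies (hst : G.reduction.IsStable M) (hq : ∀ h, G.lower h ≤ G.upper h)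
    (h : H) (hs : s < G.numLevels) :
    min (G.levelCap h s) ((G.placementOf M).below h s).card ≤
      (G.prevDummies h s ∩ G.atLevel M h s).card := by
  induction s with
  | zero => simp [Placement.below_zero]
  | succ s ih =>
    by_cases hstay : ∃ x ∈ G.prevDummies h (s + 1), x ∈ G.atLevel M h s
    · obtain ⟨x, hx, hxs⟩ := hstay
      have hdummies := (Finset.card_le_card (levelDummies_subset_of_mem_prevDummies hst hq hs hx
        hxs)).trans (Finset.card_union_le _ _)
      rw [card_levelDummies h hs] at hdummies
      have hcard := card_atLevel hst.1.1 hst.1.isSingleValued (h := h) (s := s)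
      rw [card_atLevel_eq hst h hs] at hcard
      have hcap := levelCap_anti hq h (Nat.le_add_right s 1)
      have hmin := ih (by omega)
      rw [Placement.below_succ, Placement.card_upTo]
      omega
    · push Not at hstay
      rw [Finset.inter_eq_left.2 fun x hx =>
        (mem_atLevel_or_of_mem_prevDummies hst hq hs hx).resolve_left (hstay x hx),
        card_prevDummies_succ hq h hs]
      exact min_le_left _ _

theorem card_above_placementOf_lt (hst : G.reduction.IsStable M)
    (hq : ∀ h, G.lower h ≤ G.upper h) (hr : G.placementOf M r = some (h, s)) :
    (G.above (G.placementOf M) h s r).card < G.levelCap h s := by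
  obtain ⟨hs, -⟩ := mem_atLevel.1 ((placementOf_eq_some hst.1.isSingleValued).1 hr)
  have hmin := min_le_card_prevDummies hst hq h hs
  have hcard := card_atLevel hst.1.1 hst.1.isSingleValued (h := h) (s := s)
  have hle := card_atLevel_le hst.1 h hs
  have hpos : 0 < ((G.placementOf M).residentsAt h s).card :=
    Finset.card_pos.2 ⟨r, (Placement.mem_residentsAt _).2 hr⟩
  have habove : (G.above (G.placementOf M) h s r).card < ((G.placementOf M).upTo h s).card :=
    Finset.card_lt_card (Finset.ssubset_iff_subset_ne.2 ⟨G.above_subset_upTo _ h s r,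
      fun he => notMem_above_self hr (he ▸ (Placement.mem_upTo _).2 ⟨s, hr, le_rfl⟩)⟩)
  rw [Placement.card_upTo] at habove
  omega

theorem levelCap_le_card_above_placementOf (hst : G.reduction.IsStable M) (hs : s < G.numLevels)
    (hd : G.Desires (G.placementOf M) r h s) :
    G.levelCap h s ≤ (G.above (G.placementOf M) h s r).card := by
  obtain ⟨hfull, hbetter⟩ := (isStable_reduction_iff.1 hst).2 (Sum.inl r) h s hs
    (mem_redResList_inl.2 hd.1) <| by
      rintro ⟨h', t⟩ hc
      exact prefers_redResList_inl.2 ⟨hd.1, mem_redResList_inl.1 (hst.1.1 _ hc),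
        hd.2 h' t ((placementOf_eq_some hst.1.isSingleValued).2 (mem_atLevel.2 ⟨t.2, hc⟩))⟩
  have hnoLevel : G.levelDummies h s ∩ G.atLevel M h s = ∅ := by
    refine Finset.disjoint_iff_inter_eq_empty.1 (Finset.disjoint_left.2 fun x hx hxs => ?_)
    obtain ⟨_, i, rfl⟩ := mem_levelDummies.1 hx
    have hkey := hbetter _ hxs
    simp only [copyKey_dummy, copyKey_inl, Prod.Lex.toLex_lt_toLex, if_true] at hkey
    omega
  have habove : (G.placementOf M).upTo h s ⊆ G.above (G.placementOf M) h s r := by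
    intro r' hr'
    obtain ⟨t, ht, hts⟩ := (Placement.mem_upTo _).1 hr'
    refine mem_above.2 ⟨t, ht, hts.lt_or_eq.imp_right fun he => ⟨he, ?_⟩⟩
    subst he
    have hmem := (placementOf_eq_some hst.1.isSingleValued).1 ht
    have hkey := hbetter _ hmem
    simp only [copyKey_inl, Prod.Lex.toLex_lt_toLex, lt_irrefl, false_or, true_and] at hkey
    exact ⟨(G.mem_iff _ _).1 (mem_redResList_of_mem_atLevel hst.1.1 hmem),
      (G.mem_iff _ _).1 hd.1, hkey⟩
  have hcard := card_atLevel hst.1.1 hst.1.isSingleValued (h := h) (s := s)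
  have hprev := card_prevDummies_le_card_below hst h hs
  have hle := Finset.card_le_card habove
  rw [hnoLevel, Finset.card_empty] at hcard
  rw [Placement.card_upTo] at hle
  omega

theorem isLevelStable_placementOf (hst : G.reduction.IsStable M)
    (hq : ∀ h, G.lower h ≤ G.upper h) : G.IsLevelStable (G.placementOf M) where
  valid _ _ _ hr :=
    have hmem := (placementOf_eq_some hst.1.isSingleValued).1 hr
    ⟨mem_redResList_of_mem_atLevel hst.1.1 hmem, (mem_atLevel.1 hmem).1⟩
  keep _ _ _ hr := card_above_placementOf_lt hst hq hr
  full _ _ _ hs hd := levelCap_le_card_above_placementOf hst hs hd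

end HRLQ

end StableToPlacement

section PlacementToStable

variable {R : Type u} {H : Type v} [Fintype R] [Fintype H]

namespace HRLQ

open Classical in
/-- A matching of the reduced instance that realizes the placement `pl`. The level-`s` dummies of
`h` with small indices are matched to the level-`s` copy, those with larger indices to the next one
if they list it. -/
noncomputable def matchingOf (G : HRLQ R H) (pl : Placement R H) : Finset (G.Res × G.Copy) :=
  Finset.univ.filter fun e =>
    (∃ r, e.1 = Sum.inl r ∧ pl r = some (e.2.1, e.2.2.val)) ∨
    ∃ (h : H) (t : ℕ) (ht : t + 1 < G.numLevels) (i : _), e.1 = G.dummy h t ht i ∧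
      (e.2 = (h, ⟨t, by omega⟩) ∧ i.val < G.levelCap h t - (pl.upTo h t).card ∨
       e.2 = (h, ⟨t + 1, ht⟩) ∧ G.levelCap h t - (pl.upTo h t).card ≤ i.val ∧
         G.numShort h t ≤ i.val)

variable {G : HRLQ R H} {pl : Placement R H} {r : R} {h : H} {s : ℕ} {x : G.Res}
  {c : G.Copy}

theorem inl_mem_matchingOf :
    (Sum.inl r, c) ∈ G.matchingOf pl ↔ pl r = some (c.1, c.2.val) := by
  simp only [matchingOf, Finset.mem_filter, Finset.mem_univ, true_and]
  simp [dummy]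

theorem dummy_mem_matchingOf {hs : s + 1 < G.numLevels} {i : Fin (G.levelCap h s)} :
    (G.dummy h s hs i, c) ∈ G.matchingOf pl ↔
      c = (h, ⟨s, by omega⟩) ∧ i.val < G.levelCap h s - (pl.upTo h s).card ∨
      c = (h, ⟨s + 1, hs⟩) ∧ G.levelCap h s - (pl.upTo h s).card ≤ i.val ∧
        G.numShort h s ≤ i.val := by
  simp only [matchingOf, Finset.mem_filter, Finset.mem_univ, true_and]
  constructor
  · rintro (⟨r, he, -⟩ | ⟨h', t, ht, j, he, hc⟩)
    · cases he
    · obtain ⟨rfl, rfl, hij⟩ := dummy_inj he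
      rwa [hij]
  · exact fun hc => Or.inr ⟨h, s, hs, i, rfl, hc⟩

theorem dummy_mem_atLevel_matchingOf {hs : s + 1 < G.numLevels} {i : Fin (G.levelCap h s)} :
    G.dummy h s hs i ∈ G.atLevel (G.matchingOf pl) h s ↔
      i.val < G.levelCap h s - (pl.upTo h s).card := by
  have hs' : s < G.numLevels := by omega
  simp [mem_atLevel, dummy_mem_matchingOf, hs']

theorem dummy_mem_atLevel_succ_matchingOf {hs : s + 1 < G.numLevels}
    {i : Fin (G.levelCap h s)} : G.dummy h s hs i ∈ G.atLevel (G.matchingOf pl) h (s + 1) ↔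
      G.levelCap h s - (pl.upTo h s).card ≤ i.val ∧ G.numShort h s ≤ i.val := by
  simp [mem_atLevel, dummy_mem_matchingOf, hs]

theorem isSingleValued_matchingOf : IsSingleValued (G.matchingOf pl) := by
  intro x c c' hc hc'
  rcases eq_inl_or_eq_dummy x with ⟨r, rfl⟩ | ⟨h, s, hs, i, rfl⟩
  · have he := Option.some.inj ((inl_mem_matchingOf.1 hc).symm.trans (inl_mem_matchingOf.1 hc'))
    simp only [Prod.mk.injEq] at he
    exact Prod.ext he.1 (Fin.ext he.2)
  · rcases dummy_mem_matchingOf.1 hc with ⟨rfl, hi⟩ | ⟨rfl, hi⟩ <;>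
      rcases dummy_mem_matchingOf.1 hc' with ⟨rfl, hi'⟩ | ⟨rfl, hi'⟩
    all_goals first | rfl | omega

theorem copyKey_lt_copyKey_inl_of_mem_prevDummies [DecidableEq R]
    (hx : x ∈ G.prevDummies h s) (r : R) : G.copyKey h s x < G.copyKey h s (Sum.inl r) := by
  simp only [prevDummies, Finset.mem_filter, Finset.mem_univ, true_and] at hx
  obtain ⟨t, ht, i, hts, -, rfl⟩ := hx
  rw [copyKey_dummy, copyKey_inl, if_neg (by omega), Prod.Lex.toLex_lt_toLex]
  exact Or.inl zero_lt_one

theorem own_level_of_dummy_wants_matchingOf [DecidableEq H] {t : ℕ} {ht : t + 1 < G.numLevels}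
    {h' : H} {i : Fin (G.levelCap h' t)} {hs : s < G.numLevels}
    (hmem : ((h, ⟨s, hs⟩) : G.Copy) ∈ G.redResList (G.dummy h' t ht i))
    (hwants : ∀ c, (G.dummy h' t ht i, c) ∈ G.matchingOf pl →
      Prefers (G.redResList (G.dummy h' t ht i)) (h, ⟨s, hs⟩) c) :
    h' = h ∧ t = s ∧ G.levelCap h' t - (pl.upTo h' t).card ≤ i.val := by
  by_cases hi : i.val < G.levelCap h' t - (pl.upTo h' t).card
  · have hpref := hwants _ (dummy_mem_matchingOf.2 (Or.inl ⟨rfl, hi⟩))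
    rcases mem_redResList_dummy.1 hmem with he | ⟨he, hlong⟩
    · exact absurd he hpref.ne
    · exact absurd (he ▸ hpref) (prefers_redResList_dummy hlong).asymm
  · rcases mem_redResList_dummy.1 hmem with he | ⟨he, hlong⟩
    · simp only [Prod.mk.injEq, Fin.mk.injEq] at he
      exact ⟨he.1.symm, he.2.symm, not_lt.1 hi⟩
    · exact absurd he (hwants _ (dummy_mem_matchingOf.2 (Or.inr ⟨rfl, not_lt.1 hi, hlong⟩))).ne

variable [DecidableEq R] [DecidableEq H]

theorem mem_redResList_of_mem_matchingOf (hp : G.IsLevelStable pl) :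
    ∀ e ∈ G.matchingOf pl, e.2 ∈ G.redResList e.1 := by
  rintro ⟨x, c⟩ he
  rcases eq_inl_or_eq_dummy x with ⟨r, rfl⟩ | ⟨h, s, hs, i, rfl⟩
  · exact mem_redResList_inl.2 (hp.mem_resList (inl_mem_matchingOf.1 he))
  · exact mem_redResList_dummy.2
      ((dummy_mem_matchingOf.1 he).imp And.left fun hc => ⟨hc.1, hc.2.2⟩)

theorem placementOf_matchingOf (hp : G.IsLevelStable pl) :
    G.placementOf (G.matchingOf pl) = pl := by
  funext r
  refine Option.ext fun ⟨h, s⟩ => ?_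
  rw [placementOf_eq_some isSingleValued_matchingOf, mem_atLevel]
  exact ⟨fun ⟨_, hr⟩ => inl_mem_matchingOf.1 hr,
    fun hr => ⟨hp.lt_numLevels hr, inl_mem_matchingOf.2 hr⟩⟩

theorem card_levelDummies_inter_matchingOf (h : H) (hs : s + 1 < G.numLevels) :
    (G.levelDummies h s ∩ G.atLevel (G.matchingOf pl) h s).card =
      G.levelCap h s - (pl.upTo h s).card := by
  have himage : G.levelDummies h s ∩ G.atLevel (G.matchingOf pl) h s = (Finset.univ.filter
      fun i : Fin (G.levelCap h s) => i.val < G.levelCap h s - (pl.upTo h s).card).image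
      (G.dummy h s hs) := by
    ext x
    simp only [Finset.mem_inter, mem_levelDummies, Finset.mem_image, Finset.mem_filter,
      Finset.mem_univ, true_and]
    constructor
    · rintro ⟨⟨_, i, rfl⟩, hx⟩
      exact ⟨i, dummy_mem_atLevel_matchingOf.1 hx, rfl⟩
    · rintro ⟨i, hi, rfl⟩
      exact ⟨⟨hs, i, rfl⟩, dummy_mem_atLevel_matchingOf.2 hi⟩
  rw [himage, Finset.card_image_of_injective _ (dummy_injective h s hs), Fin.card_filter_val_lt]
  exact min_eq_right (Nat.sub_le _ _)

theorem card_prevDummies_inter_matchingOf (hq : ∀ h, G.lower h ≤ G.upper h) (h : H)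
    (hs : s < G.numLevels) :
    (G.prevDummies h s ∩ G.atLevel (G.matchingOf pl) h s).card =
      min (G.levelCap h s) (pl.below h s).card := by
  rcases s with _ | s
  · simp [prevDummies_zero, Placement.below_zero]
  · have himage : G.prevDummies h (s + 1) ∩ G.atLevel (G.matchingOf pl) h (s + 1) =
        (Finset.univ.filter fun i : Fin (G.levelCap h s) =>
          max (G.levelCap h s - (pl.upTo h s).card) (G.numShort h s) ≤ i.val).image
          (G.dummy h s hs) := by
      ext x
      simp only [Finset.mem_inter, mem_prevDummies_succ (hs := hs), Finset.mem_image,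
        Finset.mem_filter, Finset.mem_univ, true_and, max_le_iff]
      constructor
      · rintro ⟨⟨i, -, rfl⟩, hx⟩
        exact ⟨i, dummy_mem_atLevel_succ_matchingOf.1 hx, rfl⟩
      · rintro ⟨i, hi, rfl⟩
        exact ⟨⟨i, hi.2, rfl⟩, dummy_mem_atLevel_succ_matchingOf.2 hi⟩
    rw [himage, Finset.card_image_of_injective _ (dummy_injective h s hs),
      card_fin_filter_le_val, Placement.below_succ]
    have := levelCap_eq_numShort_add hq h s
    omega

theorem card_atLevel_matchingOf (hp : G.IsLevelStable pl) (hq : ∀ h, G.lower h ≤ G.upper h)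
    (h : H) (hs : s < G.numLevels) :
    (G.atLevel (G.matchingOf pl) h s).card ≤ G.levelCap h s ∧
    (s + 1 < G.numLevels ∨ G.levelCap h s ≤ (pl.upTo h s).card →
      G.levelCap h s ≤ (G.atLevel (G.matchingOf pl) h s).card) := by
  have hcard := card_atLevel (h := h) (s := s) (mem_redResList_of_mem_matchingOf hp)
    isSingleValued_matchingOf
  rw [placementOf_matchingOf hp, card_prevDummies_inter_matchingOf hq h hs] at hcard
  have hupTo := pl.card_upTo h s
  have hresidents : (pl.residentsAt h s).card = 0 ∨ (pl.upTo h s).card ≤ G.levelCap h s := by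
    refine (pl.residentsAt h s).eq_empty_or_nonempty.imp (by simp [·]) ?_
    rintro ⟨r, hr⟩
    exact hp.card_upTo_le (pl.mem_residentsAt.1 hr)
  by_cases hs' : s + 1 < G.numLevels
  · rw [card_levelDummies_inter_matchingOf h hs'] at hcard
    omega
  · have hnone : G.levelDummies h s = ∅ := by simp [levelDummies, hs']
    rw [hnone, Finset.empty_inter, Finset.card_empty] at hcard
    omega

theorem isMatching_matchingOf (hp : G.IsLevelStable pl) (hq : ∀ h, G.lower h ≤ G.upper h) :
    G.reduction.IsMatching (G.matchingOf pl) := by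
  refine ⟨mem_redResList_of_mem_matchingOf hp, isSingleValued_matchingOf, ?_⟩
  rintro ⟨h, s, hs⟩
  rw [residentsOf_eq_atLevel]
  exact (card_atLevel_matchingOf hp hq h hs).1

theorem copyKey_lt_copyKey_inl_of_desires (hp : G.IsLevelStable pl) (hd : G.Desires pl r h s)
    (hcap : G.levelCap h s ≤ (pl.upTo h s).card) (hx : x ∈ G.atLevel (G.matchingOf pl) h s) :
    G.copyKey h s x < G.copyKey h s (Sum.inl r) := by
  rcases cases_of_mem_atLevel (mem_redResList_of_mem_matchingOf hp) hx with
    ⟨r', rfl⟩ | hlevel | hprev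
  · obtain ⟨_, hr'⟩ := mem_atLevel.1 hx
    rw [copyKey_inl, copyKey_inl, Prod.Lex.toLex_lt_toLex]
    exact Or.inr ⟨rfl, (hp.prefers_of_desires hd (inl_mem_matchingOf.1 hr')).2.2⟩
  · obtain ⟨_, i, rfl⟩ := mem_levelDummies.1 hlevel
    have hi := dummy_mem_atLevel_matchingOf.1 hx
    omega
  · exact copyKey_lt_copyKey_inl_of_mem_prevDummies hprev r

theorem copyKey_lt_copyKey_dummy (hp : G.IsLevelStable pl) {hs : s + 1 < G.numLevels}
    {i : Fin (G.levelCap h s)} (hi : G.levelCap h s - (pl.upTo h s).card ≤ i.val)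
    (hx : x ∈ G.atLevel (G.matchingOf pl) h s) :
    G.copyKey h s x < G.copyKey h s (G.dummy h s hs i) := by
  rw [copyKey_dummy, if_pos rfl]
  rcases cases_of_mem_atLevel (mem_redResList_of_mem_matchingOf hp) hx with
    ⟨r, rfl⟩ | hlevel | hprev
  · rw [copyKey_inl, Prod.Lex.toLex_lt_toLex]
    exact Or.inl one_lt_two
  · obtain ⟨_, j, rfl⟩ := mem_levelDummies.1 hlevel
    have hj := dummy_mem_atLevel_matchingOf.1 hx
    rw [copyKey_dummy, if_pos rfl, Prod.Lex.toLex_lt_toLex]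
    exact Or.inr ⟨rfl, hj.trans_le hi⟩
  · simp only [prevDummies, Finset.mem_filter, Finset.mem_univ, true_and] at hprev
    obtain ⟨t, ht, j, hts, -, rfl⟩ := hprev
    rw [copyKey_dummy, if_neg (by omega), Prod.Lex.toLex_lt_toLex]
    exact Or.inl two_pos

theorem desires_of_wants_matchingOf (hp : G.IsLevelStable pl) {hs : s < G.numLevels}
    (hmem : ((h, ⟨s, hs⟩) : G.Copy) ∈ G.redResList (Sum.inl r))
    (hwants : ∀ c, (Sum.inl r, c) ∈ G.matchingOf pl →
      Prefers (G.redResList (Sum.inl r)) (h, ⟨s, hs⟩) c) : G.Desires pl r h s := by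
  refine ⟨mem_redResList_inl.1 hmem, fun h' t hr => ?_⟩
  have hpref := hwants (h', ⟨t, hp.lt_numLevels hr⟩) (inl_mem_matchingOf.2 hr)
  exact (prefers_redResList_inl.1 hpref).2.2

theorem isStable_matchingOf (hp : G.IsLevelStable pl) (hq : ∀ h, G.lower h ≤ G.upper h) :
    G.reduction.IsStable (G.matchingOf pl) := by
  refine isStable_reduction_iff.2 ⟨isMatching_matchingOf hp hq, fun x h s hs hmem hwants => ?_⟩
  have hfull := (card_atLevel_matchingOf hp hq h hs).2
  rcases eq_inl_or_eq_dummy x with ⟨r, rfl⟩ | ⟨h', t, ht, i, rfl⟩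
  · have hd := desires_of_wants_matchingOf hp hmem hwants
    have hcap : G.levelCap h s ≤ (pl.upTo h s).card :=
      not_lt.1 fun hlt => hp.not_desires_of_card_upTo_lt hs hlt hd
    exact ⟨hfull (Or.inr hcap), fun y hy => copyKey_lt_copyKey_inl_of_desires hp hd hcap hy⟩
  · obtain ⟨rfl, rfl, hi⟩ := own_level_of_dummy_wants_matchingOf hmem hwants
    exact ⟨hfull (Or.inl ht), fun y hy => copyKey_lt_copyKey_dummy hp hi hy⟩

theorem mapBack_matchingOf (hp : G.IsLevelStable pl) :
    G.mapBack (G.matchingOf pl) = pl.edges := by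
  rw [← edges_placementOf isSingleValued_matchingOf, placementOf_matchingOf hp]

end HRLQ

end PlacementToStable

section Configurations

variable {R : Type u} {H : Type v}

/-- A configuration of the deferred acceptance algorithm on levelled copies: the number of levels
that a resident has used up, its position on its list, and the hospital that holds it. -/
structure Config (R : Type u) (H : Type v) where
  used : R → ℕ
  pos : R → ℕ
  cur : R → Option H

namespace Config

/-- The initial configuration of the algorithm. -/
def start (R : Type u) (H : Type v) : Config R H := ⟨fun _ => 0, fun _ => 0, fun _ => none⟩

/-- The resident `r` has proposed to the `i`-th hospital of its list after it had used up `w`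
levels, and is no longer held by it. -/
def HasPassed (c : Config R H) (r : R) (w i : ℕ) : Prop :=
  w < c.used r ∨ w = c.used r ∧ i < c.pos r

variable [DecidableEq R]

/-- The hospital that holds the resident `r` rejects it. -/
def leave (c : Config R H) (r : R) : Config R H :=
  { c with cur := Function.update c.cur r none
           pos := Function.update c.pos r (c.pos r + 1) }

/-- The resident `r` is accepted by `h`. -/
def propose (c : Config R H) (r : R) (h : H) : Config R H :=
  { c with cur := Function.update c.cur r (some h) }

/-- The resident `r` returns to the beginning of its list, one level lower. -/
def restart (c : Config R H) (r : R) : Config R H :=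
  { c with used := Function.update c.used r (c.used r + 1)
           pos := Function.update c.pos r 0 }

end Config

end Configurations

section Levels

variable {R : Type u} {H : Type v} [Fintype R] [Fintype H]

namespace HRLQ

variable {G : HRLQ R H} {c : Config R H} {r : R} {h : H} {s : ℕ}

variable (G) in
/-- The level at which a resident proposes after it has used up `w` levels. -/
def levelAfter (w : ℕ) : ℕ := G.numLevels - 1 - w

theorem levelAfter_levelAfter (hs : s < G.numLevels) : G.levelAfter (G.levelAfter s) = s := by
  unfold levelAfter
  omega

theorem levelAfter_lt (hs : s < G.numLevels) : G.levelAfter s < G.numLevels := by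
  unfold levelAfter
  omega

variable (G) in
/-- The placement of the residents in a configuration. -/
def places (c : Config R H) : Placement R H := fun r =>
  (c.cur r).map fun h => (h, G.levelAfter (c.used r))

theorem places_eq_some :
    G.places c r = some (h, s) ↔ c.cur r = some h ∧ G.levelAfter (c.used r) = s := by
  simp only [places, Option.map_eq_some_iff, Prod.mk.injEq]
  exact ⟨fun ⟨_, hcur, hh, hs⟩ => ⟨hh ▸ hcur, hs⟩, fun ⟨hcur, hs⟩ => ⟨h, hcur, rfl, hs⟩⟩

theorem partner_edges_places (c : Config R H) (r : R) :
    partner (G.places c).edges r = c.cur r := by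
  rw [Placement.partner_edges, places, Option.map_map]
  simp [Function.comp_def]

end HRLQ

end Levels

section Moves

variable {R : Type u} {H : Type v} [Fintype R] [Fintype H] [DecidableEq R]

namespace HRLQ

variable {G : HRLQ R H} {c : Config R H} {r x : R} {h : H}

theorem places_leave_of_ne (hx : x ≠ r) : G.places (c.leave r) x = G.places c x := by
  simp [places, Config.leave, hx]

theorem places_propose_of_ne (hx : x ≠ r) : G.places (c.propose r h) x = G.places c x := by
  simp [places, Config.propose, hx]

theorem places_restart (hcur : c.cur r = none) : G.places (c.restart r) = G.places c := by
  funext x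
  by_cases hx : x = r
  · simp [places, Config.restart, hx, hcur]
  · simp [places, Config.restart, hx]

end HRLQ

end Moves

section Above

variable {R : Type u} {H : Type v} [Fintype R] [DecidableEq R]

namespace HRLQ

variable {G : HRLQ R H} {pl pl' : Placement R H} {r r₀ : R} {h h₀ : H} {s t : ℕ}

theorem above_mono (hpl : ∀ r p, pl r = some p → pl' r = some p) (h : H) (s : ℕ) (r : R) :
    G.above pl h s r ⊆ G.above pl' h s r := by
  intro x hx
  obtain ⟨t, ht, hbefore⟩ := mem_above.1 hx
  exact mem_above.2 ⟨t, hpl _ _ ht, hbefore⟩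

theorem above_subset_above_of_mem (hr₀ : pl r₀ = some (h, t)) (hmem : r₀ ∈ G.above pl h s r) :
    t ≤ s ∧ G.above pl h t r₀ ⊆ G.above pl h s r := by
  obtain ⟨_, he, hbefore⟩ := mem_above.1 hmem
  cases he.symm.trans hr₀
  refine ⟨hbefore.elim le_of_lt fun he => he.1.le, fun x hx => ?_⟩
  obtain ⟨t', hx, hbefore'⟩ := mem_above.1 hx
  refine mem_above.2 ⟨t', hx, ?_⟩
  rcases hbefore with hlt | ⟨rfl, hpref⟩
  · exact Or.inl (hbefore'.elim hlt.trans' fun he => he.1.trans_lt hlt)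
  · exact hbefore'.imp_right fun ⟨he, hpref'⟩ =>
      ⟨he, hpref'.1, hpref.2.1, hpref'.2.2.trans hpref.2.2⟩

theorem subset_above_of_eq_off (hpl : ∀ r, r ≠ r₀ → pl' r = pl r) {A : Finset R}
    (hA : A ⊆ G.above pl h s r) (hr₀ : r₀ ∉ A) : A ⊆ G.above pl' h s r := by
  intro x hx
  obtain ⟨t, ht, hbefore⟩ := mem_above.1 (hA hx)
  exact mem_above.2 ⟨t, by rw [hpl x fun he => hr₀ (he ▸ hx), ht], hbefore⟩

theorem levelCap_le_card_above_of_eq_off (hq : ∀ h, G.lower h ≤ G.upper h)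
    (hr₀ : pl r₀ = some (h₀, t)) (hpl : ∀ r, r ≠ r₀ → pl' r = pl r)
    (hcap : G.levelCap h₀ t ≤ (G.above pl h₀ t r₀).card)
    (hle : G.levelCap h s ≤ (G.above pl h s r).card) :
    G.levelCap h s ≤ (G.above pl' h s r).card := by
  by_cases hmem : r₀ ∈ G.above pl h s r
  · obtain ⟨t', ht', -⟩ := mem_above.1 hmem
    cases ht'.symm.trans hr₀
    obtain ⟨hts, hsub⟩ := above_subset_above_of_mem hr₀ hmem
    exact (levelCap_anti hq h hts).trans (hcap.trans (Finset.card_le_card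
      (subset_above_of_eq_off hpl hsub (notMem_above_self hr₀))))
  · exact hle.trans (Finset.card_le_card (subset_above_of_eq_off hpl Finset.Subset.rfl hmem))

end HRLQ

end Above

section DeferredAcceptance

variable {R : Type u} {H : Type v} [Fintype R] [Fintype H] [DecidableEq R]

namespace HRLQ

variable (G : HRLQ R H)

/-- One step of the resident `r`: it leaves its hospital if that has enough residents before `r`,
it proposes to the next hospital on its list, or it starts over one level lower. -/
noncomputable def advance (c : Config R H) (r : R) : Option (Config R H) :=
  match c.cur r with
  | some h =>
      if G.levelCap h (G.levelAfter (c.used r)) ≤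
          (G.above (G.places c) h (G.levelAfter (c.used r)) r).card then some (c.leave r)
      else none
  | none =>
      if c.used r < G.numLevels then
        match (G.resList r)[c.pos r]? with
        | some h => some (c.propose r h)
        | none => some (c.restart r)
      else none

/-- The invariant of the algorithm: a resident is held by the hospital at its position, and every
copy that it has passed has enough residents before it. -/
structure IsConsistent (c : Config R H) : Prop where
  held : ∀ r h, c.cur r = some h → c.used r < G.numLevels ∧ (G.resList r)[c.pos r]? = some h
  passed : ∀ r i h w, (G.resList r)[i]? = some h → w < G.numLevels → c.HasPassed r w i →
    G.levelCap h (G.levelAfter w) ≤ (G.above (G.places c) h (G.levelAfter w) r).card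

/-- The potential of the resident `r`, which decreases whenever it moves: it drops by `1` when `r`
proposes, by `2 - 1` when `r` is rejected, and the factor `2|H| + 2` pays for the return of `r` to
the beginning of its list. -/
def potential (c : Config R H) (r : R) : ℕ :=
  (G.numLevels - c.used r) * (2 * Fintype.card H + 2) + 2 * (Fintype.card H - c.pos r) +
    (c.cur r).elim 1 fun _ => 0

variable {G} {c c' : Config R H} {r : R} {h : H} {s : ℕ}

theorem advance_eq_some_iff : G.advance c r = some c' ↔
    (∃ h, c.cur r = some h ∧ G.levelCap h (G.levelAfter (c.used r)) ≤
      (G.above (G.places c) h (G.levelAfter (c.used r)) r).card ∧ c.leave r = c') ∨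
    c.cur r = none ∧ c.used r < G.numLevels ∧
      ((∃ h, (G.resList r)[c.pos r]? = some h ∧ c.propose r h = c') ∨
        (G.resList r)[c.pos r]? = none ∧ c.restart r = c') := by
  unfold advance
  rcases c.cur r with _ | h
  · rcases (G.resList r)[c.pos r]? with _ | h <;> simp
  · simp

theorem advance_eq_none_iff : G.advance c r = none ↔
    c.cur r = none ∧ G.numLevels ≤ c.used r ∨
    ∃ h, c.cur r = some h ∧ (G.above (G.places c) h (G.levelAfter (c.used r)) r).card <
      G.levelCap h (G.levelAfter (c.used r)) := by
  unfold advance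
  rcases c.cur r with _ | h
  · rcases (G.resList r)[c.pos r]? with _ | h <;> simp
  · simp

theorem isConsistent_start : G.IsConsistent (Config.start R H) :=
  ⟨by simp [Config.start], by simp [Config.start, Config.HasPassed]⟩

namespace IsConsistent

theorem leave (hc : G.IsConsistent c) (hq : ∀ h, G.lower h ≤ G.upper h) (hcur : c.cur r = some h)
    (hcap : G.levelCap h (G.levelAfter (c.used r)) ≤
      (G.above (G.places c) h (G.levelAfter (c.used r)) r).card) : G.IsConsistent (c.leave r) := by
  refine ⟨fun x h' hx => ?_, fun x i h' w hi hw hpassed => ?_⟩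
  · by_cases hxr : x = r
    · simp [Config.leave, hxr] at hx
    · simp only [Config.leave, Function.update_of_ne hxr] at hx ⊢
      exact hc.held x h' hx
  · refine levelCap_le_card_above_of_eq_off hq (places_eq_some.2 ⟨hcur, rfl⟩)
      (fun x hx => places_leave_of_ne hx) hcap ?_
    by_cases hlast : x = r ∧ w = c.used r ∧ i = c.pos r
    · obtain ⟨rfl, rfl, rfl⟩ := hlast
      obtain rfl := Option.some.inj ((hc.held x h hcur).2.symm.trans hi)
      exact hcap
    · refine hc.passed x i h' w hi hw ?_
      by_cases hxr : x = r
      · subst hxr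
        simp only [Config.HasPassed, Config.leave, Function.update_self, true_and]
          at hpassed hlast ⊢
        omega
      · simpa [Config.HasPassed, Config.leave, hxr] using hpassed

theorem propose (hc : G.IsConsistent c) (hcur : c.cur r = none) (hused : c.used r < G.numLevels)
    (hget : (G.resList r)[c.pos r]? = some h) : G.IsConsistent (c.propose r h) := by
  refine ⟨fun x h' hx => ?_, fun x i h' w hi hw hpassed => ?_⟩
  · by_cases hxr : x = r
    · subst hxr
      simp only [Config.propose, Function.update_self, Option.some.injEq] at hx
      exact ⟨hused, hx ▸ hget⟩
    · simp only [Config.propose, Function.update_of_ne hxr] at hx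
      exact hc.held x h' hx
  · refine (hc.passed x i h' w hi hw hpassed).trans
      (Finset.card_le_card (above_mono (fun y p hy => ?_) h' _ x))
    have hne : y ≠ r := fun he => by simp [places, he, hcur] at hy
    rw [places_propose_of_ne hne, hy]

theorem restart (hc : G.IsConsistent c) (hcur : c.cur r = none)
    (hget : (G.resList r)[c.pos r]? = none) : G.IsConsistent (c.restart r) := by
  refine ⟨fun x h hx => ?_, fun x i h w hi hw hpassed => ?_⟩
  · have hne : x ≠ r := fun he => by simp [Config.restart, he, hcur] at hx
    simpa [Config.restart, hne] using hc.held x h hx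
  · rw [places_restart hcur]
    refine hc.passed x i h w hi hw ?_
    by_cases hxr : x = r
    · subst hxr
      have hlength := List.getElem?_eq_none_iff.1 hget
      have hlt := (List.getElem?_eq_some_iff.1 hi).1
      simp only [Config.HasPassed, Config.restart, Function.update_self] at hpassed ⊢
      omega
    · simpa [Config.HasPassed, Config.restart, hxr] using hpassed

theorem advance (hc : G.IsConsistent c) (hq : ∀ h, G.lower h ≤ G.upper h)
    (ha : G.advance c r = some c') : G.IsConsistent c' := by
  rcases advance_eq_some_iff.1 ha with
    ⟨h, hcur, hcap, rfl⟩ | ⟨hcur, hused, ⟨h, hget, rfl⟩ | ⟨hget, rfl⟩⟩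
  exacts [hc.leave hq hcur hcap, hc.propose hcur hused hget, hc.restart hcur hget]

theorem potential_advance_lt (hc : G.IsConsistent c) (ha : G.advance c r = some c') :
    G.potential c' r < G.potential c r := by
  rcases advance_eq_some_iff.1 ha with
    ⟨h, hcur, -, rfl⟩ | ⟨hcur, hused, ⟨h, -, rfl⟩ | ⟨-, rfl⟩⟩
  · have hlt := (List.getElem?_eq_some_iff.1 (hc.held r h hcur).2).1
    have hlength := (G.resList_nodup r).length_le_card
    simp only [potential, Config.leave, Function.update_self, hcur, Option.elim_none,
      Option.elim_some]
    omega
  · simp [potential, Config.propose, hcur]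
  · have hlevel : G.numLevels - c.used r = G.numLevels - (c.used r + 1) + 1 := by omega
    simp only [potential, Config.restart, Function.update_self, hcur, Option.elim_none]
    rw [hlevel, add_one_mul]
    omega

theorem sum_potential_advance_lt (hc : G.IsConsistent c) (ha : G.advance c r = some c') :
    ∑ r, G.potential c' r < ∑ r, G.potential c r := by
  have hoff : ∀ x, x ≠ r → G.potential c' x = G.potential c x := by
    intro x hx
    rcases advance_eq_some_iff.1 ha with ⟨h, -, -, rfl⟩ | ⟨-, -, ⟨h, -, rfl⟩ | ⟨-, rfl⟩⟩ <;>
      simp [potential, Config.leave, Config.propose, Config.restart, hx]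
  refine Finset.sum_lt_sum (fun x _ => ?_) ⟨r, Finset.mem_univ _, hc.potential_advance_lt ha⟩
  by_cases hx : x = r
  · exact hx ▸ (hc.potential_advance_lt ha).le
  · exact (hoff x hx).le

theorem hasPassed_of_desires [DecidableEq H] (hc : G.IsConsistent c) (hstuck : G.advance c r = none)
    (hs : s < G.numLevels) (hd : G.Desires (G.places c) r h s) :
    c.HasPassed r (G.levelAfter s) ((G.resList r).idxOf h) := by
  rcases advance_eq_none_iff.1 hstuck with ⟨-, hused⟩ | ⟨h', hcur, -⟩
  · exact Or.inl ((levelAfter_lt hs).trans_le hused)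
  · obtain ⟨hused, hget⟩ := hc.held r h' hcur
    refine (hd.2 h' (G.levelAfter (c.used r)) (places_eq_some.2 ⟨hcur, rfl⟩)).imp
      (fun hlt => ?_) fun ⟨he, hpref⟩ => ⟨?_, ?_⟩
    · unfold levelAfter at hlt ⊢
      omega
    · unfold levelAfter at he ⊢
      omega
    · obtain ⟨_, hget⟩ := List.getElem?_eq_some_iff.1 hget
      have hidx := hpref.2.2
      rwa [← hget, (G.resList_nodup r).idxOf_getElem] at hidx

theorem isLevelStable [DecidableEq H] (hc : G.IsConsistent c) (hstuck : ∀ r, G.advance c r = none) :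
    G.IsLevelStable (G.places c) where
  valid r h s hr := by
    obtain ⟨hcur, rfl⟩ := places_eq_some.1 hr
    obtain ⟨hused, hget⟩ := hc.held r h hcur
    exact ⟨List.mem_of_getElem? hget, levelAfter_lt hused⟩
  keep r h s hr := by
    obtain ⟨hcur, rfl⟩ := places_eq_some.1 hr
    obtain ⟨hnone, -⟩ | ⟨h', hcur', hlt⟩ := advance_eq_none_iff.1 (hstuck r)
    · cases hnone.symm.trans hcur
    · cases hcur'.symm.trans hcur
      exact hlt
  full r h s hs hd := by
    have hget : (G.resList r)[(G.resList r).idxOf h]? = some h := List.getElem?_idxOf hd.1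
    have hcap := hc.passed r _ h _ hget (levelAfter_lt hs)
      (hc.hasPassed_of_desires (hstuck r) hs hd)
    rwa [levelAfter_levelAfter hs] at hcap

end IsConsistent

end HRLQ

end DeferredAcceptance

section Encoding

/-- The concatenation of lists of numbers, each preceded by its length. -/
def blocks (ls : List (List ℕ)) : List ℕ := ls.flatMap fun l => l.length :: l

theorem blocks_append (ls ls' : List (List ℕ)) : blocks (ls ++ ls') = blocks ls ++ blocks ls' :=
  List.flatMap_append

theorem blocks_eq_append {ls : List (List ℕ)} {i : ℕ} (hi : i < ls.length) :
    blocks ls = blocks (ls.take i) ++ (ls[i].length :: ls[i] ++ blocks (ls.drop (i + 1))) :=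
  calc blocks ls = blocks (ls.take i ++ ls[i] :: ls.drop (i + 1)) := by simp
    _ = _ := blocks_append _ _

namespace HRLQ

variable {n m : ℕ} (G : HRLQ (Fin n) (Fin m))

/-- The preference lists of the residents and of the hospitals, as lists of numbers. -/
def prefLists : List (List ℕ) :=
  (List.finRange n).map (fun r => (G.resList r).map Fin.val) ++
  (List.finRange m).map (fun h => (G.hospList h).map Fin.val)

/-- The part of the encoding before the preference lists. -/
def header : List ℕ := [n, m] ++ List.ofFn G.upper ++ List.ofFn G.lower

/-- The address of the `i`-th preference list in the encoding. -/
def addr (i : ℕ) : ℕ := (G.header ++ blocks (G.prefLists.take i)).length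

theorem encode_eq : G.encode = G.header ++ blocks G.prefLists := by
  simp [encode, header, prefLists, blocks, List.flatMap_append, List.flatMap_map]

theorem length_header : G.header.length = 2 + m + m := by
  simp only [header, List.length_append, List.length_cons, List.length_nil, List.length_ofFn]

theorem length_prefLists : G.prefLists.length = n + m := by
  simp [prefLists]

theorem getElem_prefLists_res (r : Fin n) (hr : r.val < G.prefLists.length) :
    G.prefLists[r.val] = (G.resList r).map Fin.val := by
  simp [prefLists]

theorem getElem_prefLists_hosp (h : Fin m) (hh : n + h.val < G.prefLists.length) :
    G.prefLists[n + h.val] = (G.hospList h).map Fin.val := by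
  simp [prefLists]

theorem addr_zero : G.addr 0 = 2 + m + m := by
  simp [addr, blocks, length_header]

theorem addr_add : G.addr (n + m) = G.encode.length := by
  rw [addr, encode_eq, List.take_of_length_le G.length_prefLists.le]

theorem encode_getD_zero : G.encode.getD 0 0 = n := rfl

theorem encode_getD_one : G.encode.getD 1 0 = m := rfl

theorem encode_getD_upper (h : Fin m) : G.encode.getD (2 + h) 0 = G.upper h := by
  rw [encode_eq, List.getD_append _ _ _ _ (by rw [length_header]; omega), header,
    List.getD_append _ _ _ _ (by simp; omega),
    List.getD_append_right _ _ _ _ (by simp)]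
  simp

theorem encode_getD_lower (h : Fin m) : G.encode.getD (2 + m + h) 0 = G.lower h := by
  rw [encode_eq, List.getD_append _ _ _ _ (by rw [length_header]; omega), header,
    List.getD_append_right _ _ _ _ (by simp; omega)]
  simp [show 2 + m + h.val - (m + 1 + 1) = h.val by omega]

theorem encode_eq_append {i : ℕ} (hi : i < G.prefLists.length) : G.encode =
    (G.header ++ blocks (G.prefLists.take i)) ++
      (G.prefLists[i].length :: G.prefLists[i] ++ blocks (G.prefLists.drop (i + 1))) := by
  rw [encode_eq, blocks_eq_append hi, List.append_assoc]

theorem addr_succ {i : ℕ} (hi : i < G.prefLists.length) :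
    G.addr (i + 1) = G.addr i + G.prefLists[i].length + 1 := by
  rw [addr, addr, List.take_add_one, List.getElem?_eq_getElem hi, blocks_append]
  simp only [blocks, Option.toList_some, List.flatMap_singleton, List.length_append,
    List.length_cons]
  omega

theorem addr_add_length_lt {i : ℕ} (hi : i < G.prefLists.length) :
    G.addr i + G.prefLists[i].length < G.encode.length := by
  rw [G.encode_eq_append hi]
  simp only [addr, List.length_append, List.length_cons]
  omega

theorem add_le_addr {i : ℕ} (hi : i ≤ n + m) : 2 + m + m + i ≤ G.addr i := by
  induction i with
  | zero => exact G.addr_zero.ge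
  | succ i ih =>
    have hsucc := G.addr_succ (i := i) (by rw [length_prefLists]; omega)
    have hle := ih (by omega)
    omega

theorem add_le_length_encode : 2 + m + m + (n + m) ≤ G.encode.length :=
  (G.add_le_addr le_rfl).trans G.addr_add.le

theorem encode_getD_addr {i : ℕ} (hi : i < G.prefLists.length) :
    G.encode.getD (G.addr i) 0 = G.prefLists[i].length := by
  rw [G.encode_eq_append hi, addr, List.getD_append_right _ _ _ _ le_rfl, Nat.sub_self,
    List.cons_append, List.getD_cons_zero]

theorem encode_getD_addr_add {i j : ℕ} (hi : i < G.prefLists.length)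
    (hj : j < G.prefLists[i].length) :
    G.encode.getD (G.addr i + 1 + j) 0 = G.prefLists[i][j] := by
  rw [G.encode_eq_append hi, addr, List.getD_append_right _ _ _ _ (by omega), Nat.add_assoc,
    Nat.add_sub_cancel_left, Nat.add_comm 1 j, List.cons_append, List.getD_cons_succ,
    List.getD_append _ _ _ _ hj, List.getD_eq_getElem _ _ hj]

end HRLQ

end Encoding

section WeakestPreconditions

namespace RamProgram

/-- The program `p`, started in the state `s` at time `t₀`, halts, and `Q` holds of the final state
and the final time. -/
def Wp (p : RamProgram) (Q : RamState → ℕ → Prop) (s : RamState) (t₀ : ℕ) : Prop :=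
  ∃ t s', p.Runs s t s' ∧ Q s' (t₀ + t)

variable {Q Q' : RamState → ℕ → Prop} {s : RamState} {t : ℕ}

theorem wp_const {x c : ℕ} : (const x c).Wp Q s t ↔ Q (s.setReg x c) (t + 1) :=
  ⟨fun ⟨_, _, hruns, hQ⟩ => by cases hruns; exact hQ, fun hQ => ⟨_, _, .const x c s, hQ⟩⟩

theorem wp_plus {x y z : ℕ} :
    (plus x y z).Wp Q s t ↔ Q (s.setReg x (s.reg y + s.reg z)) (t + 1) :=
  ⟨fun ⟨_, _, hruns, hQ⟩ => by cases hruns; exact hQ, fun hQ => ⟨_, _, .plus x y z s, hQ⟩⟩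

theorem wp_minus {x y z : ℕ} :
    (minus x y z).Wp Q s t ↔ Q (s.setReg x (s.reg y - s.reg z)) (t + 1) :=
  ⟨fun ⟨_, _, hruns, hQ⟩ => by cases hruns; exact hQ, fun hQ => ⟨_, _, .minus x y z s, hQ⟩⟩

theorem wp_load {x y : ℕ} : (load x y).Wp Q s t ↔ Q (s.setReg x (s.mem (s.reg y))) (t + 1) :=
  ⟨fun ⟨_, _, hruns, hQ⟩ => by cases hruns; exact hQ, fun hQ => ⟨_, _, .load x y s, hQ⟩⟩

theorem wp_store {x y : ℕ} : (store x y).Wp Q s t ↔ Q (s.setMem (s.reg x) (s.reg y)) (t + 1) :=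
  ⟨fun ⟨_, _, hruns, hQ⟩ => by cases hruns; exact hQ, fun hQ => ⟨_, _, .store x y s, hQ⟩⟩

theorem wp_seq {p q : RamProgram} :
    (seq p q).Wp Q s t ↔ p.Wp (fun s' t' => q.Wp Q s' t') s t := by
  constructor
  · rintro ⟨_, _, hruns, hQ⟩
    cases hruns with
    | seq _ _ _ s' _ t₁ t₂ hp hq => exact ⟨t₁, s', hp, t₂, _, hq, by rwa [Nat.add_assoc]⟩
  · rintro ⟨t₁, s', hp, t₂, s'', hq, hQ⟩
    exact ⟨_, _, .seq _ _ _ _ _ _ _ hp hq, by rwa [← Nat.add_assoc]⟩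

theorem wp_branch {x : ℕ} {p q : RamProgram} :
    (branch x p q).Wp Q s t ↔ if s.reg x = 0 then q.Wp Q s (t + 1) else p.Wp Q s (t + 1) := by
  constructor
  · rintro ⟨_, _, hruns, hQ⟩
    cases hruns with
    | branch_pos _ _ _ _ _ t₁ hx hp =>
      rw [if_neg hx]
      exact ⟨t₁, _, hp, by rwa [Nat.add_assoc, Nat.add_comm 1]⟩
    | branch_zero _ _ _ _ _ t₁ hx hq =>
      rw [if_pos hx]
      exact ⟨t₁, _, hq, by rwa [Nat.add_assoc, Nat.add_comm 1]⟩
  · split_ifs with hx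
    · rintro ⟨t₁, s', hq, hQ⟩
      exact ⟨_, _, .branch_zero _ _ _ _ _ _ hx hq, by rwa [Nat.add_comm t₁, ← Nat.add_assoc]⟩
    · rintro ⟨t₁, s', hp, hQ⟩
      exact ⟨_, _, .branch_pos _ _ _ _ _ _ hx hp, by rwa [Nat.add_comm t₁, ← Nat.add_assoc]⟩

theorem Wp.mono {p : RamProgram} (hp : p.Wp Q s t) (hQ : ∀ s' t', Q s' t' → Q' s' t') :
    p.Wp Q' s t :=
  let ⟨t₁, s', hruns, hQs⟩ := hp
  ⟨t₁, s', hruns, hQ _ _ hQs⟩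

theorem Wp.of_forall_imp {p : RamProgram}
    (hp : ∀ P : RamState → ℕ → Prop, (∀ s' t', Q s' t' → P s' t') → p.Wp P s t) :
    p.Wp Q s t := hp Q fun _ _ hQ => hQ

theorem wp_loop {x k T : ℕ} {p : RamProgram} (I : ℕ → RamState → Prop) (hI : I k s)
    (hstep : ∀ k s t, I k s → s.reg x ≠ 0 →
      p.Wp (fun s' t' => (∃ k' < k, I k' s') ∧ t' ≤ t + T) s t) :
    (loop x p).Wp (fun s' t' => (∃ k', I k' s') ∧ s'.reg x = 0 ∧ t' ≤ t + (k * (T + 1) + 1))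
      s t := by
  induction k using Nat.strong_induction_on generalizing s t with
  | _ k ih =>
    by_cases hx : s.reg x = 0
    · exact ⟨1, s, .loop_zero _ _ _ hx, ⟨k, hI⟩, hx, by omega⟩
    · obtain ⟨t₁, s', hruns, ⟨k', hlt, hI'⟩, ht₁⟩ := hstep k s t hI hx
      obtain ⟨t₂, s'', hruns', hI'', hx', ht₂⟩ := ih k' hlt hI' (t := t + t₁ + 1)
      refine ⟨_, s'', .loop_pos _ _ _ _ _ _ _ hx hruns hruns', hI'', hx', ?_⟩
      have hmul := Nat.mul_le_mul_right (T + 1) (Nat.succ_le_of_lt hlt)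
      rw [Nat.succ_mul] at hmul
      omega

theorem wp_loop_countdown {x N T : ℕ} {p : RamProgram} (I : ℕ → RamState → Prop)
    (hx : s.reg x = N) (hI : I 0 s)
    (hstep : ∀ i < N, ∀ s t, I i s → s.reg x = N - i →
      p.Wp (fun s' t' => I (i + 1) s' ∧ s'.reg x = s.reg x - 1 ∧ t' ≤ t + T) s t) :
    (loop x p).Wp (fun s' t' => I N s' ∧ t' ≤ t + (N * (T + 1) + 1)) s t := by
  refine (wp_loop (k := N) (T := T) (fun k s => s.reg x = k ∧ k ≤ N ∧ I (N - k) s)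
    ⟨hx, le_rfl, by rwa [Nat.sub_self]⟩ ?_).mono ?_
  · rintro k s t ⟨rfl, hle, hI⟩ hne
    refine (hstep _ (by omega) s t hI (by omega)).mono fun s' t' ⟨hI', hx', ht'⟩ =>
      ⟨⟨_, ?_, rfl, ?_, ?_⟩, ht'⟩
    · omega
    · omega
    · rwa [hx', show N - (s.reg x - 1) = N - s.reg x + 1 by omega]
  · rintro s' t' ⟨⟨k, hk, -, hI'⟩, hz, ht'⟩
    rw [← hk, hz] at hI'
    exact ⟨hI', ht'⟩

end RamProgram

namespace RamState

theorem setReg_reg (s : RamState) (x v y : ℕ) :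
    (s.setReg x v).reg y = if y = x then v else s.reg y :=
  Function.update_apply ..

theorem setReg_mem (s : RamState) (x v : ℕ) : (s.setReg x v).mem = s.mem := rfl

theorem setMem_reg (s : RamState) (a v : ℕ) : (s.setMem a v).reg = s.reg := rfl

theorem setMem_mem (s : RamState) (a v b : ℕ) :
    (s.setMem a v).mem b = if b = a then v else s.mem b :=
  Function.update_apply ..

end RamState

end WeakestPreconditions

section Counting

theorem countP_mem_eq_card {α : Type*} [DecidableEq α] {l : List α} (hl : l.Nodup) {A : Finset α}
    (hA : ∀ x ∈ A, x ∈ l) : l.countP (· ∈ A) = A.card := by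
  rw [List.countP_eq_length_filter, ← List.toFinset_card_of_nodup (hl.filter _)]
  congr 1
  ext x
  simpa using hA x

theorem countP_take_succ {α : Type*} {l : List α} {i : ℕ} (hi : i < l.length) (p : α → Bool) :
    (l.take (i + 1)).countP p = (l.take i).countP p + if p l[i] then 1 else 0 := by
  rw [List.take_add_one, List.getElem?_eq_getElem hi, List.countP_append, Option.toList_some,
    List.countP_singleton]

namespace HRLQ

variable {R : Type u} {H : Type v} [Fintype R] [Fintype H] [DecidableEq R] {G : HRLQ R H}
  {c : Config R H} {r x : R} {h : H}

theorem IsConsistent.mem_hospList (hc : G.IsConsistent c) (hcur : c.cur r = some h) :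
    r ∈ G.hospList h :=
  (G.mem_iff r h).1 (List.mem_of_getElem? (hc.held r h hcur).2)

theorem IsConsistent.mem_above_places_iff (hc : G.IsConsistent c) (hcur : c.cur r = some h) :
    x ∈ G.above (G.places c) h (G.levelAfter (c.used r)) r ↔ c.cur x = some h ∧
      (c.used r < c.used x ∨
        c.used x = c.used r ∧ (G.hospList h).idxOf x < (G.hospList h).idxOf r) := by
  have hused := (hc.held r h hcur).1
  simp only [mem_above, places_eq_some, levelAfter, Prefers]
  constructor
  · rintro ⟨_, ⟨hx, rfl⟩, hbefore⟩
    have hxused := (hc.held x h hx).1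
    exact ⟨hx, hbefore.imp (fun _ => by omega) fun ⟨_, hpref⟩ => ⟨by omega, hpref.2.2⟩⟩
  · rintro ⟨hx, hbefore⟩
    have hxused := (hc.held x h hx).1
    exact ⟨_, ⟨hx, rfl⟩, hbefore.imp (fun _ => by omega) fun ⟨_, hidx⟩ =>
      ⟨by omega, hc.mem_hospList hx, hc.mem_hospList hcur, hidx⟩⟩

theorem IsConsistent.countP_mem_above (hc : G.IsConsistent c) (hcur : c.cur r = some h) :
    (G.hospList h).countP (· ∈ G.above (G.places c) h (G.levelAfter (c.used r)) r) =
      (G.above (G.places c) h (G.levelAfter (c.used r)) r).card :=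
  countP_mem_eq_card (G.hospList_nodup h) fun _ hx =>
    hc.mem_hospList ((hc.mem_above_places_iff hcur).1 hx).1

theorem IsConsistent.levelCap_levelAfter (hc : G.IsConsistent c) (hcur : c.cur r = some h) :
    G.levelCap h (G.levelAfter (c.used r)) =
      if c.used r < ∑ h, G.lower h then G.lower h else G.upper h := by
  have hused := (hc.held r h hcur).1
  have hlevel : G.levelAfter (c.used r) < Fintype.card R ↔ ¬c.used r < ∑ h, G.lower h := by
    unfold levelAfter
    unfold numLevels at hused ⊢
    omega
  simp only [levelCap, hlevel, ite_not]

end HRLQ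

end Counting

section Programs

open RamProgram

local infixr:60 " ;; " => RamProgram.seq

local notation "rZero" => (0 : ℕ)
local notation "rOne" => (1 : ℕ)
local notation "rNumRes" => (2 : ℕ)
local notation "rNumHosp" => (3 : ℕ)
local notation "rLists" => (4 : ℕ)
local notation "rUsedBase" => (5 : ℕ)
local notation "rQuotas" => (6 : ℕ)
local notation "rNumLevels" => (7 : ℕ)
local notation "rPosBase" => (8 : ℕ)
local notation "rCurBase" => (9 : ℕ)
local notation "rRes" => (10 : ℕ)
local notation "rUsed" => (11 : ℕ)
local notation "rPos" => (12 : ℕ)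
local notation "rCur" => (13 : ℕ)
local notation "rUsedAddr" => (14 : ℕ)
local notation "rPosAddr" => (15 : ℕ)
local notation "rCurAddr" => (16 : ℕ)
local notation "rToDo" => (17 : ℕ)
local notation "rIndex" => (20 : ℕ)
local notation "rList" => (21 : ℕ)
local notation "rCounter" => (22 : ℕ)
local notation "rValue" => (23 : ℕ)
local notation "rEntry" => (24 : ℕ)
local notation "rOther" => (25 : ℕ)
local notation "rSeen" => (26 : ℕ)
local notation "rCount" => (27 : ℕ)
local notation "rTest" => (28 : ℕ)
local notation "rTemp" => (29 : ℕ)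

/-- An instruction that only overwrites a scratch register. -/
def noop : RamProgram := const rTemp 0

/-- `rTest` becomes nonzero if and only if the registers `x` and `y` differ. -/
def compareProgram (x y : ℕ) : RamProgram :=
  minus rTest x y ;; minus rTemp y x ;; plus rTest rTest rTemp

/-- `rList` becomes the address of the preference list with the number in `rIndex`. -/
def walkProgram : RamProgram :=
  plus rList rLists rZero ;; plus rCounter rIndex rZero ;;
  loop rCounter
    (load rValue rList ;; plus rList rList rValue ;; plus rList rList rOne ;;
      minus rCounter rCounter rOne)

/-- The treatment by `scanProgram` of the resident at the address `rEntry` of a hospital's list. It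
is held before `rRes` if it has used up more levels, or as many and `rRes` is not yet seen. -/
def scanStep : RamProgram :=
  load rOther rEntry ;;
  compareProgram rOther rRes ;; branch rTest noop (const rSeen 1) ;;
  plus rValue rCurBase rOther ;; load rValue rValue ;; compareProgram rValue rCur ;;
  branch rTest noop
    (plus rValue rUsedBase rOther ;; load rValue rValue ;; minus rTest rValue rUsed ;;
      branch rTest (plus rCount rCount rOne)
        (minus rTest rUsed rValue ;; plus rTest rTest rSeen ;;
          branch rTest noop (plus rCount rCount rOne))) ;;
  plus rEntry rEntry rOne ;; minus rCounter rCounter rOne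

/-- `rCount` becomes the number of residents that the hospital `rCur - 1`, whose list starts at the
address `rList`, holds before the resident `rRes`. -/
def scanProgram : RamProgram :=
  const rCount 0 ;; const rSeen 0 ;; load rCounter rList ;; plus rEntry rList rOne ;;
  loop rCounter scanStep

/-- `rValue` becomes the capacity of the copy that holds the resident `rRes`. -/
def capacityProgram : RamProgram :=
  plus rTest rUsed rOne ;; minus rTest rTest rQuotas ;; plus rValue rOne rCur ;;
  branch rTest noop (plus rValue rValue rNumHosp) ;; load rValue rValue

/-- The resident `rRes` leaves its hospital if `rCount` is at least `rValue`. -/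
def leaveProgram : RamProgram :=
  plus rTest rCount rOne ;; minus rTest rTest rValue ;;
  branch rTest
    (store rCurAddr rZero ;; plus rPos rPos rOne ;; store rPosAddr rPos ;; const rRes 0)
    (plus rRes rRes rOne)

/-- One step of the resident `rRes` if a hospital holds it. -/
def heldProgram : RamProgram :=
  plus rIndex rNumRes rCur ;; minus rIndex rIndex rOne ;;
  walkProgram ;; scanProgram ;; capacityProgram ;; leaveProgram

/-- The free resident `rRes`, whose list starts at the address `rList`, proposes to the next
hospital or starts over one level lower. -/
def proposeProgram : RamProgram :=
  load rTest rList ;; minus rTest rTest rPos ;;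
  branch rTest
    (plus rValue rList rOne ;; plus rValue rValue rPos ;; load rValue rValue ;;
      plus rValue rValue rOne ;; store rCurAddr rValue ;; const rRes 0)
    (plus rUsed rUsed rOne ;; store rUsedAddr rUsed ;; store rPosAddr rZero ;; const rRes 0)

/-- One step of the resident `rRes` if no hospital holds it. -/
def freeProgram : RamProgram :=
  minus rTest rNumLevels rUsed ;;
  branch rTest (plus rIndex rRes rZero ;; walkProgram ;; proposeProgram) (plus rRes rRes rOne)

/-- The state of the resident `rRes` is loaded into the registers. -/
def focusProgram : RamProgram :=
  plus rUsedAddr rUsedBase rRes ;; load rUsed rUsedAddr ;;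
  plus rPosAddr rPosBase rRes ;; load rPos rPosAddr ;;
  plus rCurAddr rCurBase rRes ;; load rCur rCurAddr

/-- One step of the resident `rRes`. Afterwards the search for a resident that can make a step
starts over or goes on with the next resident. -/
def roundProgram : RamProgram :=
  focusProgram ;; branch rCur heldProgram freeProgram ;; minus rToDo rNumRes rRes

/-- `rQuotas` becomes the sum of the lower quotas. -/
def quotaProgram : RamProgram :=
  plus rCounter rNumHosp rZero ;; plus rEntry rOne rOne ;; plus rEntry rEntry rNumHosp ;;
  loop rCounter
    (load rValue rEntry ;; plus rQuotas rQuotas rValue ;; plus rEntry rEntry rOne ;;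
      minus rCounter rCounter rOne)

/-- Computation of the fixed register contents. -/
def initProgram : RamProgram :=
  const rOne 1 ;; load rNumRes rZero ;; load rNumHosp rOne ;;
  plus rLists rOne rOne ;; plus rLists rLists rNumHosp ;; plus rLists rLists rNumHosp ;;
  plus rIndex rNumRes rNumHosp ;; walkProgram ;; plus rUsedBase rList rZero ;;
  quotaProgram ;; plus rNumLevels rNumRes rQuotas ;;
  plus rPosBase rUsedBase rNumRes ;; plus rCurBase rPosBase rNumRes ;; plus rToDo rNumRes rZero

/-- Copying of the final partners to the output cells. -/
def outputProgram : RamProgram :=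
  const rRes 0 ;; plus rToDo rNumRes rZero ;; plus rEntry rCurBase rZero ;;
  loop rToDo
    (load rOther rEntry ;; store rRes rOther ;; plus rRes rRes rOne ;; plus rEntry rEntry rOne ;;
      minus rToDo rToDo rOne)

/-- The deferred acceptance algorithm on levelled copies. -/
def matchingProgram : RamProgram := initProgram ;; loop rToDo roundProgram ;; outputProgram

theorem wp_scanStep {s : RamState} {t a b w : ℕ} (hone : s.reg rOne = 1)
    (ha : s.mem (s.reg rEntry) = a) (hb : s.mem (s.reg rCurBase + a) = b)
    (hw : s.mem (s.reg rUsedBase + a) = w) :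
    scanStep.Wp (fun s' t' => s'.mem = s.mem ∧ (∀ x < 20, s'.reg x = s.reg x) ∧
      s'.reg rCounter = s.reg rCounter - 1 ∧ s'.reg rEntry = s.reg rEntry + 1 ∧
      s'.reg rSeen = (if a = s.reg rRes then 1 else s.reg rSeen) ∧
      s'.reg rCount = s.reg rCount + (if b = s.reg rCur ∧
        (s.reg rUsed < w ∨ w = s.reg rUsed ∧ a ≠ s.reg rRes ∧ s.reg rSeen = 0) then 1 else 0) ∧
      t' ≤ t + 25) s t := by
  refine .of_forall_imp fun Q hQ => ?_
  have hframe : ∀ x < 20, x ≠ 23 ∧ x ≠ 24 ∧ x ≠ 25 ∧ x ≠ 22 ∧ x ≠ 26 ∧ x ≠ 27 ∧ x ≠ 28 ∧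
      x ≠ 29 := by omega
  simp only [scanStep, compareProgram, noop, wp_seq, wp_plus, wp_load, wp_minus, wp_branch,
    wp_const, RamState.setReg_reg, RamState.setReg_mem, Nat.reduceEqDiff, reduceIte, ha, hb, hw,
    hone]
  split_ifs
  all_goals
    refine hQ _ _ ⟨rfl, fun x hx => ?_, ?_, ?_, ?_, ?_, by omega⟩
    · obtain ⟨h22, h23, h24, h25, h26, h27, h28, h29⟩ := hframe x hx
      simp only [RamState.setReg_reg, h22, h23, h24, h25, h26, h27, h28, h29, if_false]
    all_goals simp only [RamState.setReg_reg, Nat.reduceEqDiff, reduceIte]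
    all_goals grind

namespace HRLQ

variable {n m : ℕ} (G : HRLQ (Fin n) (Fin m))

/-- The contents of the registers that are fixed during the algorithm. -/
structure Globals (s : RamState) : Prop where
  zero : s.reg rZero = 0
  one : s.reg rOne = 1
  residents : s.reg rNumRes = n
  hospitals : s.reg rNumHosp = m
  lists : s.reg rLists = 2 + m + m
  usedBase : s.reg rUsedBase = G.encode.length
  quotas : s.reg rQuotas = ∑ h, G.lower h
  levels : s.reg rNumLevels = G.numLevels
  posBase : s.reg rPosBase = G.encode.length + n
  curBase : s.reg rCurBase = G.encode.length + n + n

/-- The memory contains the instance, followed by the three tables of the configuration `c`. A free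
resident has the entry `0` in the third table, and a resident held by `h` the entry `h + 1`. -/
structure Represents (f : ℕ → ℕ) (c : Config (Fin n) (Fin m)) : Prop where
  input : ∀ a < G.encode.length, f a = G.encode.getD a 0
  used : ∀ r : Fin n, f (G.encode.length + r) = c.used r
  pos : ∀ r : Fin n, f (G.encode.length + n + r) = c.pos r
  cur : ∀ r : Fin n, f (G.encode.length + n + n + r) = (c.cur r).elim 0 (fun h => h.val + 1)

/-- The registers and the memory when a step of the resident `r` in the configuration `c` is
computed. -/
structure IsFocused (c : Config (Fin n) (Fin m)) (r : Fin n) (s : RamState) : Prop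
    extends G.Globals s where
  memory : G.Represents s.mem c
  res : s.reg rRes = r
  used : s.reg rUsed = c.used r
  pos : s.reg rPos = c.pos r
  cur : s.reg rCur = (c.cur r).elim 0 (fun h => h.val + 1)
  usedAddr : s.reg rUsedAddr = G.encode.length + r
  posAddr : s.reg rPosAddr = G.encode.length + n + r
  curAddr : s.reg rCurAddr = G.encode.length + n + n + r

/-- The outcome of a step of `r` in the configuration `c`: the new configuration is stored and
`rRes` is reset, or `r` cannot make a step and `rRes` is increased. -/
def StepResult (c : Config (Fin n) (Fin m)) (r : Fin n) (s : RamState) : Prop :=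
  G.Globals s ∧ ((∃ c', G.advance c r = some c' ∧ G.Represents s.mem c' ∧ s.reg rRes = 0) ∨
    G.advance c r = none ∧ G.Represents s.mem c ∧ s.reg rRes = r + 1)

variable {G} {f : ℕ → ℕ} {s s' : RamState} {c : Config (Fin n) (Fin m)} {r : Fin n} {h : Fin m}
  {x v i : ℕ}

theorem Globals.congr (hs : G.Globals s) (hreg : ∀ x < 10, s'.reg x = s.reg x) :
    G.Globals s' := by
  constructor <;> rw [hreg _ (by omega)]
  exacts [hs.zero, hs.one, hs.residents, hs.hospitals, hs.lists, hs.usedBase, hs.quotas, hs.levels,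
    hs.posBase, hs.curBase]

theorem Globals.setReg (hs : G.Globals s) (hx : 10 ≤ x) : G.Globals (s.setReg x v) :=
  hs.congr fun y hy => by rw [RamState.setReg_reg, if_neg (by omega)]

theorem Globals.setMem (hs : G.Globals s) : G.Globals (s.setMem x v) :=
  hs.congr fun _ _ => rfl

namespace IsFocused

theorem congr (hs : G.IsFocused c r s) (hmem : s'.mem = s.mem)
    (hreg : ∀ x < 20, s'.reg x = s.reg x) : G.IsFocused c r s' where
  toGlobals := hs.toGlobals.congr fun x hx => hreg x (by omega)
  memory := hmem ▸ hs.memory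
  res := (hreg _ (by omega)).trans hs.res
  used := (hreg _ (by omega)).trans hs.used
  pos := (hreg _ (by omega)).trans hs.pos
  cur := (hreg _ (by omega)).trans hs.cur
  usedAddr := (hreg _ (by omega)).trans hs.usedAddr
  posAddr := (hreg _ (by omega)).trans hs.posAddr
  curAddr := (hreg _ (by omega)).trans hs.curAddr

theorem setReg (hs : G.IsFocused c r s) (hx : 20 ≤ x) : G.IsFocused c r (s.setReg x v) :=
  hs.congr rfl fun y hy => by rw [RamState.setReg_reg, if_neg (by omega)]

theorem cur_of_eq_some (hs : G.IsFocused c r s) (hcur : c.cur r = some h) :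
    s.reg rCur = h + 1 := by
  rw [hs.cur, hcur, Option.elim_some]

end IsFocused

namespace Represents

theorem list_length {k : ℕ} {l : List (Fin k)} (hf : G.Represents f c)
    (hi : i < G.prefLists.length) (hl : G.prefLists[i] = l.map Fin.val) :
    f (G.addr i) = l.length := by
  rw [hf.input _ ((Nat.le_add_right ..).trans_lt (G.addr_add_length_lt hi)), G.encode_getD_addr hi,
    hl, List.length_map]

theorem list_getElem {k j : ℕ} {l : List (Fin k)} (hf : G.Represents f c)
    (hi : i < G.prefLists.length) (hl : G.prefLists[i] = l.map Fin.val) (hj : j < l.length) :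
    f (G.addr i + 1 + j) = l[j] := by
  have hlt := G.addr_add_length_lt hi
  have hlen : G.prefLists[i].length = l.length := by rw [hl, List.length_map]
  rw [hf.input _ (by omega), G.encode_getD_addr_add hi (by omega)]
  simp only [hl, List.getElem_map]

theorem resList_length (hf : G.Represents f c) (r : Fin n) :
    f (G.addr r) = (G.resList r).length :=
  hf.list_length (by rw [length_prefLists]; omega) (G.getElem_prefLists_res r _)

theorem resList_getElem (hf : G.Represents f c) (r : Fin n) (hi : i < (G.resList r).length) :
    f (G.addr r + 1 + i) = (G.resList r)[i] :=
  hf.list_getElem (by rw [length_prefLists]; omega) (G.getElem_prefLists_res r _) hi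

theorem hospList_length (hf : G.Represents f c) (h : Fin m) :
    f (G.addr (n + h)) = (G.hospList h).length :=
  hf.list_length (by rw [length_prefLists]; omega) (G.getElem_prefLists_hosp h _)

theorem hospList_getElem (hf : G.Represents f c) (h : Fin m) (hi : i < (G.hospList h).length) :
    f (G.addr (n + h) + 1 + i) = (G.hospList h)[i] :=
  hf.list_getElem (by rw [length_prefLists]; omega) (G.getElem_prefLists_hosp h _) hi

theorem upper (hf : G.Represents f c) (h : Fin m) : f (2 + h) = G.upper h := by
  have hlen := G.add_le_length_encode
  rw [hf.input _ (by omega), G.encode_getD_upper]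

theorem lower (hf : G.Represents f c) (h : Fin m) : f (2 + m + h) = G.lower h := by
  have hlen := G.add_le_length_encode
  rw [hf.input _ (by omega), G.encode_getD_lower]

theorem start (G : HRLQ (Fin n) (Fin m)) :
    G.Represents (RamState.init G.encode).mem (Config.start (Fin n) (Fin m)) where
  input _ _ := rfl
  used _ := List.getD_eq_default _ _ (by omega)
  pos _ := List.getD_eq_default _ _ (by omega)
  cur _ := List.getD_eq_default _ _ (by omega)

theorem update_used (hf : G.Represents f c) (r : Fin n) (v : ℕ) :
    G.Represents (Function.update f (G.encode.length + r) v)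
      { c with used := Function.update c.used r v } where
  input a ha := by rw [Function.update_of_ne (by omega), hf.input a ha]
  used r' := by
    simp only [Function.update_apply, hf.used, Nat.add_left_cancel_iff, Fin.val_inj]
  pos r' := by rw [Function.update_of_ne (by omega), hf.pos r']
  cur r' := by rw [Function.update_of_ne (by omega), hf.cur r']

theorem update_pos (hf : G.Represents f c) (r : Fin n) (v : ℕ) :
    G.Represents (Function.update f (G.encode.length + n + r) v)
      { c with pos := Function.update c.pos r v } where
  input a ha := by rw [Function.update_of_ne (by omega), hf.input a ha]
  used r' := by rw [Function.update_of_ne (by omega), hf.used r']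
  pos r' := by
    simp only [Function.update_apply, hf.pos, Nat.add_left_cancel_iff, Fin.val_inj]
  cur r' := by rw [Function.update_of_ne (by omega), hf.cur r']

theorem update_cur (hf : G.Represents f c) (r : Fin n) (x : Option (Fin m)) :
    G.Represents
      (Function.update f (G.encode.length + n + n + r) (x.elim 0 (fun h => h.val + 1)))
      { c with cur := Function.update c.cur r x } where
  input a ha := by rw [Function.update_of_ne (by omega), hf.input a ha]
  used r' := by rw [Function.update_of_ne (by omega), hf.used r']
  pos r' := by rw [Function.update_of_ne (by omega), hf.pos r']
  cur r' := by
    simp only [Function.update_apply, hf.cur, Nat.add_left_cancel_iff, Fin.val_inj]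
    split_ifs <;> rfl

theorem leave (hf : G.Represents f c) (r : Fin n) :
    G.Represents (Function.update (Function.update f (G.encode.length + n + n + r) 0)
      (G.encode.length + n + r) (c.pos r + 1)) (c.leave r) :=
  (hf.update_cur r none).update_pos r (c.pos r + 1)

theorem propose (hf : G.Represents f c) (r : Fin n) (h : Fin m) :
    G.Represents (Function.update f (G.encode.length + n + n + r) (h + 1)) (c.propose r h) :=
  hf.update_cur r (some h)

theorem restart (hf : G.Represents f c) (r : Fin n) :
    G.Represents (Function.update (Function.update f (G.encode.length + r) (c.used r + 1))
      (G.encode.length + n + r) 0) (c.restart r) :=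
  (hf.update_used r (c.used r + 1)).update_pos r 0

end Represents

theorem wp_walkProgram {t : ℕ} (hinput : ∀ a < G.encode.length, s.mem a = G.encode.getD a 0)
    (hzero : s.reg rZero = 0) (hone : s.reg rOne = 1) (hlists : s.reg rLists = 2 + m + m)
    (hindex : s.reg rIndex = i) (hi : i ≤ n + m) :
    walkProgram.Wp (fun s' t' => s'.mem = s.mem ∧ (∀ x < 20, s'.reg x = s.reg x) ∧
      s'.reg rList = G.addr i ∧ t' ≤ t + (5 * i + 3)) s t := by
  simp only [walkProgram, wp_seq, wp_plus]
  refine (wp_loop_countdown (N := i) (T := 4) (fun j s' => s'.mem = s.mem ∧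
    (∀ x < 20, s'.reg x = s.reg x) ∧ s'.reg rList = G.addr j) ?_ ?_ ?_).mono
    fun s' t' ⟨⟨hmem, hreg, haddr⟩, _⟩ => ⟨hmem, hreg, haddr, by omega⟩
  · simp only [RamState.setReg_reg, Nat.reduceEqDiff, reduceIte, hindex, hzero, Nat.add_zero]
  · refine ⟨rfl, fun x hx => ?_, ?_⟩
    · simp only [RamState.setReg_reg, show x ≠ 21 by omega, show x ≠ 22 by omega, if_false]
    · simp only [RamState.setReg_reg, Nat.reduceEqDiff, reduceIte, hzero, hlists, addr_zero,
        Nat.add_zero]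
  · rintro j hj s₁ t₁ ⟨hmem, hreg, haddr⟩ -
    have hlt : j < G.prefLists.length := by rw [length_prefLists]; omega
    have hlength : s₁.mem (G.addr j) = G.prefLists[j].length := by
      rw [hmem, hinput _ ((Nat.le_add_right ..).trans_lt (G.addr_add_length_lt hlt)),
        G.encode_getD_addr hlt]
    simp only [wp_seq, wp_plus, wp_load, wp_minus, RamState.setReg_reg, RamState.setReg_mem,
      Nat.reduceEqDiff, reduceIte, hlength, haddr, hreg 1 (by omega), hone]
    refine ⟨⟨hmem, fun x hx => ?_, (G.addr_succ hlt).symm⟩, trivial, le_rfl⟩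
    simp only [show x ≠ 21 by omega, show x ≠ 22 by omega, show x ≠ 23 by omega, if_false,
      hreg x hx]

theorem IsFocused.wp_walkProgram {t : ℕ} (hs : G.IsFocused c r s) (hindex : s.reg rIndex = i)
    (hi : i ≤ n + m) :
    walkProgram.Wp (fun s' t' => G.IsFocused c r s' ∧ s'.reg rList = G.addr i ∧
      t' ≤ t + (5 * i + 3)) s t :=
  (HRLQ.wp_walkProgram hs.memory.input hs.zero hs.one hs.lists hindex hi).mono
    fun _ _ ⟨hmem, hreg, haddr, ht⟩ => ⟨hs.congr hmem hreg, haddr, ht⟩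

variable (G) in
/-- The invariant of `scanProgram`, after it has treated the first `i` residents on the list of the
hospital `h` that holds `r`. -/
structure ScanInvariant (c : Config (Fin n) (Fin m)) (r : Fin n) (h : Fin m) (i : ℕ)
    (s : RamState) : Prop extends G.IsFocused c r s where
  entry : s.reg rEntry = G.addr (n + h) + 1 + i
  seen : s.reg rSeen = 0 ↔ i ≤ (G.hospList h).idxOf r
  count : s.reg rCount = ((G.hospList h).take i).countP
    (· ∈ G.above (G.places c) h (G.levelAfter (c.used r)) r)

theorem ScanInvariant.wp_scanStep {t : ℕ} (hc : G.IsConsistent c) (hcur : c.cur r = some h)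
    (hs : G.ScanInvariant c r h i s) (hi : i < (G.hospList h).length) :
    scanStep.Wp (fun s' t' => G.ScanInvariant c r h (i + 1) s' ∧
      s'.reg rCounter = s.reg rCounter - 1 ∧ t' ≤ t + 25) s t := by
  generalize hx : (G.hospList h)[i] = x
  have hidx : (G.hospList h).idxOf x = i := hx ▸ (G.hospList_nodup h).idxOf_getElem i hi
  have hself : x.val = s.reg rRes ↔ i = (G.hospList h).idxOf r := by
    rw [hs.res, Fin.val_inj, ← hidx, List.idxOf_inj (hx ▸ List.getElem_mem hi)]
  have hheld : (c.cur x).elim 0 (fun h => h.val + 1) = s.reg rCur ↔ c.cur x = some h := by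
    rw [hs.cur_of_eq_some hcur]
    cases c.cur x <;> simp [Fin.ext_iff]
  refine (_root_.wp_scanStep (a := x) (b := (c.cur x).elim 0 (fun h => h.val + 1)) (w := c.used x)
    hs.one ?_ ?_ ?_).mono fun s' t' ⟨hmem, hreg, hcounter, hentry, hseen, hcount, ht⟩ =>
      ⟨⟨hs.toIsFocused.congr hmem hreg, ?_, ?_, ?_⟩, hcounter, ht⟩
  · rw [hs.entry, hs.memory.hospList_getElem h hi, hx]
  · rw [hs.curBase, hs.memory.cur]
  · rw [hs.usedBase, hs.memory.used]
  · rw [hentry, hs.entry, Nat.add_assoc]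
  · rw [hseen]
    by_cases hres : x.val = s.reg rRes
    · have hi_eq := hself.1 hres
      exact iff_of_false (by simp only [if_pos hres, one_ne_zero, not_false_eq_true]) (by omega)
    · have hi_ne := mt hself.2 hres
      rw [if_neg hres, hs.seen]
      omega
  · have hbefore : i < (G.hospList h).idxOf r ↔ x.val ≠ s.reg rRes ∧ s.reg rSeen = 0 := by
      rw [Ne, hself, hs.seen]
      omega
    rw [hcount, hs.count, countP_take_succ hi, hx]
    simp only [decide_eq_true_iff, hc.mem_above_places_iff hcur, hidx, hbefore, hheld, hs.used]

theorem IsFocused.wp_scanProgram {t : ℕ} (hc : G.IsConsistent c) (hcur : c.cur r = some h)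
    (hs : G.IsFocused c r s) (hlist : s.reg rList = G.addr (n + h)) :
    scanProgram.Wp (fun s' t' => G.IsFocused c r s' ∧
      s'.reg rCount = (G.above (G.places c) h (G.levelAfter (c.used r)) r).card ∧
      t' ≤ t + (26 * n + 5)) s t := by
  have hlength : (G.hospList h).length ≤ n := by
    simpa using (G.hospList_nodup h).length_le_card
  simp only [scanProgram, wp_seq, wp_const, wp_load, wp_plus, RamState.setReg_reg,
    RamState.setReg_mem, Nat.reduceEqDiff, reduceIte, hlist, hs.memory.hospList_length, hs.one]
  refine (wp_loop_countdown (N := (G.hospList h).length) (T := 25) (G.ScanInvariant c r h)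
    ?_ ⟨?_, ?_, ?_, ?_⟩ fun i hi s₁ t₁ hs₁ _ => hs₁.wp_scanStep hc hcur hi).mono
    fun s' t' ⟨hs', _⟩ => ⟨hs'.toIsFocused, ?_, by omega⟩
  · simp only [RamState.setReg_reg, Nat.reduceEqDiff, reduceIte]
  · exact (((hs.setReg (by omega)).setReg (by omega)).setReg (by omega)).setReg (by omega)
  · simp only [RamState.setReg_reg, reduceIte, Nat.add_zero]
  · simp only [RamState.setReg_reg, Nat.reduceEqDiff, reduceIte, Nat.zero_le]
  · simp only [RamState.setReg_reg, Nat.reduceEqDiff, reduceIte, List.take_zero, List.countP_nil]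
  · rw [hs'.count, List.take_length, hc.countP_mem_above hcur]

theorem IsFocused.wp_capacityProgram {t : ℕ} (hc : G.IsConsistent c) (hcur : c.cur r = some h)
    (hs : G.IsFocused c r s) :
    capacityProgram.Wp (fun s' t' => G.IsFocused c r s' ∧ s'.reg rCount = s.reg rCount ∧
      s'.reg rValue = G.levelCap h (G.levelAfter (c.used r)) ∧ t' ≤ t + 6) s t := by
  refine .of_forall_imp fun Q hQ => ?_
  have hupper : s.mem (1 + (h.val + 1)) = G.upper h := by
    rw [← hs.memory.upper, show 1 + (h.val + 1) = 2 + h by omega]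
  have hlower : s.mem (1 + (h.val + 1) + m) = G.lower h := by
    rw [← hs.memory.lower, show 1 + (h.val + 1) + m = 2 + m + h by omega]
  simp only [capacityProgram, noop, wp_seq, wp_plus, wp_minus, wp_load, wp_const, wp_branch,
    RamState.setReg_reg, RamState.setReg_mem, Nat.reduceEqDiff, reduceIte, hs.used, hs.one,
    hs.quotas, hs.cur_of_eq_some hcur, hs.hospitals, hupper, hlower]
  split_ifs
  all_goals
    refine hQ _ _ ⟨?_, ?_, ?_, by omega⟩
    · repeat refine IsFocused.setReg ?_ (by omega)
      exact hs
    · simp only [RamState.setReg_reg, Nat.reduceEqDiff, reduceIte]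
    · rw [RamState.setReg_reg, if_pos rfl, hc.levelCap_levelAfter hcur]
      split_ifs <;> first | rfl | omega

theorem IsFocused.wp_leaveProgram {t : ℕ} (hcur : c.cur r = some h) (hs : G.IsFocused c r s)
    (hcount : s.reg rCount = (G.above (G.places c) h (G.levelAfter (c.used r)) r).card)
    (hcap : s.reg rValue = G.levelCap h (G.levelAfter (c.used r))) :
    leaveProgram.Wp (fun s' t' => G.StepResult c r s' ∧ t' ≤ t + 7) s t := by
  refine .of_forall_imp fun Q hQ => ?_
  simp only [leaveProgram, wp_seq, wp_plus, wp_minus, wp_store, wp_const, wp_branch,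
    RamState.setReg_reg, RamState.setMem_reg, Nat.reduceEqDiff, reduceIte, hs.zero, hs.one, hs.pos,
    hs.res, hs.posAddr, hs.curAddr]
  split_ifs
  · refine hQ _ _ ⟨⟨?_, .inr ⟨?_, hs.memory, ?_⟩⟩, by omega⟩
    · exact ((hs.toGlobals.setReg (by omega)).setReg (by omega)).setReg (by omega)
    · exact advance_eq_none_iff.2 (.inr ⟨h, hcur, by omega⟩)
    · simp only [RamState.setReg_reg, reduceIte]
  · refine hQ _ _ ⟨⟨?_, .inl ⟨c.leave r, ?_, hs.memory.leave r, ?_⟩⟩, by omega⟩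
    · exact (((((hs.toGlobals.setReg (by omega)).setReg (by omega)).setMem).setReg
        (by omega)).setMem).setReg (by omega)
    · exact advance_eq_some_iff.2 (.inl ⟨h, hcur, by omega, rfl⟩)
    · simp only [RamState.setReg_reg, reduceIte]

theorem IsFocused.wp_heldProgram {t : ℕ} (hc : G.IsConsistent c) (hcur : c.cur r = some h)
    (hs : G.IsFocused c r s) :
    heldProgram.Wp (fun s' t' => G.StepResult c r s' ∧ t' ≤ t + (31 * n + 5 * m + 30)) s t := by
  simp only [heldProgram, wp_seq, wp_plus, wp_minus, RamState.setReg_reg, Nat.reduceEqDiff,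
    reduceIte, hs.residents, hs.one, hs.cur_of_eq_some hcur]
  refine (((hs.setReg (by omega)).setReg (by omega)).wp_walkProgram (i := n + h) ?_
    (by omega)).mono fun s₁ t₁ ⟨hs₁, hlist, _⟩ => ?_
  · simp only [RamState.setReg_reg, reduceIte]
    omega
  refine (hs₁.wp_scanProgram hc hcur hlist).mono fun s₂ t₂ ⟨hs₂, hcount, _⟩ => ?_
  refine (hs₂.wp_capacityProgram hc hcur).mono fun s₃ t₃ ⟨hs₃, hcount₃, hcap, _⟩ => ?_
  exact (hs₃.wp_leaveProgram hcur (hcount₃.trans hcount) hcap).mono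
    fun s₄ t₄ ⟨hres, _⟩ => ⟨hres, by omega⟩

theorem IsFocused.wp_proposeProgram {t : ℕ} (hcur : c.cur r = none)
    (hused : c.used r < G.numLevels) (hs : G.IsFocused c r s) (hlist : s.reg rList = G.addr r) :
    proposeProgram.Wp (fun s' t' => G.StepResult c r s' ∧ t' ≤ t + 9) s t := by
  refine .of_forall_imp fun Q hQ => ?_
  simp only [proposeProgram, wp_seq, wp_plus, wp_minus, wp_load, wp_store, wp_const, wp_branch,
    RamState.setReg_reg, RamState.setReg_mem, RamState.setMem_reg, Nat.reduceEqDiff, reduceIte,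
    hs.zero, hs.one, hs.used, hs.pos, hs.usedAddr, hs.posAddr, hs.curAddr, hlist,
    hs.memory.resList_length]
  split_ifs with hend
  · refine hQ _ _ ⟨⟨?_, .inl ⟨c.restart r, ?_, hs.memory.restart r, ?_⟩⟩, by omega⟩
    · exact (((((hs.toGlobals.setReg (by omega)).setReg (by omega)).setReg
        (by omega)).setMem).setMem).setReg (by omega)
    · exact advance_eq_some_iff.2 (.inr ⟨hcur, hused, .inr
        ⟨List.getElem?_eq_none (Nat.sub_eq_zero_iff_le.1 hend), rfl⟩⟩)
    · simp only [RamState.setReg_reg, reduceIte]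
  · have hpos : c.pos r < (G.resList r).length := by omega
    rw [hs.memory.resList_getElem r hpos]
    refine hQ _ _ ⟨⟨?_, .inl ⟨c.propose r (G.resList r)[c.pos r], ?_, hs.memory.propose r _, ?_⟩⟩,
      by omega⟩
    · refine Globals.setReg (Globals.setMem ?_) (by omega)
      repeat refine Globals.setReg ?_ (by omega)
      exact hs.toGlobals
    · exact advance_eq_some_iff.2 (.inr ⟨hcur, hused, .inl
        ⟨_, List.getElem?_eq_getElem hpos, rfl⟩⟩)
    · simp only [RamState.setReg_reg, reduceIte]

theorem IsFocused.wp_freeProgram {t : ℕ} (hcur : c.cur r = none) (hs : G.IsFocused c r s) :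
    freeProgram.Wp (fun s' t' => G.StepResult c r s' ∧ t' ≤ t + (5 * n + 15)) s t := by
  simp only [freeProgram, wp_seq, wp_plus, wp_minus, wp_branch, RamState.setReg_reg,
    Nat.reduceEqDiff, reduceIte, hs.zero, hs.one, hs.levels, hs.used, hs.res]
  split_ifs with hend
  · refine ⟨⟨(hs.toGlobals.setReg (by omega)).setReg (by omega), .inr ⟨?_, hs.memory, ?_⟩⟩,
      by omega⟩
    · exact advance_eq_none_iff.2 (.inl ⟨hcur, Nat.sub_eq_zero_iff_le.1 hend⟩)
    · simp only [RamState.setReg_reg, reduceIte]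
  · refine (((hs.setReg (by omega)).setReg (by omega)).wp_walkProgram (i := r) ?_ (by omega)).mono
      fun s₁ t₁ ⟨hs₁, hlist, _⟩ => ?_
    · simp only [RamState.setReg_reg, reduceIte, Nat.add_zero]
    exact (hs₁.wp_proposeProgram hcur (by omega) hlist).mono fun s₂ t₂ ⟨hres, _⟩ =>
      ⟨hres, by omega⟩

theorem Globals.wp_focusProgram {t : ℕ} (hs : G.Globals s) (hmem : G.Represents s.mem c)
    (hres : s.reg rRes = r) :
    focusProgram.Wp (fun s' t' => G.IsFocused c r s' ∧ t' ≤ t + 6) s t := by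
  simp only [focusProgram, wp_seq, wp_plus, wp_load, RamState.setReg_reg, RamState.setReg_mem,
    Nat.reduceEqDiff, reduceIte, hs.usedBase, hs.posBase, hs.curBase, hres, hmem.used, hmem.pos,
    hmem.cur]
  refine ⟨⟨?_, hmem, ?_, ?_, ?_, ?_, ?_, ?_, ?_⟩, le_rfl⟩
  · repeat refine Globals.setReg ?_ (by omega)
    exact hs
  all_goals simp only [RamState.setReg_reg, Nat.reduceEqDiff, reduceIte, hres]

theorem StepResult.setReg (hs : G.StepResult c r s) (hx : 11 ≤ x) :
    G.StepResult c r (s.setReg x v) := by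
  rw [StepResult, RamState.setReg_reg, if_neg (by omega)]
  exact ⟨hs.1.setReg (by omega), hs.2⟩

theorem Globals.wp_roundProgram {t : ℕ} (hc : G.IsConsistent c) (hs : G.Globals s)
    (hmem : G.Represents s.mem c) (hres : s.reg rRes = r) :
    roundProgram.Wp (fun s' t' => G.StepResult c r s' ∧ s'.reg rToDo = n - s'.reg rRes ∧
      t' ≤ t + (31 * n + 5 * m + 38)) s t := by
  rw [roundProgram, wp_seq]
  refine (hs.wp_focusProgram hmem hres).mono fun s₁ t₁ ⟨hs₁, _⟩ => ?_
  have hfinish : ∀ s₂ t₂, G.StepResult c r s₂ → t₂ ≤ t₁ + 1 + (31 * n + 5 * m + 30) →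
      (minus rToDo rNumRes rRes).Wp (fun s' t' => G.StepResult c r s' ∧
        s'.reg rToDo = n - s'.reg rRes ∧ t' ≤ t + (31 * n + 5 * m + 38)) s₂ t₂ :=
    fun s₂ t₂ hs₂ _ => wp_minus.2 ⟨hs₂.setReg (by omega), by
      simp only [RamState.setReg_reg, Nat.reduceEqDiff, reduceIte, hs₂.1.residents], by omega⟩
  simp only [wp_seq, wp_branch, hs₁.cur]
  rcases hcur : c.cur r with _ | h
  · exact (hs₁.wp_freeProgram hcur).mono fun s₂ t₂ ⟨hs₂, _⟩ => hfinish s₂ t₂ hs₂ (by omega)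
  · exact (hs₁.wp_heldProgram hc hcur).mono fun s₂ t₂ ⟨hs₂, ht₂⟩ => hfinish s₂ t₂ hs₂ ht₂

theorem wp_quotaProgram {t : ℕ} (hinput : s.mem = (RamState.init G.encode).mem)
    (hzero : s.reg rZero = 0) (hone : s.reg rOne = 1) (hhosp : s.reg rNumHosp = m)
    (hquotas : s.reg rQuotas = 0) :
    quotaProgram.Wp (fun s' t' => s'.mem = s.mem ∧
      (∀ x < 20, x ≠ rQuotas → s'.reg x = s.reg x) ∧ s'.reg rQuotas = ∑ h, G.lower h ∧
      t' ≤ t + (5 * m + 4)) s t := by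
  have hsum : ∑ h, G.lower h = ∑ j ∈ Finset.range m, G.encode.getD (2 + m + j) 0 := by
    rw [← Fin.sum_univ_eq_sum_range fun j => G.encode.getD (2 + m + j) 0]
    exact Finset.sum_congr rfl fun h _ => (G.encode_getD_lower h).symm
  simp only [quotaProgram, wp_seq, wp_plus, hsum]
  refine (wp_loop_countdown (N := m) (T := 4) (fun j s' => s'.mem = s.mem ∧
    (∀ x < 20, x ≠ rQuotas → s'.reg x = s.reg x) ∧
    s'.reg rQuotas = ∑ i ∈ Finset.range j, G.encode.getD (2 + m + i) 0 ∧
    s'.reg rEntry = 2 + m + j) ?_ ?_ ?_).mono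
    fun s' t' ⟨⟨hmem, hreg, hquotas, _⟩, _⟩ => ⟨hmem, hreg, hquotas, by omega⟩
  · simp only [RamState.setReg_reg, Nat.reduceEqDiff, reduceIte, hhosp, hzero, Nat.add_zero]
  · refine ⟨rfl, fun x hx _ => ?_, ?_, ?_⟩
    · simp only [RamState.setReg_reg, show x ≠ 22 by omega, show x ≠ 24 by omega, if_false]
    · simp only [RamState.setReg_reg, Nat.reduceEqDiff, reduceIte, hquotas, Finset.range_zero,
        Finset.sum_empty]
    · simp only [RamState.setReg_reg, Nat.reduceEqDiff, reduceIte, hone, hhosp]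
      omega
  · rintro j - s₁ t₁ ⟨hmem, hreg, hquotas₁, hentry⟩ -
    have hlower : s₁.mem (2 + m + j) = G.encode.getD (2 + m + j) 0 := by rw [hmem, hinput]; rfl
    simp only [wp_seq, wp_plus, wp_load, wp_minus, RamState.setReg_reg, RamState.setReg_mem,
      Nat.reduceEqDiff, reduceIte, hlower, hquotas₁, hentry, hreg 1 (by omega) (by omega), hone]
    refine ⟨⟨hmem, fun x hx hne => ?_, (Finset.sum_range_succ _ _).symm, rfl⟩, trivial, le_rfl⟩
    simp only [show x ≠ 22 by omega, show x ≠ 23 by omega, show x ≠ 24 by omega, hne, if_false,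
      hreg x hx hne]

theorem wp_initProgram (G : HRLQ (Fin n) (Fin m)) {t : ℕ} :
    initProgram.Wp (fun s' t' => G.Globals s' ∧ s'.mem = (RamState.init G.encode).mem ∧
      s'.reg rRes = 0 ∧ s'.reg rToDo = n ∧ t' ≤ t + (5 * n + 10 * m + 20))
      (RamState.init G.encode) t := by
  refine .of_forall_imp fun Q hQ => ?_
  have hmem : ∀ a, (RamState.init G.encode).mem a = G.encode.getD a 0 := fun _ => rfl
  have hzero : ∀ x, (RamState.init G.encode).reg x = 0 := fun _ => rfl
  simp only [initProgram, wp_seq, wp_const, wp_load, wp_plus, RamState.setReg_reg,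
    RamState.setReg_mem, Nat.reduceEqDiff, reduceIte, hmem, hzero, G.encode_getD_zero,
    G.encode_getD_one]
  refine (wp_walkProgram (G := G) (i := n + m) ?_ ?_ ?_ ?_ ?_ le_rfl).mono
    fun s₁ t₁ ⟨hmem₁, hreg₁, haddr, _⟩ => ?_
  · exact fun a _ => hmem a
  iterate 4 simp [RamState.setReg_reg, hzero]
  simp only [RamState.setReg_reg, hzero] at hreg₁
  refine (wp_quotaProgram (G := G) ?_ ?_ ?_ ?_ ?_).mono
    fun s₂ t₂ ⟨hmem₂, hreg₂, hquotas, _⟩ => ?_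
  · exact hmem₁
  iterate 4 simp [RamState.setReg_reg, hreg₁]
  simp only [RamState.setReg_reg] at hreg₂
  refine hQ _ _ ⟨?_, hmem₂.trans hmem₁, ?_, ?_, by omega⟩
  · constructor <;>
      simp [RamState.setReg_reg, hreg₂, hreg₁, haddr, addr_add, hquotas, numLevels]
  · simp [RamState.setReg_reg, hreg₂, hreg₁]
  · simp [RamState.setReg_reg, hreg₂, hreg₁]

theorem Globals.wp_outputProgram {t : ℕ} (hs : G.Globals s) (hmem : G.Represents s.mem c) :
    outputProgram.Wp (fun s' t' => s'.Outputs (G.places c).edges ∧ t' ≤ t + (6 * n + 4)) s t := by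
  have _ := G.add_le_length_encode
  simp only [outputProgram, wp_seq, wp_const, wp_plus]
  refine (wp_loop_countdown (N := n) (T := 5) (fun i s' => s'.reg rOne = 1 ∧ s'.reg rRes = i ∧
    s'.reg rEntry = G.encode.length + n + n + i ∧
    (∀ r : Fin n, r.val < i → s'.mem r = (c.cur r).elim 0 (fun h => h.val + 1)) ∧
    ∀ a, n ≤ a → s'.mem a = s.mem a) ?_ ?_ ?_).mono
    fun s' t' ⟨⟨_, _, _, hout, _⟩, _⟩ => ⟨fun r => ?_, by omega⟩
  · simp only [RamState.setReg_reg, Nat.reduceEqDiff, reduceIte, hs.zero, hs.residents,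
      Nat.add_zero]
  · simp [RamState.setReg_reg, RamState.setReg_mem, hs.zero, hs.one, hs.curBase]
  · rintro i hi s₁ t₁ ⟨hone, hres, hentry, hout, hrest⟩ -
    have hcur : s₁.mem (G.encode.length + n + n + i) =
        (c.cur ⟨i, hi⟩).elim 0 (fun h => h.val + 1) := by
      rw [hrest _ (by omega), ← hmem.cur]
    simp only [wp_seq, wp_load, wp_plus, wp_minus, wp_store, RamState.setReg_reg,
      RamState.setReg_mem, RamState.setMem_reg, RamState.setMem_mem, Nat.reduceEqDiff, reduceIte,
      hone, hres, hentry, hcur]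
    refine ⟨⟨trivial, trivial, rfl, fun r hr => ?_, fun a ha => ?_⟩, trivial, le_rfl⟩
    · split_ifs with heq
      · congr 2
        exact Fin.ext heq.symm
      · exact hout r (by omega)
    · rw [if_neg (by omega), hrest a ha]
  · rw [partner_edges_places, hout r r.isLt]

variable (G) in
/-- The invariant of the main loop: no resident before `rRes` can make a step. The parameter `k`
bounds the number of remaining rounds, as at most `n` rounds lie between two successful steps. -/
structure SearchInvariant (k : ℕ) (c : Config (Fin n) (Fin m)) (s : RamState) : Prop
    extends G.Globals s where
  consistent : G.IsConsistent c
  memory : G.Represents s.mem c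
  toDo : s.reg rToDo = n - s.reg rRes
  stuck : ∀ r : Fin n, r.val < s.reg rRes → G.advance c r = none
  rounds : (∑ r, G.potential c r) * (n + 1) + (n - s.reg rRes) = k

theorem SearchInvariant.start (hs : G.Globals s) (hmem : s.mem = (RamState.init G.encode).mem)
    (hres : s.reg rRes = 0) (htodo : s.reg rToDo = n) :
    G.SearchInvariant (n * (G.numLevels * (2 * m + 2) + 2 * m + 1) * (n + 1) + n)
      (Config.start (Fin n) (Fin m)) s where
  toGlobals := hs
  consistent := isConsistent_start
  memory := hmem ▸ .start G
  toDo := by omega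
  stuck := by simp [hres]
  rounds := by simp [potential, Config.start, hres]

theorem SearchInvariant.exists_lt {k : ℕ} (hs : G.SearchInvariant k c s)
    (hq : ∀ h, G.lower h ≤ G.upper h) (hres : s.reg rRes = r) (hs' : G.StepResult c r s')
    (htodo : s'.reg rToDo = n - s'.reg rRes) :
    ∃ k' < k, ∃ c', G.SearchInvariant k' c' s' := by
  have hrounds := hs.rounds
  obtain ⟨hglobals, ⟨c', ha, hmem, hres'⟩ | ⟨hnone, hmem, hres'⟩⟩ := hs'
  · have hlt := Nat.mul_le_mul_right (n + 1)
      (Nat.succ_le_of_lt (hs.consistent.sum_potential_advance_lt ha))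
    rw [Nat.succ_mul] at hlt
    exact ⟨_, by omega, c', hglobals, hs.consistent.advance hq ha, hmem, htodo,
      fun x hx => by omega, rfl⟩
  · refine ⟨_, by omega, c, hglobals, hs.consistent, hmem, htodo, fun x hx => ?_, rfl⟩
    obtain hx | hx : x.val < r.val ∨ x.val = r.val := by omega
    · exact hs.stuck x (hres ▸ hx)
    · rwa [Fin.ext hx]

theorem wp_matchingProgram (G : HRLQ (Fin n) (Fin m)) (hq : ∀ h, G.lower h ≤ G.upper h) :
    matchingProgram.Wp (fun s t => ∃ c, G.IsLevelStable (G.places c) ∧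
      s.Outputs (G.places c).edges ∧
      t ≤ (n * (G.numLevels * (2 * m + 2) + 2 * m + 1) * (n + 1) + n) * (31 * n + 5 * m + 39) +
        (11 * n + 10 * m + 25)) (RamState.init G.encode) 0 := by
  simp only [matchingProgram, wp_seq]
  refine G.wp_initProgram.mono fun s₁ t₁ ⟨hglobals, hmem, hres, htodo, _⟩ => ?_
  refine (wp_loop (T := 31 * n + 5 * m + 38) (fun k s => ∃ c, G.SearchInvariant k c s)
    ⟨_, .start hglobals hmem hres htodo⟩ ?_).mono ?_
  · rintro k s t ⟨c, hs⟩ hne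
    have hlt : s.reg rRes < n := by have htodo := hs.toDo; omega
    exact (hs.toGlobals.wp_roundProgram (r := ⟨s.reg rRes, hlt⟩) hs.consistent hs.memory rfl).mono
      fun s' t' ⟨hs', htodo', ht'⟩ => ⟨hs.exists_lt hq rfl hs' htodo', ht'⟩
  · rintro s₂ t₂ ⟨⟨k, c, hs⟩, hzero, ht₂⟩
    have hstuck : ∀ r, G.advance c r = none := fun r => hs.stuck r (by have htodo := hs.toDo; omega)
    refine (hs.toGlobals.wp_outputProgram hs.memory).mono fun s' t' ⟨hout, ht'⟩ =>
      ⟨c, hs.consistent.isLevelStable hstuck, hout, ?_⟩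
    rw [show 31 * n + 5 * m + 38 + 1 = 31 * n + 5 * m + 39 by omega] at ht₂
    omega

end HRLQ

/-- A polynomial bound for the running time of `matchingProgram`. -/
noncomputable def timeBound : Polynomial ℕ :=
  (.X * (2 * .X * (2 * .X + 2) + 2 * .X + 1) * (.X + 1) + .X) * (36 * .X + 39) + (21 * .X + 25)

theorem le_eval_timeBound {n m l k : ℕ} (hn : n ≤ k) (hm : m ≤ k) (hl : l ≤ 2 * k) :
    (n * (l * (2 * m + 2) + 2 * m + 1) * (n + 1) + n) * (31 * n + 5 * m + 39) +
      (11 * n + 10 * m + 25) ≤ timeBound.eval k := by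
  simp only [timeBound, Polynomial.eval_add, Polynomial.eval_mul, Polynomial.eval_X,
    Polynomial.eval_ofNat, Polynomial.eval_one]
  gcongr <;> omega

theorem HRLQ.exists_stable_computation {n m : ℕ} (G : HRLQ (Fin n) (Fin m))
    (hN : ∃ N, G.IsFeasible N) :
    ∃ M'' : Finset (G.Res × G.Copy), G.reduction.IsStable M'' ∧
      ∃ (t : ℕ) (s : RamState), matchingProgram.Runs (RamState.init G.encode) t s ∧
        t ≤ timeBound.eval G.encode.length ∧ s.Outputs (G.mapBack M'') := by
  obtain ⟨N, hN⟩ := hN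
  obtain ⟨t, s, hruns, c, hp, hout, ht⟩ := G.wp_matchingProgram hN.lower_le_upper
  rw [Nat.zero_add] at ht
  refine ⟨G.matchingOf (G.places c), HRLQ.isStable_matchingOf hp hN.lower_le_upper, t, s, hruns,
    ht.trans ?_, by rwa [HRLQ.mapBack_matchingOf hp]⟩
  have hlen := G.add_le_length_encode
  have hlower := hN.sum_lower_le
  rw [Fintype.card_fin] at hlower
  exact le_eval_timeBound (by omega) (by omega) (by
    rw [HRLQ.numLevels, Fintype.card_fin]
    omega)

end Programs

theorem mainTheorem7 :
    (∀ (R : Type u) (H : Type v) [Fintype R] [Fintype H] [DecidableEq R] [DecidableEq H]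
      (G : HRLQ R H) (M'' : Finset (G.Res × G.Copy)), G.reduction.IsStable M'' →
      (∃ N, G.IsFeasible N) →
      (∀ (σ τ : Correspondence R H) (N : Finset (R × H)), G.IsFeasible N →
        ∀ ρ : List (R × H),
          (IsAltCycle σ (G.mapBack M'') N ρ ∨
            (IsAltPath σ (G.mapBack M'') N ρ ∧ OneEndMatched (G.mapBack M'') ρ)) →
          G.IsFeasible (G.mapBack M'' ∆ ρ.toFinset) ∧
          G.votes τ (G.mapBack M'' ∆ ρ.toFinset) (G.mapBack M'') ≤
            G.votes τ (G.mapBack M'') (G.mapBack M'' ∆ ρ.toFinset)) ∧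
      (∀ τ : Correspondence R H, G.IsPopularAmongMaxFeasible τ (G.mapBack M''))) ∧
    (∃ (P : RamProgram) (p : Polynomial ℕ), ∀ (n m : ℕ) (G : HRLQ (Fin n) (Fin m)),
      (∃ N, G.IsFeasible N) →
      ∃ M'' : Finset (G.Res × G.Copy), G.reduction.IsStable M'' ∧
        ∃ (t : ℕ) (s : RamState), P.Runs (RamState.init G.encode) t s ∧
          t ≤ p.eval G.encode.length ∧ s.Outputs (G.mapBack M'')) := by
  refine ⟨?_, matchingProgram, timeBound, fun n m G hN => G.exists_stable_computation hN⟩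
  intro R H _ _ _ _ G M'' hst ⟨N₀, hN₀⟩
  have hp := HRLQ.isLevelStable_placementOf hst hN₀.lower_le_upper
  rw [← HRLQ.edges_placementOf hst.1.isSingleValued]
  exact ⟨fun σ τ N hN ρ hρ => hp.exchange σ τ hN hρ, fun τ => hp.isPopularAmongMaxFeasible τ hN₀⟩
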